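/- **Setting.** Let $c:[0,1]\times\mathbb R\to\{\pm1\}$ be an update rule: $c$ is measurable; if $U\sim\mathrm{Unif}[0,1]$ and $G\sim N(0,1)$ are independent then $0<\Pr[c(U,G)=1]<1$; and the boundary of $c^{-1}(1)$ is Lebesgue-null. Fix $T\in\mathbb N$. For a positive semidefinite $K\in\mathbb R^{T\times T}$ (indices $1,\dots,T$) and vectors $v=(v^1,\dots,v^T)$, $v^t\in\mathbb R^t$, let $\sigma^0\sim\mathrm{Unif}\{\pm1\}$, $(G^1,\dots,G^T)\sim N(0,K)$ and $U^1,\dots,U^T\sim\mathrm{Unif}[0,1]$ be independent and put, for $t=1,\dots,T$, $$h^t=G^t+\langle v^t,(\sigma^0,\dots,\sigma^{t-1})\rangle,\qquad \sigma^t=c(U^t,h^t).$$ Let $\mathcal C_{st}(K,v)=\mathbb E[\sigma^s\sigma^t]$ ($0\le s,t\le T$) and $\mathcal R_{st}(K,v)=\mathbb E[G^s\sigma^t]$ ($1\le s\le T$, $0\le t\le T$). $M^{(t)}$ denotes the upper left block of $M$ with indices up to $t$, and $M_{a:b,c:d}$ the block of rows $a,\dots,b$ and columns $c,\dots,d$.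 Call $(K,v)$ nondegenerate if $K^{(t)}$ and $C^{(t-1)}$ are invertible for $t=1,\dots,T$. In that case $A=\mathcal A(K,v)\in\mathbb R^{(T+1)\times(T+1)}$ (indices $0,\dots,T$) is the upper triangular matrix with zero diagonal such that, with $C=\mathcal C(K,v)$, $R=\mathcal R(K,v)$, $$A_{0:t-1,t}=\bigl(A^{(t-1)}-(K^{(t)})^{-1}R_{1:t,0:t-1}\bigr)(C^{(t-1)})^{-1}C_{0:t-1,t}+(K^{(t)})^{-1}R_{1:t,t},\qquad t=1,\dots,T;$$ otherwise $\mathcal A(K,v):=0$. **Integro-difference system.** For $\Sigma:[0,1]\to\mathbb R^{T\times T}$ with positive semidefinite values and $f^t:[0,1]\to\mathbb R^t$, $t=1,\dots,T$, write $C(y)=\mathcal C(\Sigma(y),f(y))$, $A(y)=\mathcal A(\Sigma(y),f(y))$. The system is, for all $x\in[0,1]$ (the entries of $C$ and $A$ being integrable on $[0,1]$), $$\Sigma(x)=\int_0^xC_{1:T,1:T}(y)\,dy+\int_x^1C_{0:T-1,0:T-1}(y)\,dy,$$ $$f^t(x)=\int_0^xA_{0:t-1,t}(y)\,dy+\int_x^1\begin{bmatrix}0\\A_{0:t-2,t-1}(y)\end{bmatrix}dy,\qquad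 t=1,\dots,T$$ (for $t=1$ the last bracket is $0$). **Difference equations.** For $\delta\in(0,1)$ let $n=\lfloor1/\delta\rfloor$. The system for $\Sigma^{j}\in\mathbb R^{T\times T}$ positive semidefinite and $f^{t,j}\in\mathbb R^t$, $j=0,\dots,n$, is, with $C^k=\mathcal C(\Sigma^k,f^{\cdot,k})$, $A^k=\mathcal A(\Sigma^k,f^{\cdot,k})$ and summation index $k\in\{1,\dots,n\}$, $$\Sigma^{j}=\delta\sum_{k<j}C^k_{1:T,1:T}+\delta\sum_{k\ge j}C^k_{0:T-1,0:T-1},$$ $$f^{t,j}=\delta\sum_{k<j}A^k_{0:t-1,t}+\delta\sum_{k>j}\begin{bmatrix}0\\A^k_{0:t-2,t-1}\end{bmatrix}+\delta A^j_{0:t-1,t-1},\qquad t=1,\dots,T.$$ Let $\Sigma^{\delta},f^{t,\delta}:[0,1]\to\mathbb R^{T\times T},\mathbb R^t$ be the piecewise linear functions with $\Sigma^{\delta}(j\delta)=\Sigma^{j}$, $f^{t,\delta}(j\delta)=f^{t,j}$ for $j=0,\dots,n$, constant on $[n\delta,1]$. **Theorem.** The integro-difference system has a solution $\Sigma,f^1,\dots,f^T$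 on $[0,1]$ which is $C^\infty$ on $[0,1]$ and nondegenerate at every $x\in[0,1]$, and it is the only solution on $[0,1]$. For every $\delta\in(0,1)$ the difference equations have exactly one solution, which is nondegenerate at every $j$; and, as $\delta\to0^+$, $\Sigma^{\delta}\to\Sigma$ and $f^{t,\delta}\to f^t$, $t=1,\dots,T$, uniformly on $[0,1]$. -/

import Mathlib

open MeasureTheory ProbabilityTheory Set Filter Topology
open scoped Matrix ContDiff unitInterval

namespace BlockScan

/-- An update rule `c : [0,1] × ℝ → {±1}`, where the first argument is the uniform random seed:
it is non-degenerate on a standard Gaussian input, and the boundary of `c⁻¹(1)` is null. -/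
structure IsUpdateRule (c : I × ℝ → ℝ) : Prop where
  measurable : Measurable c
  eq_one_or : ∀ p, c p = 1 ∨ c p = -1
  prob_pos : 0 < ((volume : Measure I).prod (gaussianReal 0 1)) {p | c p = 1}
  prob_lt_one : ((volume : Measure I).prod (gaussianReal 0 1)) {p | c p = 1} < 1
  boundary_null : volume (frontier {p : I × ℝ | c p = 1}) = 0

/-- Tuples `(v¹, …, v^T)` with `v^t ∈ ℝ^t`; the vector `v^{t+1} ∈ ℝ^{t+1}`, whose entries are
indexed by `0, …, t`, is stored at `t : Fin T`. -/
abbrev Vecs (T : ℕ) : Type := (t : Fin T) → Fin (t.val + 1) → ℝ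

/-- A sample point: the initial spin `σ⁰`, the Gaussian vector `(G¹, …, G^T)` (with `G^{t+1}` stored
at `t : Fin T`), and the seeds of the `T` updates. -/
abbrev Sample (T : ℕ) : Type := ℝ × EuclideanSpace ℝ (Fin T) × (Fin T → I)

/-- The uniform law on `{±1}`. -/
noncomputable def signLaw : Measure ℝ :=
  (2⁻¹ : ENNReal) • Measure.dirac 1 + (2⁻¹ : ENNReal) • Measure.dirac (-1)

/-- The joint law of `σ⁰ ∼ Unif{±1}`, `G ∼ N(0, K)` and i.i.d. uniform seeds, all independent. -/
noncomputable def sampleLaw {T : ℕ} (K : Matrix (Fin T) (Fin T) ℝ) : Measure (Sample T) :=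
  signLaw.prod ((multivariateGaussian 0 K).prod (Measure.pi fun _ : Fin T => (volume : Measure I)))

/-- The spins `σ^t`, `t = 0, …, T`, given by `σ^t = c(h^t)`, `h^t = G^t + ⟨v^t, (σ⁰, …, σ^{t-1})⟩`
(value `0` beyond the horizon `T`). -/
noncomputable def spin {T : ℕ} (c : I × ℝ → ℝ) (v : Vecs T) (w : Sample T) : ℕ → ℝ
  | 0 => w.1
  | t + 1 =>
    if h : t < T then
      c (w.2.2 ⟨t, h⟩,
        w.2.1 ⟨t, h⟩ + ∑ s : Fin (t + 1), v ⟨t, h⟩ s * spin c v w s.val)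
    else 0
  decreasing_by exact s.isLt

/-- The correlation matrix `C_{s,t} = E[σ^s σ^t]`, `0 ≤ s, t ≤ T`. -/
noncomputable def corr {T : ℕ} (c : I × ℝ → ℝ) (K : Matrix (Fin T) (Fin T) ℝ) (v : Vecs T) :
    Matrix (Fin (T + 1)) (Fin (T + 1)) ℝ :=
  Matrix.of fun s t => ∫ w, spin c v w s.val * spin c v w t.val ∂(sampleLaw K)

/-- The response matrix `R_{s,t} = E[G^s σ^t]`, `1 ≤ s ≤ T`, `0 ≤ t ≤ T`; the row of `G^{s+1}` is
stored at `s : Fin T`. -/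
noncomputable def resp {T : ℕ} (c : I × ℝ → ℝ) (K : Matrix (Fin T) (Fin T) ℝ) (v : Vecs T) :
    Matrix (Fin T) (Fin (T + 1)) ℝ :=
  Matrix.of fun s t => ∫ w, w.2.1 s * spin c v w t.val ∂(sampleLaw K)

/-- The upper left `m × n` block of a matrix. -/
def block {M N m n : ℕ} (hm : m ≤ M) (hn : n ≤ N) (B : Matrix (Fin M) (Fin N) ℝ) :
    Matrix (Fin m) (Fin n) ℝ :=
  B.submatrix (Fin.castLE hm) (Fin.castLE hn)

/-- The first `m` entries of column `j` of a matrix. -/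
def colHead {M N m : ℕ} (hm : m ≤ M) (B : Matrix (Fin M) (Fin N) ℝ) (j : Fin N) : Fin m → ℝ :=
  fun i => B (Fin.castLE hm i) j

/-- For given `K`, `C`, `R`, the block `A^{(t)}` (rows and columns `0, …, t`) of the strictly upper
triangular matrix `A` whose columns are given by `A_{0:0,0} = 0` and, for `t ≥ 1`,
`A_{0:t-1,t} = (A^{(t-1)} - (K^{(t)})⁻¹ R_{1:t,0:t-1}) (C^{(t-1)})⁻¹ C_{0:t-1,t}
  + (K^{(t)})⁻¹ R_{1:t,t}`.
It is obtained from `A^{(t-1)}` by adding this column, a diagonal zero and a last row of zeros. -/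
noncomputable def kernelBlock {T : ℕ} (K : Matrix (Fin T) (Fin T) ℝ)
    (C : Matrix (Fin (T + 1)) (Fin (T + 1)) ℝ) (R : Matrix (Fin T) (Fin (T + 1)) ℝ) :
    (t : ℕ) → t ≤ T → Matrix (Fin (t + 1)) (Fin (t + 1)) ℝ
  | 0, _ => 0
  | t + 1, h =>
    let A : Matrix (Fin (t + 1)) (Fin (t + 1)) ℝ := kernelBlock K C R t (Nat.le_of_succ_le h)
    let Kinv : Matrix (Fin (t + 1)) (Fin (t + 1)) ℝ := (block h h K)⁻¹
    let Cinv : Matrix (Fin (t + 1)) (Fin (t + 1)) ℝ :=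
      (block (Nat.le_succ_of_le h) (Nat.le_succ_of_le h) C)⁻¹
    let last : Fin (T + 1) := ⟨t + 1, Nat.lt_succ_of_le h⟩
    let a : Fin (t + 1) → ℝ :=
      ((A - Kinv * block h (Nat.le_succ_of_le h) R) * Cinv) *ᵥ
          colHead (Nat.le_succ_of_le h) C last
        + Kinv *ᵥ colHead h R last
    Matrix.of fun i j =>
      if hi : i.val < t + 1 then
        if hj : j.val < t + 1 then A ⟨i.val, hi⟩ ⟨j.val, hj⟩ else a ⟨i.val, hi⟩
      else 0

/-- `K^{(t)}` and `C^{(t-1)}` are invertible for `t = 1, …, T`. -/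
def Nondegenerate {T : ℕ} (c : I × ℝ → ℝ) (K : Matrix (Fin T) (Fin T) ℝ) (v : Vecs T) : Prop :=
  ∀ (t : ℕ) (h : t + 1 ≤ T), IsUnit (block h h K).det ∧
    IsUnit (block (Nat.le_succ_of_le h) (Nat.le_succ_of_le h) (corr c K v)).det

open Classical in
/-- The matrix `A` determined by `(K, v)`, with the convention that it vanishes when one of the
inverses in its recursion does not exist. -/
noncomputable def kernel {T : ℕ} (c : I × ℝ → ℝ) (K : Matrix (Fin T) (Fin T) ℝ) (v : Vecs T) :
    Matrix (Fin (T + 1)) (Fin (T + 1)) ℝ :=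
  if Nondegenerate c K v then kernelBlock K (corr c K v) (resp c K v) T le_rfl else 0

/-- With `t : Fin T` standing for the pass `t + 1`: the column `A_{0:t, t+1}`. -/
def newCol {T : ℕ} (A : Matrix (Fin (T + 1)) (Fin (T + 1)) ℝ) (t : Fin T) :
    Fin (t.val + 1) → ℝ :=
  colHead (Nat.le_succ_of_le t.isLt) A t.succ

/-- With `t : Fin T` standing for the pass `t + 1`: the vector `[0; A_{0:t-1, t}]`. -/
def shiftCol {T : ℕ} (A : Matrix (Fin (T + 1)) (Fin (T + 1)) ℝ) (t : Fin T) :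
    Fin (t.val + 1) → ℝ :=
  Fin.cons 0 (colHead (m := t.val) (Nat.le_succ_of_le t.isLt.le) A t.castSucc)

/-- With `t : Fin T` standing for the pass `t + 1`: the column `A_{0:t, t}`. -/
def oldCol {T : ℕ} (A : Matrix (Fin (T + 1)) (Fin (T + 1)) ℝ) (t : Fin T) :
    Fin (t.val + 1) → ℝ :=
  colHead (Nat.le_succ_of_le t.isLt) A t.castSucc

/-- `(S, f)` solves the integro-difference system on `[0,1]`. With `C(y)`, `A(y)` the correlation
matrix and kernel determined by `(S(y), f(y))`,
`S(x) = ∫₀ˣ C_{1:T,1:T} + ∫ₓ¹ C_{0:T-1,0:T-1}` and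
`f^t(x) = ∫₀ˣ A_{0:t-1,t} + ∫ₓ¹ [0; A_{0:t-2,t-1}]`;
`S(x)` is a covariance matrix and the integrals exist. -/
structure IsSolution {T : ℕ} (c : I × ℝ → ℝ) (S : ℝ → Matrix (Fin T) (Fin T) ℝ)
    (f : ℝ → Vecs T) : Prop where
  posSemidef : ∀ x ∈ Icc (0 : ℝ) 1, (S x).PosSemidef
  integrable_corr : ∀ s t,
    IntervalIntegrable (fun y => corr c (S y) (f y) s t) volume 0 1
  integrable_kernel : ∀ s t,
    IntervalIntegrable (fun y => kernel c (S y) (f y) s t) volume 0 1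
  eq_cov : ∀ x ∈ Icc (0 : ℝ) 1, ∀ s t : Fin T,
    S x s t = (∫ y in (0 : ℝ)..x, corr c (S y) (f y) s.succ t.succ)
      + ∫ y in x..(1 : ℝ), corr c (S y) (f y) s.castSucc t.castSucc
  eq_drift : ∀ x ∈ Icc (0 : ℝ) 1, ∀ (t : Fin T) (s : Fin (t.val + 1)),
    f x t s = (∫ y in (0 : ℝ)..x, newCol (kernel c (S y) (f y)) t s)
      + ∫ y in x..(1 : ℝ), shiftCol (kernel c (S y) (f y)) t s

/-- The number `⌊1/δ⌋` of blocks. -/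
noncomputable def numBlocks (δ : ℝ) : ℕ := ⌊1 / δ⌋₊

/-- `(S^j, f^j)`, `0 ≤ j ≤ ⌊1/δ⌋`, solves the difference equations at block size `δ`. The blocks are
`1, …, ⌊1/δ⌋` and, with `C^k`, `A^k` the correlation matrix and kernel determined by `(S^k, f^k)`,
`S^j = δ ∑_{k<j} C^k_{1:T,1:T} + δ ∑_{k≥j} C^k_{0:T-1,0:T-1}` and
`f^{t,j} = δ ∑_{k<j} A^k_{0:t-1,t} + δ ∑_{k>j} [0; A^k_{0:t-2,t-1}] + δ A^j_{0:t-1,t-1}`. -/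
structure IsDifferenceSolution {T : ℕ} (c : I × ℝ → ℝ) (δ : ℝ)
    (S : ℕ → Matrix (Fin T) (Fin T) ℝ) (f : ℕ → Vecs T) : Prop where
  posSemidef : ∀ j ≤ numBlocks δ, (S j).PosSemidef
  eq_cov : ∀ j ≤ numBlocks δ, ∀ s t : Fin T,
    S j s t = δ * (∑ k ∈ Finset.Icc 1 (numBlocks δ) with k < j,
        corr c (S k) (f k) s.succ t.succ)
      + δ * ∑ k ∈ Finset.Icc 1 (numBlocks δ) with j ≤ k,
        corr c (S k) (f k) s.castSucc t.castSucc
  eq_drift : ∀ j ≤ numBlocks δ, ∀ (t : Fin T) (s : Fin (t.val + 1)),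
    f j t s = δ * (∑ k ∈ Finset.Icc 1 (numBlocks δ) with k < j,
        newCol (kernel c (S k) (f k)) t s)
      + δ * (∑ k ∈ Finset.Icc 1 (numBlocks δ) with j < k,
        shiftCol (kernel c (S k) (f k)) t s)
      + δ * oldCol (kernel c (S j) (f j)) t s

/-- The piecewise linear function on `[0,1]` with value `a j` at `j δ`, `0 ≤ j ≤ ⌊1/δ⌋`, continued
by the constant `a ⌊1/δ⌋` to the right of `⌊1/δ⌋ δ`. -/
noncomputable def interp (δ : ℝ) (a : ℕ → ℝ) (x : ℝ) : ℝ :=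
  (1 - Int.fract (x / δ)) * a (min ⌊x / δ⌋₊ (numBlocks δ))
    + Int.fract (x / δ) * a (min (⌊x / δ⌋₊ + 1) (numBlocks δ))

end BlockScan

open BlockScan

namespace BlockScan

/-! The system is triangular in the passes. The spins `σ⁰, …, σ^t`, hence the entries of `C` and `A`
with indices up to `t`, depend only on the first `t` passes of `(K, v)`. In the equation for pass `t
+ 1`, the integral over `[x, 1]` and the self term of the block involve indices up to `t` only, so
they are known once the first `t` passes are; only the integral over `[0, x]` contains pass `t + 1`
itself. Pass `t + 1` thus solves a Volterra equation, and Grönwall's inequality gives uniqueness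
(`IsIntegralSolution.eqOn`). In the difference equations the corresponding sum runs over strictly
earlier blocks, so they form an explicit recursion in (pass, block): iterating the right-hand side
`T (n + 1)` times forgets the input, which gives existence and uniqueness together
(`iterate_discreteRhs_eq`).

The rates are smooth although `c` may jump. Summing over sign patterns turns the drift into a
deterministic shift for each pattern, and a translation moves this shift from the argument of `c`
into the Gaussian density (`integral_multivariateGaussian_shift`). The parameters then enter only
through an exponential family, which can be differentiated under the integral sign.

Nondegeneracy propagates. If `K` is positive definite, every sign pattern has positive probability,
so `C` is positive definite (`corr_posDef`). With only the first `t` passes of `K` nonsingular, the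
same argument after padding makes `C` positive on the spins `0, …, t`. The covariance is an average
of shifted blocks of `C`, so it is positive on the first `t + 1` passes, and induction on `t`
finishes. `exists_discrete_bounds_succ` makes this uniform in the block size: early blocks get their
lower bound from the blocks to the right, late ones from the early blocks.

Solutions of the difference equations therefore stay in one compact convex set of nondegenerate
states, and their interpolations are equi-Lipschitz. By Arzelà–Ascoli they have cluster points, and
each cluster point solves the integral equation (`exists_paths`), which proves existence. Uniqueness
of the limit makes the whole family converge. Differentiating the integral equation gives `W' = F(W)
- G(W)` with smooth `F`, `G`, so the solution is smooth. -/

/-! ### Differentiation of exponential integrals in their parameter. -/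

theorem hasFDerivAt_integral_exp_smul {Ω : Type*} [MeasurableSpace Ω] {μ : Measure Ω}
    {E : Type} [NormedAddCommGroup E] [NormedSpace ℝ E]
    {τ : Ω → E →L[ℝ] ℝ} (hτ : AEStronglyMeasurable τ μ)
    {G : Type} [NormedAddCommGroup G] [NormedSpace ℝ G]
    {g : Ω → G} (hg : AEStronglyMeasurable g μ) {θ : E} {r : ℝ} (hr : 0 < r)
    (hint : Integrable (fun w => Real.exp (τ w θ + r * ‖τ w‖) * ‖g w‖) μ) :
    HasFDerivAt (fun θ => ∫ w, Real.exp (τ w θ) • g w ∂μ)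
      (∫ w, Real.exp (τ w θ) • (τ w).smulRight (g w) ∂μ) θ := by
  have happ : ∀ θ' : E, AEStronglyMeasurable (fun w => Real.exp (τ w θ')) μ := fun θ' =>
    Real.continuous_exp.comp_aestronglyMeasurable
      ((ContinuousLinearMap.apply ℝ ℝ θ').continuous.comp_aestronglyMeasurable hτ)
  have hsm : AEStronglyMeasurable (fun w => (τ w).smulRight (g w)) μ := by
    have : Continuous fun p : (E →L[ℝ] ℝ) × G => p.1.smulRight p.2 := by fun_prop
    exact this.comp_aestronglyMeasurable (hτ.prodMk hg)
  -- The margin `r` is split in two: one half pays for moving from `θ` to `θ'`, the other absorbs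
  -- the factor `‖τ w‖` produced by the derivative.
  have hkey : ∀ w, ∀ θ' ∈ Metric.ball θ (r / 2),
      ‖Real.exp (τ w θ') • (τ w).smulRight (g w)‖
        ≤ (2 / r) * (Real.exp (τ w θ + r * ‖τ w‖) * ‖g w‖) := by
    intro w θ' hθ'
    rw [norm_smul, ContinuousLinearMap.norm_smulRight_apply, Real.norm_of_nonneg (Real.exp_pos _).le]
    have h1 : τ w θ' ≤ τ w θ + r / 2 * ‖τ w‖ := by
      have h2 : τ w (θ' - θ) ≤ ‖τ w‖ * ‖θ' - θ‖ :=
        (le_abs_self _).trans ((τ w).le_opNorm _)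
      have h3 : ‖θ' - θ‖ ≤ r / 2 := (mem_ball_iff_norm.1 hθ').le
      have h4 := mul_le_mul_of_nonneg_left h3 (norm_nonneg (τ w))
      rw [map_sub] at h2
      linarith
    have h5 : ‖τ w‖ ≤ (2 / r) * Real.exp (r / 2 * ‖τ w‖) := by
      have := Real.add_one_le_exp (r / 2 * ‖τ w‖)
      calc ‖τ w‖ = (2 / r) * (r / 2 * ‖τ w‖) := by field_simp
        _ ≤ _ := by gcongr; linarith
    calc Real.exp (τ w θ') * (‖τ w‖ * ‖g w‖)
        ≤ Real.exp (τ w θ + r / 2 * ‖τ w‖) * ((2 / r) * Real.exp (r / 2 * ‖τ w‖) * ‖g w‖) := by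
          gcongr
      _ = (2 / r) * ((Real.exp (τ w θ + r / 2 * ‖τ w‖) * Real.exp (r / 2 * ‖τ w‖)) * ‖g w‖) := by
          ring
      _ = _ := by rw [← Real.exp_add]; ring_nf
  refine hasFDerivAt_integral_of_dominated_of_fderiv_le (s := Metric.ball θ (r / 2))
    (F := fun θ w => Real.exp (τ w θ) • g w)
    (F' := fun θ w => Real.exp (τ w θ) • (τ w).smulRight (g w))
    (Metric.ball_mem_nhds θ (by positivity)) (Eventually.of_forall fun θ' => (happ θ').smul hg) ?_
    ((happ θ).smul hsm) (Eventually.of_forall hkey) (hint.const_mul (2 / r))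
    (Eventually.of_forall fun w θ' _ => ?_)
  · refine hint.mono ((happ θ).smul hg) (Eventually.of_forall fun w => ?_)
    rw [norm_smul, norm_mul, norm_norm, Real.norm_of_nonneg (Real.exp_pos _).le,
      Real.norm_of_nonneg (Real.exp_pos _).le]
    gcongr
    have := mul_nonneg hr.le (norm_nonneg (τ w))
    linarith
  · have h1 : HasFDerivAt (fun θ' => Real.exp (τ w θ')) (Real.exp (τ w θ') • τ w) θ' :=
      (τ w).hasFDerivAt.exp
    have h2 := h1.smul_const (g w)
    convert! h2 using 1
    ext x
    simp [mul_smul]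

/-- Integrals `θ ↦ ∫ exp(τ(θ)) g` are smooth where the integrand stays integrable after an
enlargement of the exponent. -/
theorem contDiffOn_integral_exp_smul {Ω : Type*} [MeasurableSpace Ω] {μ : Measure Ω}
    {E : Type} [NormedAddCommGroup E] [NormedSpace ℝ E] {U : Set E} (hU : IsOpen U)
    {τ : Ω → E →L[ℝ] ℝ} (hτ : AEStronglyMeasurable τ μ) (n : ℕ) :
    ∀ {G : Type} [NormedAddCommGroup G] [NormedSpace ℝ G]
      {g : Ω → G}, AEStronglyMeasurable g μ →
      (∀ θ ∈ U, ∃ r > 0, Integrable (fun w => Real.exp (τ w θ + r * ‖τ w‖) * ‖g w‖) μ) →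
      ContDiffOn ℝ n (fun θ => ∫ w, Real.exp (τ w θ) • g w ∂μ) U := by
  induction n with
  | zero =>
    intro G _ _ g hg hint
    rw [Nat.cast_zero, contDiffOn_zero]
    intro θ hθ
    obtain ⟨r, hr, hi⟩ := hint θ hθ
    exact (hasFDerivAt_integral_exp_smul hτ hg hr hi).continuousAt.continuousWithinAt
  | succ n ih =>
    intro G _ _ g hg hint
    have hsm : AEStronglyMeasurable (fun w => (τ w).smulRight (g w)) μ := by
      have : Continuous fun p : (E →L[ℝ] ℝ) × G => p.1.smulRight p.2 := by fun_prop
      exact this.comp_aestronglyMeasurable (hτ.prodMk hg)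
    rw [Nat.cast_succ, contDiffOn_succ_iff_hasFDerivWithinAt_of_uniqueDiffOn hU.uniqueDiffOn]
    -- The derivative is an integral of the same form with `g` replaced by `(τ w).smulRight (g w)`;
    -- this is why the induction runs over all target spaces `G`. The margin drops from `r` to `r /
    -- 2`.
    refine ⟨by simp, fun θ => ∫ w, Real.exp (τ w θ) • (τ w).smulRight (g w) ∂μ, ih hsm ?_, ?_⟩
    · intro θ hθ
      obtain ⟨r, hr, hi⟩ := hint θ hθ
      refine ⟨r / 2, by positivity, (hi.const_mul (2 / r)).mono ?_ (Eventually.of_forall fun w => ?_)⟩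
      · have : Continuous fun p : (E →L[ℝ] ℝ) × (E →L[ℝ] G) =>
            Real.exp (p.1 θ + r / 2 * ‖p.1‖) * ‖p.2‖ := by fun_prop
        exact this.comp_aestronglyMeasurable (hτ.prodMk hsm)
      · rw [Real.norm_of_nonneg (by positivity), Real.norm_of_nonneg (by positivity),
          ContinuousLinearMap.norm_smulRight_apply]
        have h5 : ‖τ w‖ ≤ (2 / r) * Real.exp (r / 2 * ‖τ w‖) := by
          have := Real.add_one_le_exp (r / 2 * ‖τ w‖)
          calc ‖τ w‖ = (2 / r) * (r / 2 * ‖τ w‖) := by field_simp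
            _ ≤ _ := by gcongr; linarith
        calc Real.exp (τ w θ + r / 2 * ‖τ w‖) * (‖τ w‖ * ‖g w‖)
            ≤ Real.exp (τ w θ + r / 2 * ‖τ w‖) * ((2 / r) * Real.exp (r / 2 * ‖τ w‖) * ‖g w‖) := by
              gcongr
          _ = (2 / r) * ((Real.exp (τ w θ + r / 2 * ‖τ w‖) * Real.exp (r / 2 * ‖τ w‖)) * ‖g w‖) := by
              ring
          _ = _ := by rw [← Real.exp_add]; ring_nf
    · intro θ hθ
      obtain ⟨r, hr, hi⟩ := hint θ hθ
      exact (hasFDerivAt_integral_exp_smul hτ hg hr hi).hasFDerivWithinAt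

/-! ### Gaussian densities and uniform positivity of quadratic forms. -/

theorem integrable_exp_neg_mul_sq_norm {E : Type*} [NormedAddCommGroup E] [InnerProductSpace ℝ E]
    [FiniteDimensional ℝ E] [MeasurableSpace E] [BorelSpace E] {b : ℝ} (hb : 0 < b) :
    Integrable (fun x : E => Real.exp (-b * ‖x‖ ^ 2)) := by
  have h := GaussianFourier.integrable_cexp_neg_mul_sq_norm_add (V := E) (b := (b : ℂ))
    (by simpa using hb) 0 0
  refine h.norm.congr (Eventually.of_forall fun x => ?_)
  simp only [Complex.norm_exp]
  congr 1
  simp [← Complex.ofReal_pow]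

/-- The standard Gaussian measure has density proportional to `exp(-‖x‖²/2)`. -/
theorem stdGaussian_eq_withDensity (E : Type*) [NormedAddCommGroup E] [InnerProductSpace ℝ E]
    [FiniteDimensional ℝ E] [MeasurableSpace E] [BorelSpace E] :
    ∃ κ : ℝ, 0 < κ ∧ stdGaussian E =
      (volume : Measure E).withDensity fun x => ENNReal.ofReal (κ * Real.exp (-(1 / 2) * ‖x‖ ^ 2)) := by
  have hint := integrable_exp_neg_mul_sq_norm (E := E) (b := 1 / 2) (by norm_num)
  have hval := GaussianFourier.integral_rexp_neg_mul_sq_norm (V := E) (b := 1 / 2) (by norm_num)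
  set Z : ℝ := ∫ x : E, Real.exp (-(1 / 2) * ‖x‖ ^ 2) with hZ
  have hZpos : 0 < Z := by rw [hval]; positivity
  refine ⟨Z⁻¹, by positivity, ?_⟩
  have hfin : IsFiniteMeasure ((volume : Measure E).withDensity
      fun x => ENNReal.ofReal (Z⁻¹ * Real.exp (-(1 / 2) * ‖x‖ ^ 2))) :=
    isFiniteMeasure_withDensity_ofReal (hint.const_mul _).2
  apply Measure.ext_of_charFun
  ext t
  rw [charFun_stdGaussian, charFun_apply, integral_withDensity_eq_integral_toReal_smul₀
    (by fun_prop) (by simp)]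
  have hc := GaussianFourier.integral_cexp_neg_mul_sq_norm_add (V := E) (b := (1 / 2 : ℂ))
    (by norm_num) Complex.I t
  have hc0 := GaussianFourier.integral_cexp_neg_mul_sq_norm_add (V := E) (b := (1 / 2 : ℂ))
    (by norm_num) 0 0
  have hZc : (Z : ℂ) = (Real.pi / (1 / 2 : ℂ)) ^ (Module.finrank ℝ E / 2 : ℂ) := by
    rw [hZ, ← integral_complex_ofReal]
    simp only [zero_mul, add_zero] at hc0
    rw [zero_pow two_ne_zero, zero_mul, zero_div, Complex.exp_zero,
      mul_one] at hc0
    rw [← hc0]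
    congr 1
    ext x
    push_cast
    rfl
  rw [← hZc] at hc
  have hstep : ∀ x : E, (ENNReal.ofReal (Z⁻¹ * Real.exp (-(1 / 2) * ‖x‖ ^ 2))).toReal •
      Complex.exp (inner ℝ x t * Complex.I) =
      (Z : ℂ)⁻¹ * Complex.exp (-(1 / 2 : ℂ) * ‖x‖ ^ 2 + Complex.I * inner ℝ t x) := by
    intro x
    rw [ENNReal.toReal_ofReal (by positivity), Complex.real_smul, Complex.exp_add]
    push_cast
    rw [real_inner_comm]
    ring_nf
  simp_rw [hstep]
  rw [integral_const_mul, hc, ← mul_assoc, inv_mul_cancel₀ (by exact_mod_cast hZpos.ne'), one_mul]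
  congr 1
  simp
  ring

/-- Continuous families of positive definite matrices over a compact set are uniformly positive. -/
theorem exists_le_quadForm_of_isCompact {X : Type*} [TopologicalSpace X] {S : Set X}
    (hS : IsCompact S) {n : ℕ} {M : X → Matrix (Fin n) (Fin n) ℝ}
    (hM : ∀ i j, ContinuousOn (fun z => M z i j) S) (hpos : ∀ z ∈ S, (M z).PosDef) :
    ∃ l : ℝ, 0 < l ∧ ∀ z ∈ S, ∀ x : Fin n → ℝ, l * (x ⬝ᵥ x) ≤ x ⬝ᵥ M z *ᵥ x := by
  have hcS : IsCompact {x : Fin n → ℝ | x ⬝ᵥ x = 1} := by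
    apply Metric.isCompact_of_isClosed_isBounded
    · exact isClosed_eq (by unfold dotProduct; fun_prop) continuous_const
    · refine (Metric.isBounded_closedBall (x := (0 : Fin n → ℝ)) (r := 1)).subset fun x hx => ?_
      rw [mem_closedBall_zero_iff, pi_norm_le_iff_of_nonneg zero_le_one]
      intro i
      have hx : ∑ j, x j * x j = 1 := hx
      have h1 : x i * x i ≤ 1 := hx ▸ Finset.single_le_sum (f := fun j => x j * x j)
        (fun j _ => mul_self_nonneg (x j)) (Finset.mem_univ i)
      rw [Real.norm_eq_abs]
      exact (sq_le_one_iff_abs_le_one _).1 (by rwa [sq])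
  have hcont : ContinuousOn (fun p : X × (Fin n → ℝ) => p.2 ⬝ᵥ M p.1 *ᵥ p.2)
      (S ×ˢ {x : Fin n → ℝ | x ⬝ᵥ x = 1}) := by
    unfold dotProduct Matrix.mulVec dotProduct
    refine continuousOn_finsetSum _ fun i _ => ContinuousOn.mul (by fun_prop) ?_
    refine continuousOn_finsetSum _ fun j _ => ContinuousOn.mul ?_ (by fun_prop)
    exact (hM i j).comp continuousOn_fst fun p hp => hp.1
  obtain ⟨l, hl, hlb⟩ : ∃ l : ℝ, 0 < l ∧ ∀ p ∈ S ×ˢ {x : Fin n → ℝ | x ⬝ᵥ x = 1},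
      l ≤ p.2 ⬝ᵥ M p.1 *ᵥ p.2 := by
    rcases (S ×ˢ {x : Fin n → ℝ | x ⬝ᵥ x = 1}).eq_empty_or_nonempty with he | hne
    · exact ⟨1, one_pos, fun p hp => by simp [he] at hp⟩
    · obtain ⟨p, hp, hmin⟩ := (hS.prod hcS).exists_isMinOn hne hcont
      refine ⟨_, ?_, fun q hq => hmin hq⟩
      have hne0 : p.2 ≠ 0 := by
        intro h0
        have : p.2 ⬝ᵥ p.2 = 1 := hp.2
        simp [h0] at this
      simpa using (hpos p.1 hp.1).dotProduct_mulVec_pos hne0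
  refine ⟨l, hl, fun z hz x => ?_⟩
  by_cases hx : x = 0
  · simp [hx]
  have hxx : 0 < x ⬝ᵥ x := by
    simpa using Matrix.dotProduct_star_self_pos_iff (v := x) |>.2 hx
  set a := Real.sqrt (x ⬝ᵥ x) with ha
  have hapos : 0 < a := Real.sqrt_pos.2 hxx
  have haa : a * a = x ⬝ᵥ x := Real.mul_self_sqrt hxx.le
  have h := hlb (z, a⁻¹ • x) ⟨hz, by
    change (a⁻¹ • x) ⬝ᵥ (a⁻¹ • x) = 1
    rw [smul_dotProduct, dotProduct_smul, ← haa]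
    simp only [smul_eq_mul]
    field_simp⟩
  simp only [Matrix.mulVec_smul, smul_dotProduct, dotProduct_smul, smul_eq_mul] at h
  rw [← haa]
  calc l * (a * a) ≤ (a⁻¹ * (a⁻¹ * (x ⬝ᵥ M z *ᵥ x))) * (a * a) := by gcongr
    _ = _ := by field_simp

theorem exists_le_quadForm {n : ℕ} {M : Matrix (Fin n) (Fin n) ℝ} (hM : M.PosDef) :
    ∃ l : ℝ, 0 < l ∧ ∀ x : Fin n → ℝ, l * (x ⬝ᵥ x) ≤ x ⬝ᵥ M *ᵥ x := by
  obtain ⟨l, hl, h⟩ := exists_le_quadForm_of_isCompact (isCompact_singleton (x := ()))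
    (M := fun _ => M) (fun i j => continuousOn_const) (fun _ _ => hM)
  exact ⟨l, hl, h () rfl⟩

section Density

open scoped MatrixOrder

/-- The unnormalized centered Gaussian density with precision matrix `Q`. -/
noncomputable def gaussKernel {T : ℕ} (Q : Matrix (Fin T) (Fin T) ℝ)
    (x : EuclideanSpace ℝ (Fin T)) : ℝ :=
  Real.exp (-(1 / 2) * (x.ofLp ⬝ᵥ Q *ᵥ x.ofLp))

theorem integral_multivariateGaussian {T : ℕ} {K : Matrix (Fin T) (Fin T) ℝ} (hK : K.PosDef)
    (g : EuclideanSpace ℝ (Fin T) → ℝ) :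
    ∫ x, g x ∂(multivariateGaussian 0 K) =
      (∫ x, gaussKernel K⁻¹ x * g x) / ∫ x, gaussKernel K⁻¹ x := by
  set R := CFC.sqrt K with hR
  have hRR : R * R = K := CFC.sqrt_mul_sqrt_self K hK.posSemidef.nonneg
  have hdetR : R.det ≠ 0 := by
    intro h0
    have := hK.det_pos
    rw [← hRR, Matrix.det_mul, h0] at this
    simp at this
  have hRsymm : Rᵀ = R := by
    have h : R.IsHermitian := by
      have : (0 : Matrix (Fin T) (Fin T) ℝ) ≤ R := by
        exact CFC.sqrt_nonneg K
      exact (Matrix.nonneg_iff_posSemidef.1 this).1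
    rw [← Matrix.conjTranspose_eq_transpose_of_trivial]
    exact h
  set L : EuclideanSpace ℝ (Fin T) →L[ℝ] EuclideanSpace ℝ (Fin T) :=
    Matrix.toEuclideanCLM (𝕜 := ℝ) R with hL
  have hLapp : ∀ x : EuclideanSpace ℝ (Fin T), (L x).ofLp = R *ᵥ x.ofLp := fun x => rfl
  have hinj : Function.Injective L := by
    intro x y hxy
    have h1 : R *ᵥ x.ofLp = R *ᵥ y.ofLp := by rw [← hLapp, ← hLapp, hxy]
    exact (WithLp.ofLp_injective 2) (Matrix.mulVec_injective_of_isUnit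
      ((Matrix.isUnit_iff_isUnit_det _).2 (isUnit_iff_ne_zero.2 hdetR)) h1)
  have hdetL : LinearMap.det (L : EuclideanSpace ℝ (Fin T) →ₗ[ℝ] EuclideanSpace ℝ (Fin T)) ≠ 0 := by
    have hker : LinearMap.ker (L : EuclideanSpace ℝ (Fin T) →ₗ[ℝ] EuclideanSpace ℝ (Fin T)) = ⊥ :=
      LinearMap.ker_eq_bot.2 hinj
    exact (LinearMap.isUnit_det _ ((Module.End.isUnit_iff _).2
      ⟨hinj, LinearMap.injective_iff_surjective.1 hinj⟩)).ne_zero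
  have hemb : MeasurableEmbedding L :=
    L.continuous.measurableEmbedding hinj
  have hmap := Measure.map_linearMap_addHaar_eq_smul_addHaar
    (volume : Measure (EuclideanSpace ℝ (Fin T))) hdetL
  obtain ⟨κ, hκ, hstd⟩ := stdGaussian_eq_withDensity (EuclideanSpace ℝ (Fin T))
  have hquad : ∀ x : EuclideanSpace ℝ (Fin T),
      gaussKernel K⁻¹ (L x) = Real.exp (-(1 / 2) * ‖x‖ ^ 2) := by
    intro x
    unfold gaussKernel
    congr 2
    have hinv : R⁻¹ * R = 1 := Matrix.nonsing_inv_mul _ (isUnit_iff_ne_zero.2 hdetR)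
    have h1 : (R⁻¹ * R⁻¹) *ᵥ R *ᵥ x.ofLp = R⁻¹ *ᵥ x.ofLp := by
      rw [Matrix.mulVec_mulVec, Matrix.mul_assoc, hinv, Matrix.mul_one]
    rw [hLapp, ← hRR, Matrix.mul_inv_rev, h1, Matrix.dotProduct_mulVec, ← Matrix.mulVec_transpose,
      Matrix.transpose_nonsing_inv, hRsymm, Matrix.mulVec_mulVec, hinv, Matrix.one_mulVec,
      EuclideanSpace.real_norm_sq_eq]
    simp [dotProduct, sq]
  -- The constant is left implicit here; the case `g = 1` identifies it as the inverse of the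
  -- integral of `gaussKernel K⁻¹`, and also shows that this integral is nonzero.
  obtain ⟨k, hk⟩ : ∃ k : ℝ, ∀ g : EuclideanSpace ℝ (Fin T) → ℝ,
      ∫ x, g x ∂(multivariateGaussian 0 K) = k * ∫ x, gaussKernel K⁻¹ x * g x := by
    refine ⟨κ * |(LinearMap.det
      (L : EuclideanSpace ℝ (Fin T) →ₗ[ℝ] EuclideanSpace ℝ (Fin T)))⁻¹|, fun g => ?_⟩
    have hfun : (fun x : EuclideanSpace ℝ (Fin T) => 0 +
        Matrix.toEuclideanCLM (𝕜 := ℝ) (CFC.sqrt K) x) = L := by ext x; simp [L, R]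
    rw [multivariateGaussian, hfun, hemb.integral_map, hstd,
      integral_withDensity_eq_integral_toReal_smul₀ (by fun_prop) (by simp)]
    have h1 : ∀ x : EuclideanSpace ℝ (Fin T),
        (ENNReal.ofReal (κ * Real.exp (-(1 / 2) * ‖x‖ ^ 2))).toReal • g (L x) =
        κ * (fun y => gaussKernel K⁻¹ y * g y) (L x) := by
      intro x
      rw [ENNReal.toReal_ofReal (by positivity), smul_eq_mul]
      simp only [hquad]
      ring
    simp_rw [h1]
    rw [integral_const_mul, ← hemb.integral_map fun y => gaussKernel K⁻¹ y * g y]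
    have hmap' : Measure.map L (volume : Measure (EuclideanSpace ℝ (Fin T))) = _ := hmap
    rw [hmap', integral_smul_measure, smul_eq_mul, ENNReal.toReal_ofReal (abs_nonneg _), mul_assoc]
  have h1 := hk fun _ => 1
  simp only [integral_const, probReal_univ, smul_eq_mul, mul_one] at h1
  have hne : (∫ x, gaussKernel K⁻¹ x) ≠ 0 := by
    intro h0
    rw [h0] at h1
    simp at h1
  rw [hk g, eq_div_iff hne]
  linear_combination (-(∫ x, gaussKernel K⁻¹ x * g x)) * h1

end Density

/-! ### The Gaussian exponential family in natural parameters. -/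

/-- The pairing of `x` with the natural parameters `(Q, η)` of the Gaussian exponential family,
`-½ ⟨x, Q x⟩ + ⟨η, x⟩`, as a linear function of the parameters. -/
noncomputable def natPairing {T : ℕ} (x : EuclideanSpace ℝ (Fin T)) :
    ((Fin T → Fin T → ℝ) × (Fin T → ℝ)) →L[ℝ] ℝ :=
  ∑ i, ∑ j, (-(1 / 2) * (x i * x j)) • ((ContinuousLinearMap.proj (R := ℝ) j).comp
      ((ContinuousLinearMap.proj (R := ℝ) i).comp
        (ContinuousLinearMap.fst ℝ (Fin T → Fin T → ℝ) (Fin T → ℝ))))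
    + ∑ i, x i • (ContinuousLinearMap.proj (R := ℝ) i).comp
        (ContinuousLinearMap.snd ℝ (Fin T → Fin T → ℝ) (Fin T → ℝ))

theorem natPairing_apply {T : ℕ} (x : EuclideanSpace ℝ (Fin T))
    (θ : (Fin T → Fin T → ℝ) × (Fin T → ℝ)) :
    natPairing x θ = -(1 / 2) * (x.ofLp ⬝ᵥ Matrix.of θ.1 *ᵥ x.ofLp) + θ.2 ⬝ᵥ x.ofLp := by
  simp only [natPairing, add_apply, sum_apply,
    smul_apply, ContinuousLinearMap.comp_apply, ContinuousLinearMap.proj_apply,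
    ContinuousLinearMap.coe_fst', ContinuousLinearMap.coe_snd', smul_eq_mul, dotProduct,
    Matrix.mulVec, Matrix.of_apply, Finset.mul_sum]
  congr 1
  · refine Finset.sum_congr rfl fun i _ => Finset.sum_congr rfl fun j _ => by ring
  · exact Finset.sum_congr rfl fun i _ => mul_comm _ _

theorem abs_dotProduct_mulVec_le {T : ℕ} (Q : Fin T → Fin T → ℝ) (x : EuclideanSpace ℝ (Fin T)) :
    |x.ofLp ⬝ᵥ Matrix.of Q *ᵥ x.ofLp| ≤ (T : ℝ) ^ 2 * ‖x‖ ^ 2 * ‖Q‖ := by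
  have hx : ∀ i, |x i| ≤ ‖x‖ := fun i => by simpa using PiLp.norm_apply_le x i
  have hQ : ∀ i j, |Q i j| ≤ ‖Q‖ := fun i j => (norm_le_pi_norm (Q i) j).trans (norm_le_pi_norm Q i)
  simp only [dotProduct, Matrix.mulVec, Matrix.of_apply, Finset.mul_sum]
  refine (Finset.abs_sum_le_sum_abs _ _).trans ((Finset.sum_le_sum fun i _ =>
    Finset.abs_sum_le_sum_abs _ _).trans ?_)
  calc ∑ i, ∑ j, |x i * (Q i j * x j)| ≤ ∑ _i : Fin T, ∑ _j : Fin T, ‖x‖ * (‖Q‖ * ‖x‖) := by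
        refine Finset.sum_le_sum fun i _ => Finset.sum_le_sum fun j _ => ?_
        rw [abs_mul, abs_mul]
        gcongr
        exacts [hx i, hQ i j, hx j]
    _ = _ := by simp; ring

theorem abs_dotProduct_le {T : ℕ} (v : Fin T → ℝ) (x : EuclideanSpace ℝ (Fin T)) :
    |v ⬝ᵥ x.ofLp| ≤ T * ‖x‖ * ‖v‖ := by
  have hx : ∀ i, |x i| ≤ ‖x‖ := fun i => by simpa using PiLp.norm_apply_le x i
  simp only [dotProduct]
  refine (Finset.abs_sum_le_sum_abs _ _).trans ?_
  calc ∑ i, |v i * x i| ≤ ∑ _i : Fin T, ‖v‖ * ‖x‖ := by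
        refine Finset.sum_le_sum fun i _ => ?_
        rw [abs_mul]
        gcongr
        exacts [norm_le_pi_norm v i, hx i]
    _ = _ := by simp; ring

theorem norm_natPairing_le {T : ℕ} (x : EuclideanSpace ℝ (Fin T)) :
    ‖natPairing x‖ ≤ (T : ℝ) ^ 2 * ‖x‖ ^ 2 + T * ‖x‖ := by
  refine ContinuousLinearMap.opNorm_le_bound _ (by positivity) fun θ => ?_
  rw [natPairing_apply, Real.norm_eq_abs]
  have h1 := abs_dotProduct_mulVec_le θ.1 x
  have h2 := abs_dotProduct_le θ.2 x
  have h3 : ‖θ.1‖ ≤ ‖θ‖ := norm_fst_le θ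
  have h4 : ‖θ.2‖ ≤ ‖θ‖ := norm_snd_le θ
  have h5 : (T : ℝ) ^ 2 * ‖x‖ ^ 2 * ‖θ.1‖ ≤ (T : ℝ) ^ 2 * ‖x‖ ^ 2 * ‖θ‖ := by gcongr
  have h6 : (T : ℝ) * ‖x‖ * ‖θ.2‖ ≤ T * ‖x‖ * ‖θ‖ := by gcongr
  refine (abs_add_le _ _).trans ?_
  rw [abs_mul, abs_neg, abs_of_pos (by norm_num : (0 : ℝ) < 1 / 2)]
  have h0 := abs_nonneg (x.ofLp ⬝ᵥ Matrix.of θ.1 *ᵥ x.ofLp)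
  linarith

theorem continuous_natPairing {T : ℕ} :
    Continuous (natPairing : EuclideanSpace ℝ (Fin T) → _) := by
  unfold natPairing
  fun_prop

/-- Parameters with a positive quadratic part. -/
def posParam (T : ℕ) : Set ((Fin T → Fin T → ℝ) × (Fin T → ℝ)) :=
  {θ | ∃ l : ℝ, 0 < l ∧ ∀ x : Fin T → ℝ, l * (x ⬝ᵥ x) ≤ x ⬝ᵥ Matrix.of θ.1 *ᵥ x}

theorem dotProduct_ofLp_self {T : ℕ} (x : EuclideanSpace ℝ (Fin T)) :
    x.ofLp ⬝ᵥ x.ofLp = ‖x‖ ^ 2 := by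
  rw [EuclideanSpace.real_norm_sq_eq]
  simp [dotProduct, sq]

theorem isOpen_posParam (T : ℕ) : IsOpen (posParam T) := by
  rw [Metric.isOpen_iff]
  rintro θ ⟨l, hl, h⟩
  -- A perturbation of this size changes the quadratic form by at most `(l / 2) ‖x‖²`, which leaves
  -- the lower bound `l / 2`.
  refine ⟨l / (2 * ((T : ℝ) ^ 2 + 1)), by positivity, fun θ' hθ' => ⟨l / 2, by positivity, fun x => ?_⟩⟩
  have h1 := abs_dotProduct_mulVec_le (θ'.1 - θ.1) (WithLp.toLp 2 x)
  have h2 : ‖θ'.1 - θ.1‖ ≤ l / (2 * ((T : ℝ) ^ 2 + 1)) :=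
    (norm_fst_le (θ' - θ)).trans (mem_ball_iff_norm.1 hθ').le
  have h3 : ‖WithLp.toLp 2 x‖ ^ 2 = x ⬝ᵥ x := (dotProduct_ofLp_self (WithLp.toLp 2 x)).symm
  have h4 : x ⬝ᵥ Matrix.of (θ'.1 - θ.1) *ᵥ x
      = x ⬝ᵥ Matrix.of θ'.1 *ᵥ x - x ⬝ᵥ Matrix.of θ.1 *ᵥ x := by
    rw [← Matrix.of_sub_of, Matrix.sub_mulVec, dotProduct_sub]
  have hxx : 0 ≤ x ⬝ᵥ x := by rw [← h3]; positivity
  simp only at h1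
  rw [h4, h3] at h1
  have h5 : (T : ℝ) ^ 2 * (x ⬝ᵥ x) * ‖θ'.1 - θ.1‖ ≤ l / 2 * (x ⬝ᵥ x) := by
    calc (T : ℝ) ^ 2 * (x ⬝ᵥ x) * ‖θ'.1 - θ.1‖
        ≤ (T : ℝ) ^ 2 * (x ⬝ᵥ x) * (l / (2 * ((T : ℝ) ^ 2 + 1))) := by gcongr
      _ = ((T : ℝ) ^ 2 / ((T : ℝ) ^ 2 + 1)) * (l / 2 * (x ⬝ᵥ x)) := by field_simp
      _ ≤ 1 * (l / 2 * (x ⬝ᵥ x)) := by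
          gcongr
          rw [div_le_one (by positivity)]
          linarith
      _ = _ := one_mul _
  have h6 := (abs_le.1 h1).1
  have h7 := h x
  linarith

theorem integrable_exp_natPairing {T : ℕ} {q : EuclideanSpace ℝ (Fin T) → ℝ}
    (hq : AEStronglyMeasurable q) {A : ℝ} (hqA : ∀ x, |q x| ≤ A * Real.exp ‖x‖)
    {θ : (Fin T → Fin T → ℝ) × (Fin T → ℝ)} (hθ : θ ∈ posParam T) :
    ∃ r > 0, Integrable fun x => Real.exp (natPairing x θ + r * ‖natPairing x‖) * ‖q x‖ := by
  obtain ⟨l, hl, h⟩ := hθ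
  have hA : 0 ≤ A := by
    have := (abs_nonneg _).trans (hqA 0)
    simpa using this
  -- With this `r` the enlargement `r ‖natPairing x‖` costs at most `(l / 8) ‖x‖²` plus a linear
  -- term. All linear terms are collected in `B ‖x‖` and cost another `(l / 4) ‖x‖²`; of the decay
  -- `-(l / 2) ‖x‖²` there remains `-(l / 8) ‖x‖²`.
  set r : ℝ := l / (8 * ((T : ℝ) ^ 2 + 1)) with hr
  have hrpos : 0 < r := by positivity
  set B : ℝ := T * ‖θ.2‖ + r * T + 1 with hB
  refine ⟨r, hrpos, ((integrable_exp_neg_mul_sq_norm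
    (E := EuclideanSpace ℝ (Fin T)) (b := l / 8) (by positivity)).const_mul
    (A * Real.exp (B ^ 2 * (1 / l)))).mono ?_ (Eventually.of_forall fun x => ?_)⟩
  · exact AEStronglyMeasurable.mul (Continuous.aestronglyMeasurable (by
      have := continuous_natPairing (T := T); fun_prop)) hq.norm
  rw [norm_mul, norm_norm, Real.norm_of_nonneg (Real.exp_pos _).le, Real.norm_eq_abs]
  refine le_trans ?_ (le_abs_self _)
  have h1 : natPairing x θ ≤ -(l / 2) * ‖x‖ ^ 2 + T * ‖x‖ * ‖θ.2‖ := by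
    rw [natPairing_apply]
    have h2 := h x.ofLp
    rw [dotProduct_ofLp_self] at h2
    have h3 := (abs_le.1 (abs_dotProduct_le θ.2 x)).2
    linarith
  have h2 : r * ‖natPairing x‖ ≤ l / 8 * ‖x‖ ^ 2 + r * T * ‖x‖ := by
    calc r * ‖natPairing x‖ ≤ r * ((T : ℝ) ^ 2 * ‖x‖ ^ 2 + T * ‖x‖) := by
          gcongr; exact norm_natPairing_le x
      _ = ((T : ℝ) ^ 2 / ((T : ℝ) ^ 2 + 1)) * (l / 8 * ‖x‖ ^ 2) + r * T * ‖x‖ := by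
          rw [hr]; field_simp
      _ ≤ 1 * (l / 8 * ‖x‖ ^ 2) + r * T * ‖x‖ := by
          gcongr
          rw [div_le_one (by positivity)]
          linarith
      _ = _ := by rw [one_mul]
  have h3 : B * ‖x‖ ≤ l / 4 * ‖x‖ ^ 2 + B ^ 2 * (1 / l) := by
    have h4 : 0 ≤ l / 4 * (‖x‖ - 2 * B / l) ^ 2 := by positivity
    have h5 : l / 4 * (‖x‖ - 2 * B / l) ^ 2
        = l / 4 * ‖x‖ ^ 2 - B * ‖x‖ + B ^ 2 * (1 / l) := by field_simp; ring
    linarith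
  calc Real.exp (natPairing x θ + r * ‖natPairing x‖) * |q x|
      ≤ Real.exp (natPairing x θ + r * ‖natPairing x‖) * (A * Real.exp ‖x‖) := by
        gcongr; exact hqA x
    _ = A * Real.exp (natPairing x θ + r * ‖natPairing x‖ + ‖x‖) := by
        rw [Real.exp_add _ ‖x‖]; ring
    _ ≤ A * Real.exp (B ^ 2 * (1 / l) + -(l / 8) * ‖x‖ ^ 2) := by
        refine mul_le_mul_of_nonneg_left (Real.exp_le_exp.2 ?_) hA
        have : B * ‖x‖ = T * ‖x‖ * ‖θ.2‖ + r * T * ‖x‖ + ‖x‖ := by rw [hB]; ring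
        linarith
    _ = _ := by rw [Real.exp_add]; ring

/-- All derivatives fall on the exponential, so `q` needs measurability and a growth bound but no
continuity. This is what allows discontinuous update rules. -/
theorem contDiffOn_integral_exp_natPairing {T : ℕ} {q : EuclideanSpace ℝ (Fin T) → ℝ}
    (hq : AEStronglyMeasurable q) {A : ℝ} (hqA : ∀ x, |q x| ≤ A * Real.exp ‖x‖) :
    ContDiffOn ℝ ∞ (fun θ => ∫ x, Real.exp (natPairing x θ) * q x) (posParam T) := by
  rw [contDiffOn_infty]
  intro n
  exact contDiffOn_integral_exp_smul (isOpen_posParam T)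
    continuous_natPairing.aestronglyMeasurable n hq
    fun θ hθ => integrable_exp_natPairing hq hqA hθ

theorem integrable_exp_natPairing_mul {T : ℕ} {q : EuclideanSpace ℝ (Fin T) → ℝ}
    (hq : AEStronglyMeasurable q) {A : ℝ} (hqA : ∀ x, |q x| ≤ A * Real.exp ‖x‖)
    {θ : (Fin T → Fin T → ℝ) × (Fin T → ℝ)} (hθ : θ ∈ posParam T) :
    Integrable fun x => Real.exp (natPairing x θ) * q x := by
  obtain ⟨r, hr, hi⟩ := integrable_exp_natPairing hq hqA hθ
  refine hi.mono (AEStronglyMeasurable.mul (Continuous.aestronglyMeasurable (by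
      have := continuous_natPairing (T := T); fun_prop)) hq) (Eventually.of_forall fun x => ?_)
  rw [norm_mul, norm_mul, norm_norm, Real.norm_of_nonneg (Real.exp_pos _).le,
    Real.norm_of_nonneg (Real.exp_pos _).le]
  gcongr
  have := mul_nonneg (le_of_lt hr) (norm_nonneg (natPairing x))
  linarith

/-! ### Expectations as sums over sign patterns. -/

/-- The spin `±1` encoded by a Boolean. -/
noncomputable def sign (b : Bool) : ℝ := if b then 1 else -1

theorem sign_injective : Function.Injective sign := by
  intro a b h
  cases a <;> cases b <;> simp [sign] at h ⊢ <;> norm_num at h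

theorem eq_sign_iff (a : ℝ) : (∃ b, a = sign b) ↔ a = 1 ∨ a = -1 := by
  simp [sign]
  tauto

theorem abs_sign (b : Bool) : |sign b| = 1 := by cases b <;> simp [sign]

/-- The drift `⟨v^t, (σ⁰, …, σ^{t-1})⟩` along a sign pattern. -/
noncomputable def patternDrift {T : ℕ} (v : Vecs T) (ε : Fin (T + 1) → Bool) (t : Fin T) : ℝ :=
  ∑ s : Fin (t.val + 1), v t s * sign (ε (Fin.castLE (Nat.succ_le_succ t.isLt.le) s))

/-- The probability that an update with field `x` produces the spin `b`. -/
noncomputable def updateProb (c : I × ℝ → ℝ) (b : Bool) (x : ℝ) : ℝ :=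
  ∫ u : I, if c (u, x) = sign b then 1 else 0

/-- The probability that updates in the given fields produce a sign pattern. -/
noncomputable def patternProb {T : ℕ} (c : I × ℝ → ℝ) (ε : Fin (T + 1) → Bool)
    (h : EuclideanSpace ℝ (Fin T)) : ℝ :=
  ∏ t : Fin T, updateProb c (ε t.succ) (h t)

section UpdateRule

variable {c : I × ℝ → ℝ} {T : ℕ}

theorem measurable_updateIndicator (hc : IsUpdateRule c) (b : Bool) :
    Measurable fun p : I × ℝ => if c p = sign b then (1 : ℝ) else 0 :=
  Measurable.ite (hc.measurable (measurableSet_singleton _)) measurable_const measurable_const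

theorem measurable_updateProb (hc : IsUpdateRule c) (b : Bool) : Measurable (updateProb c b) := by
  have h : StronglyMeasurable fun p : ℝ × I => if c (p.2, p.1) = sign b then (1 : ℝ) else 0 :=
    ((measurable_updateIndicator hc b).comp measurable_swap).stronglyMeasurable
  exact h.integral_prod_right.measurable

theorem updateProb_nonneg (b : Bool) (x : ℝ) : 0 ≤ updateProb c b x :=
  integral_nonneg fun u => by dsimp only; split_ifs <;> norm_num

theorem updateProb_le_one (b : Bool) (x : ℝ) : updateProb c b x ≤ 1 := by
  have h := norm_integral_le_of_norm_le_const (μ := (volume : Measure I))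
    (f := fun u : I => if c (u, x) = sign b then (1 : ℝ) else 0) (C := 1)
    (Eventually.of_forall fun u => by split_ifs <;> simp)
  simp only [probReal_univ, mul_one] at h
  exact (le_abs_self _).trans h

theorem measurable_patternProb (hc : IsUpdateRule c) (ε : Fin (T + 1) → Bool) :
    Measurable (patternProb c ε) :=
  Finset.measurable_prod _ fun t _ => (measurable_updateProb hc _).comp (by fun_prop)

theorem patternProb_nonneg (ε : Fin (T + 1) → Bool) (h : EuclideanSpace ℝ (Fin T)) :
    0 ≤ patternProb c ε h :=
  Finset.prod_nonneg fun _ _ => updateProb_nonneg _ _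

theorem patternProb_le_one (ε : Fin (T + 1) → Bool) (h : EuclideanSpace ℝ (Fin T)) :
    patternProb c ε h ≤ 1 :=
  Finset.prod_le_one (fun _ _ => updateProb_nonneg _ _) fun _ _ => updateProb_le_one _ _

instance isProbabilityMeasure_signLaw : IsProbabilityMeasure signLaw := ⟨by
  simp [signLaw, ENNReal.inv_two_add_inv_two]⟩

instance isProbabilityMeasure_sampleLaw (K : Matrix (Fin T) (Fin T) ℝ) :
    IsProbabilityMeasure (sampleLaw K) := by
  unfold sampleLaw
  infer_instance

theorem integral_signLaw (f : ℝ → ℝ) : ∫ x, f x ∂signLaw = (f 1 + f (-1)) / 2 := by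
  have hi : ∀ a : ℝ, Integrable f ((2⁻¹ : ENNReal) • Measure.dirac a) := fun a =>
    (integrable_dirac (by simp)).smul_measure (by simp)
  rw [signLaw, integral_add_measure (hi _) (hi _), integral_smul_measure, integral_smul_measure,
    integral_dirac, integral_dirac]
  simp
  ring

theorem ae_signLaw : ∀ᵐ x ∂signLaw, ∃ b, x = sign b := by
  have hset : MeasurableSet {x : ℝ | ∃ b, x = sign b} := by
    have : {x : ℝ | ∃ b, x = sign b} = {1, -1} := by
      ext x
      simp only [Set.mem_ofPred_eq, eq_sign_iff, mem_insert_iff, mem_singleton_iff]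
    rw [this]
    measurability
  rw [signLaw, ae_add_measure_iff]
  constructor <;> refine Measure.ae_smul_measure ?_ _ <;> rw [ae_dirac_iff hset]
  exacts [⟨true, rfl⟩, ⟨false, rfl⟩]

theorem spin_zero (v : Vecs T) (w : Sample T) : spin c v w 0 = w.1 := by
  rw [spin]

theorem spin_succ (v : Vecs T) (w : Sample T) (t : Fin T) :
    spin c v w (t.val + 1) = c (w.2.2 t,
      w.2.1 t + ∑ s : Fin (t.val + 1), v t s * spin c v w s.val) := by
  rw [spin, dif_pos t.isLt]

theorem measurable_spin (hc : IsUpdateRule c) (v : Vecs T) (s : ℕ) :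
    Measurable fun w : Sample T => spin c v w s := by
  induction s using Nat.strong_induction_on with
  | _ s ih =>
    match s with
    | 0 => simpa only [spin_zero] using measurable_fst
    | t + 1 =>
      by_cases h : t < T
      · have := fun w : Sample T => spin_succ (c := c) v w ⟨t, h⟩
        simp only at this
        simp_rw [this]
        refine hc.measurable.comp (Measurable.prodMk (by fun_prop) (Measurable.add (by fun_prop) ?_))
        exact Finset.measurable_sum _ fun s _ => (ih s.val s.isLt).const_mul _
      · simp_rw [spin, dif_neg h]
        exact measurable_const

theorem spin_eq_sign (hc : IsUpdateRule c) (v : Vecs T) {w : Sample T} (hw : ∃ b, w.1 = sign b)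
    (s : Fin (T + 1)) : ∃ b, spin c v w s.val = sign b := by
  refine Fin.cases ?_ (fun t => ?_) s
  · simpa [spin_zero] using hw
  · rw [Fin.val_succ, spin_succ, eq_sign_iff]
    exact hc.eq_one_or _

theorem ae_spin_eq_sign (hc : IsUpdateRule c) (K : Matrix (Fin T) (Fin T) ℝ) (v : Vecs T) :
    ∀ᵐ w ∂(sampleLaw K), ∀ s : Fin (T + 1), ∃ b, spin c v w s.val = sign b := by
  have : ∀ᵐ w ∂(sampleLaw K), ∃ b, w.1 = sign b :=
    (Measure.quasiMeasurePreserving_fst (μ := signLaw)).ae ae_signLaw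
  filter_upwards [this] with w hw s
  exact spin_eq_sign hc v hw s

/-- The indicator that a sample produces the given sign pattern. -/
noncomputable def patternIndicator (c : I × ℝ → ℝ) (v : Vecs T) (ε : Fin (T + 1) → Bool)
    (w : Sample T) : ℝ :=
  (if w.1 = sign (ε 0) then 1 else 0) *
    ∏ t : Fin T, if c (w.2.2 t, w.2.1 t + patternDrift v ε t) = sign (ε t.succ) then 1 else 0

/-- Along a prescribed pattern the drifts are deterministic. Conversely, if every update with the
prescribed drift returns the prescribed sign, induction on time shows that the actual spins follow
the pattern, so the recursion for the spins can be replaced by a product. -/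
theorem patternIndicator_eq (v : Vecs T) (ε : Fin (T + 1) → Bool) (w : Sample T) :
    patternIndicator c v ε w = if ∀ s : Fin (T + 1), spin c v w s.val = sign (ε s) then 1 else 0 := by
  have hdrift : ∀ t : Fin T, (∀ s : Fin (T + 1), s.val ≤ t.val → spin c v w s.val = sign (ε s)) →
      ∑ s : Fin (t.val + 1), v t s * spin c v w s.val = patternDrift v ε t := by
    intro t h
    refine Finset.sum_congr rfl fun s _ => ?_
    rw [← h (Fin.castLE (Nat.succ_le_succ t.isLt.le) s) (Nat.lt_succ_iff.1 s.isLt)]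
    rfl
  unfold patternIndicator
  split_ifs with h1 h2 h2
  · rw [one_mul, Finset.prod_eq_one]
    intro t _
    rw [if_pos]
    have := h2 t.succ
    rw [Fin.val_succ, spin_succ, hdrift t fun s _ => h2 s] at this
    exact this
  · rw [one_mul]
    push Not at h2
    by_contra hne
    have hall : ∀ t : Fin T, c (w.2.2 t, w.2.1 t + patternDrift v ε t) = sign (ε t.succ) := by
      intro t
      by_contra hcon
      exact hne (Finset.prod_eq_zero (Finset.mem_univ t) (if_neg hcon))
    obtain ⟨s, hs⟩ := h2
    have key : ∀ n : ℕ, ∀ s : Fin (T + 1), s.val = n → spin c v w s.val = sign (ε s) := by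
      intro n
      induction n using Nat.strong_induction_on with
      | _ n ih =>
        intro s
        refine Fin.cases (fun _ => ?_) (fun t ht => ?_) s
        · simpa [spin_zero] using h1
        · rw [Fin.val_succ, spin_succ, hdrift t fun s hs => ih s.val (by
            rw [← ht, Fin.val_succ]; omega) s rfl]
          exact hall t
    exact hs (key _ s rfl)
  · exfalso
    apply h1
    simpa [spin_zero] using h2 0
  · rw [zero_mul]

theorem measurable_patternIndicator (hc : IsUpdateRule c) (v : Vecs T) (ε : Fin (T + 1) → Bool) :
    Measurable (patternIndicator c v ε) := by
  refine Measurable.mul (Measurable.ite (measurable_fst (measurableSet_singleton _))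
    measurable_const measurable_const) (Finset.measurable_prod _ fun t _ => ?_)
  exact (measurable_updateIndicator hc (ε t.succ)).comp (by fun_prop)

theorem sum_patternIndicator_mul (v : Vecs T) {w : Sample T}
    (hw : ∀ s : Fin (T + 1), ∃ b, spin c v w s.val = sign b) (f : (Fin (T + 1) → ℝ) → ℝ) :
    f (fun s => spin c v w s.val) =
      ∑ ε : Fin (T + 1) → Bool, patternIndicator c v ε w * f fun s => sign (ε s) := by
  choose ε hε using hw
  rw [Finset.sum_eq_single ε]
  · rw [patternIndicator_eq, if_pos hε, one_mul]
    simp_rw [hε]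
  · intro ε' _ hne
    rw [patternIndicator_eq, if_neg, zero_mul]
    intro h
    apply hne
    funext s
    exact sign_injective ((h s).symm.trans (hε s))
  · simp

/-- For a fixed pattern each factor contains its own seed, so integrating out the independent seeds
factorizes into `patternProb`; the initial spin contributes the factor `1 / 2`. -/
theorem integral_patternIndicator_mul (hc : IsUpdateRule c) (K : Matrix (Fin T) (Fin T) ℝ)
    (v : Vecs T) (ε : Fin (T + 1) → Bool) {g : EuclideanSpace ℝ (Fin T) → ℝ}
    (hg : Integrable g (multivariateGaussian 0 K)) :
    Integrable (fun w => patternIndicator c v ε w * g w.2.1) (sampleLaw K) ∧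
    ∫ w, patternIndicator c v ε w * g w.2.1 ∂(sampleLaw K) =
      (1 / 2) * ∫ x, g x * patternProb c ε (x + WithLp.toLp 2 (patternDrift v ε))
        ∂(multivariateGaussian 0 K) := by
  constructor
  · have h1 : Integrable (fun w : Sample T => g w.2.1) (sampleLaw K) :=
      Integrable.comp_snd (f := fun p : EuclideanSpace ℝ (Fin T) × (Fin T → I) => g p.1)
        (hg.comp_fst _) signLaw
    refine h1.bdd_mul (c := 1) (measurable_patternIndicator hc v ε).aestronglyMeasurable
      (Eventually.of_forall fun w => ?_)
    rw [patternIndicator_eq]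
    split_ifs <;> simp
  set J : EuclideanSpace ℝ (Fin T) × (Fin T → I) → ℝ := fun p =>
    ∏ t : Fin T, if c (p.2 t, p.1 t + patternDrift v ε t) = sign (ε t.succ) then (1 : ℝ) else 0
    with hJ
  have hJm : Measurable J := Finset.measurable_prod _ fun t _ =>
    (measurable_updateIndicator hc (ε t.succ)).comp (by fun_prop)
  have hJb : ∀ p, ‖J p‖ ≤ 1 := by
    intro p
    rw [Real.norm_of_nonneg (Finset.prod_nonneg fun t _ => by split_ifs <;> norm_num)]
    exact Finset.prod_le_one (fun t _ => by split_ifs <;> norm_num)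
      fun t _ => by split_ifs <;> norm_num
  have hint : Integrable (fun p => J p * g p.1)
      ((multivariateGaussian 0 K).prod (Measure.pi fun _ : Fin T => (volume : Measure I))) :=
    (hg.comp_fst _).bdd_mul (c := 1) hJm.aestronglyMeasurable (Eventually.of_forall hJb)
  have h1 : ∀ w : Sample T, patternIndicator c v ε w * g w.2.1 =
      (fun a : ℝ => if a = sign (ε 0) then (1 : ℝ) else 0) w.1 * (fun p => J p * g p.1) w.2 := by
    intro w
    simp only [patternIndicator, hJ, mul_assoc]
  rw [integral_congr_ae (Eventually.of_forall h1), sampleLaw,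
    integral_prod_mul (fun a : ℝ => if a = sign (ε 0) then (1 : ℝ) else 0) (fun p => J p * g p.1),
    integral_signLaw, integral_prod _ hint]
  congr 1
  · cases ε 0 <;> simp [sign] <;> norm_num
  · refine integral_congr_ae (Eventually.of_forall fun x => ?_)
    simp only
    rw [integral_mul_const, mul_comm]
    congr 1
    rw [hJ]
    simp only
    rw [integral_fintype_prod_eq_prod (f := fun (t : Fin T) (u : I) =>
      if c (u, x t + patternDrift v ε t) = sign (ε t.succ) then (1 : ℝ) else 0)]
    rfl

/-- Expectations of the spins and the Gaussian vector as sums over sign patterns. -/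
theorem integral_spin_eq_sum (hc : IsUpdateRule c) (K : Matrix (Fin T) (Fin T) ℝ)
    (v : Vecs T) (f : (Fin (T + 1) → ℝ) → ℝ) {g : EuclideanSpace ℝ (Fin T) → ℝ}
    (hg : Integrable g (multivariateGaussian 0 K)) :
    ∫ w, g w.2.1 * f (fun s => spin c v w s.val) ∂(sampleLaw K) =
      ∑ ε : Fin (T + 1) → Bool, (1 / 2) * (f fun s => sign (ε s)) *
        ∫ x, g x * patternProb c ε (x + WithLp.toLp 2 (patternDrift v ε))
          ∂(multivariateGaussian 0 K) := by
  have h1 : ∫ w, g w.2.1 * f (fun s => spin c v w s.val) ∂(sampleLaw K) =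
      ∫ w, ∑ ε : Fin (T + 1) → Bool,
        (f fun s => sign (ε s)) * (patternIndicator c v ε w * g w.2.1) ∂(sampleLaw K) := by
    refine integral_congr_ae ?_
    filter_upwards [ae_spin_eq_sign hc K v] with w hw
    rw [sum_patternIndicator_mul v hw f, Finset.mul_sum]
    exact Finset.sum_congr rfl fun ε _ => by ring
  rw [h1, integral_finsetSum _ fun ε _ =>
    (integral_patternIndicator_mul hc K v ε hg).1.const_mul _]
  refine Finset.sum_congr rfl fun ε _ => ?_
  rw [integral_const_mul, (integral_patternIndicator_mul hc K v ε hg).2]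
  ring

end UpdateRule

/-! ### Correlations, responses and positivity of pattern probabilities. -/

section Correlations

variable {c : I × ℝ → ℝ} {T : ℕ}

/-- The probability of a sign pattern, up to the factor for the initial spin. -/
noncomputable def patternMass (c : I × ℝ → ℝ) (K : Matrix (Fin T) (Fin T) ℝ) (v : Vecs T)
    (ε : Fin (T + 1) → Bool) : ℝ :=
  ∫ x, patternProb c ε (x + WithLp.toLp 2 (patternDrift v ε)) ∂(multivariateGaussian 0 K)

theorem corr_eq_sum (hc : IsUpdateRule c) (K : Matrix (Fin T) (Fin T) ℝ) (v : Vecs T)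
    (s t : Fin (T + 1)) :
    corr c K v s t = ∑ ε : Fin (T + 1) → Bool,
      (1 / 2) * (sign (ε s) * sign (ε t)) * patternMass c K v ε := by
  have h := integral_spin_eq_sum hc K v (fun y => y s * y t)
    (g := fun _ => 1) (integrable_const _)
  simp only [one_mul] at h
  exact h

theorem integrable_eval_multivariateGaussian (K : Matrix (Fin T) (Fin T) ℝ) (s : Fin T) :
    Integrable (fun x : EuclideanSpace ℝ (Fin T) => x s) (multivariateGaussian 0 K) :=
  (EuclideanSpace.proj s : EuclideanSpace ℝ (Fin T) →L[ℝ] ℝ).integrable_comp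
    (IsGaussian.integrable_id (μ := multivariateGaussian 0 K))

theorem resp_eq_sum (hc : IsUpdateRule c) (K : Matrix (Fin T) (Fin T) ℝ) (v : Vecs T)
    (s : Fin T) (t : Fin (T + 1)) :
    resp c K v s t = ∑ ε : Fin (T + 1) → Bool, (1 / 2) * sign (ε t) *
      ∫ x, x s * patternProb c ε (x + WithLp.toLp 2 (patternDrift v ε))
        ∂(multivariateGaussian 0 K) :=
  integral_spin_eq_sum hc K v (fun y => y t) (integrable_eval_multivariateGaussian K s)

theorem patternMass_nonneg (K : Matrix (Fin T) (Fin T) ℝ) (v : Vecs T) (ε : Fin (T + 1) → Bool) :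
    0 ≤ patternMass c K v ε :=
  integral_nonneg fun _ => patternProb_nonneg _ _

theorem corr_comm (K : Matrix (Fin T) (Fin T) ℝ) (v : Vecs T) (s t : Fin (T + 1)) :
    corr c K v s t = corr c K v t s := by
  simp only [corr, Matrix.of_apply, mul_comm]

theorem corr_isHermitian (K : Matrix (Fin T) (Fin T) ℝ) (v : Vecs T) :
    (corr c K v).IsHermitian :=
  Matrix.ext fun s t => by simp [Matrix.conjTranspose_apply, corr_comm]

/-- This is `E[(∑ a_s σ^s)²]` sorted by sign pattern. It gives semidefiniteness at once, and
definiteness as soon as all patterns have positive mass. -/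
theorem dotProduct_corr_mulVec (hc : IsUpdateRule c) (K : Matrix (Fin T) (Fin T) ℝ) (v : Vecs T)
    (a : Fin (T + 1) → ℝ) :
    a ⬝ᵥ corr c K v *ᵥ a = ∑ ε : Fin (T + 1) → Bool,
      (1 / 2) * (∑ s, a s * sign (ε s)) ^ 2 * patternMass c K v ε := by
  simp only [dotProduct, Matrix.mulVec, corr_eq_sum hc, Finset.mul_sum, Finset.sum_mul]
  have : ∀ s : Fin (T + 1), ∑ t : Fin (T + 1), ∑ ε : Fin (T + 1) → Bool,
      a s * ((1 / 2) * (sign (ε s) * sign (ε t)) * patternMass c K v ε * a t) =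
      ∑ ε : Fin (T + 1) → Bool, ∑ t : Fin (T + 1),
      a s * ((1 / 2) * (sign (ε s) * sign (ε t)) * patternMass c K v ε * a t) :=
    fun s => Finset.sum_comm
  simp_rw [this]
  rw [Finset.sum_comm]
  refine Finset.sum_congr rfl fun ε _ => ?_
  rw [sq, Finset.sum_mul_sum, Finset.mul_sum, Finset.sum_mul]
  refine Finset.sum_congr rfl fun s _ => ?_
  rw [Finset.mul_sum, Finset.sum_mul]
  exact Finset.sum_congr rfl fun t _ => by ring

theorem corr_posSemidef (hc : IsUpdateRule c) (K : Matrix (Fin T) (Fin T) ℝ) (v : Vecs T) :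
    (corr c K v).PosSemidef := by
  refine Matrix.PosSemidef.of_dotProduct_mulVec_nonneg (corr_isHermitian K v) fun a => ?_
  rw [star_trivial, dotProduct_corr_mulVec hc]
  exact Finset.sum_nonneg fun ε _ => mul_nonneg (by positivity) (patternMass_nonneg K v ε)

theorem abs_corr_le_one (hc : IsUpdateRule c) (K : Matrix (Fin T) (Fin T) ℝ) (v : Vecs T)
    (s t : Fin (T + 1)) : |corr c K v s t| ≤ 1 := by
  have h := norm_integral_le_of_norm_le_const (μ := sampleLaw K)
    (f := fun w => spin c v w s.val * spin c v w t.val) (C := 1) (by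
      filter_upwards [ae_spin_eq_sign hc K v] with w hw
      obtain ⟨a, ha⟩ := hw s
      obtain ⟨b, hb⟩ := hw t
      rw [ha, hb, Real.norm_eq_abs, abs_mul, abs_sign, abs_sign, one_mul])
  rw [probReal_univ, mul_one] at h
  exact h

/-- Spins have modulus one and `|G^s| ≤ 1 + (G^s)²`, while the variance of `G^s` is `K s s`. No
invertibility of `K` is involved. -/
theorem abs_resp_le (hc : IsUpdateRule c) {K : Matrix (Fin T) (Fin T) ℝ} (hK : K.PosSemidef)
    (v : Vecs T) (s : Fin T) (t : Fin (T + 1)) : |resp c K v s t| ≤ 1 + K s s := by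
  have hmean : ∫ x : EuclideanSpace ℝ (Fin T), x s ∂(multivariateGaussian 0 K) = 0 := by
    have := (EuclideanSpace.proj s : EuclideanSpace ℝ (Fin T) →L[ℝ] ℝ).integral_comp_comm
      (IsGaussian.integrable_id (μ := multivariateGaussian 0 K))
    simpa using this
  have hL2 : MemLp (fun x : EuclideanSpace ℝ (Fin T) => x s) 2 (multivariateGaussian 0 K) :=
    (EuclideanSpace.proj s : EuclideanSpace ℝ (Fin T) →L[ℝ] ℝ).comp_memLp'
      (IsGaussian.memLp_two_id (μ := multivariateGaussian 0 K))
  have hvar := variance_eval_multivariateGaussian (μ := 0) hK s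
  rw [variance_of_integral_eq_zero hL2.aestronglyMeasurable.aemeasurable hmean] at hvar
  have hsq : Integrable (fun x : EuclideanSpace ℝ (Fin T) => 1 + x s ^ 2) (multivariateGaussian 0 K) :=
    (integrable_const 1).add hL2.integrable_sq
  have hsnd : Integrable (fun w : Sample T => 1 + w.2.1 s ^ 2) (sampleLaw K) :=
    Integrable.comp_snd (f := fun p : EuclideanSpace ℝ (Fin T) × (Fin T → I) => 1 + p.1 s ^ 2)
      (hsq.comp_fst _) signLaw
  calc |resp c K v s t| ≤ ∫ w, (1 + w.2.1 s ^ 2) ∂(sampleLaw K) := by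
        rw [← Real.norm_eq_abs, resp, Matrix.of_apply]
        refine norm_integral_le_of_norm_le hsnd ?_
        filter_upwards [ae_spin_eq_sign hc K v] with w hw
        obtain ⟨a, ha⟩ := hw t
        rw [ha, Real.norm_eq_abs, abs_mul, abs_sign, mul_one]
        nlinarith [sq_abs (w.2.1 s), sq_nonneg (|w.2.1 s| - 1)]
    _ = ∫ x : EuclideanSpace ℝ (Fin T), (1 + x s ^ 2) ∂(multivariateGaussian 0 K) := by
        have h1 := integral_fun_snd (μ := signLaw) (ν := (multivariateGaussian 0 K).prod
          (Measure.pi fun _ : Fin T => (volume : Measure I))) (fun p => 1 + p.1 s ^ 2)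
        have h2 := integral_fun_fst (μ := multivariateGaussian 0 K) (ν :=
          (Measure.pi fun _ : Fin T => (volume : Measure I))) (fun x => 1 + x s ^ 2)
        simp only [probReal_univ, one_smul] at h1 h2
        exact h1.trans h2
    _ = 1 + K s s := by
        rw [integral_add (integrable_const 1) hL2.integrable_sq, hvar]
        simp

/-- If a sign had probability zero at Lebesgue-almost every field, it would also have at
Gaussian-almost every field, and the rule would be constant almost surely on a standard Gaussian
input. -/
theorem volume_updateProb_ne_zero (hc : IsUpdateRule c) (b : Bool) :
    (volume : Measure ℝ) {x | updateProb c b x ≠ 0} ≠ 0 := by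
  intro h0
  have hmeas : ∀ b, MeasurableSet {p : I × ℝ | c p = sign b} := fun b =>
    hc.measurable (measurableSet_singleton _)
  have hγ : ∀ᵐ x ∂(gaussianReal 0 1), updateProb c b x = 0 :=
    (gaussianReal_absolutelyContinuous 0 one_ne_zero).ae_le (ae_iff.2 h0)
  have hzero : ((volume : Measure I).prod (gaussianReal 0 1)) {p | c p = sign b} = 0 := by
    rw [Measure.prod_apply_symm (hmeas b), lintegral_eq_zero_iff
      (measurable_measure_prodMk_right (hmeas b))]
    filter_upwards [hγ] with x hx
    have hm : MeasurableSet {u : I | c (u, x) = sign b} := measurable_prodMk_right (hmeas b)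
    have h1 : updateProb c b x = (volume : Measure I).real {u : I | c (u, x) = sign b} := by
      rw [← integral_indicator_one hm]
      rfl
    rw [h1, measureReal_eq_zero_iff] at hx
    exact hx
  cases b with
  | true => exact hc.prob_pos.ne' (by simpa [sign] using hzero)
  | false =>
    refine hc.prob_lt_one.ne ?_
    have hcompl : {p : I × ℝ | c p = 1} = {p | c p = sign false}ᶜ := by
      ext p
      simp only [Set.mem_ofPred_eq, mem_compl_iff, sign]
      rcases hc.eq_one_or p with h | h <;> rw [h] <;> norm_num
    rw [hcompl, prob_compl_eq_one_iff (hmeas false)]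
    exact hzero

theorem volume_support_patternProb (hc : IsUpdateRule c) (ε : Fin (T + 1) → Bool) :
    (volume : Measure (EuclideanSpace ℝ (Fin T))) (Function.support (patternProb c ε)) ≠ 0 := by
  have hset : Function.support (patternProb c ε) =
      WithLp.ofLp ⁻¹' (Set.univ.pi fun t : Fin T => {x | updateProb c (ε t.succ) x ≠ 0}) := by
    ext h
    simp [patternProb, Finset.prod_ne_zero_iff]
  have hm : MeasurableSet (Set.univ.pi fun t : Fin T => {x | updateProb c (ε t.succ) x ≠ 0}) :=
    MeasurableSet.univ_pi fun t => (measurable_updateProb hc _) (measurableSet_singleton 0).compl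
  rw [hset, (PiLp.volume_preserving_ofLp (Fin T)).measure_preimage hm.nullMeasurableSet,
    volume_pi_pi]
  exact Finset.prod_ne_zero_iff.2 fun t _ => volume_updateProb_ne_zero hc _

end Correlations

/-! ### Shifted Gaussian integrals and definiteness of the correlations. -/

section Smoothness

variable {c : I × ℝ → ℝ} {T : ℕ}

/-- The natural parameters of the shifted Gaussian with precision `Q` and mean `m`. -/
def natParam (Q : Matrix (Fin T) (Fin T) ℝ) (m : Fin T → ℝ) :
    (Fin T → Fin T → ℝ) × (Fin T → ℝ) := (fun i j => Q i j, Q *ᵥ m)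

theorem natParam_mem {K : Matrix (Fin T) (Fin T) ℝ} (hK : K.PosDef) (m : Fin T → ℝ) :
    natParam K⁻¹ m ∈ posParam T :=
  exists_le_quadForm hK.inv

theorem gaussKernel_sub {Q : Matrix (Fin T) (Fin T) ℝ} (hQ : Qᵀ = Q) (m : Fin T → ℝ)
    (h : EuclideanSpace ℝ (Fin T)) :
    gaussKernel Q (h - WithLp.toLp 2 m) =
      Real.exp (-(1 / 2) * (m ⬝ᵥ Q *ᵥ m)) * Real.exp (natPairing h (natParam Q m)) := by
  rw [← Real.exp_add, natPairing_apply, gaussKernel]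
  congr 1
  have h1 : m ⬝ᵥ Q *ᵥ h.ofLp = h.ofLp ⬝ᵥ Q *ᵥ m := by
    rw [Matrix.dotProduct_mulVec, ← Matrix.mulVec_transpose, hQ, dotProduct_comm]
  have h2 : (natParam Q m).2 ⬝ᵥ h.ofLp = h.ofLp ⬝ᵥ Q *ᵥ m := dotProduct_comm _ _
  have h3 : Matrix.of (natParam Q m).1 = Q := rfl
  have h4 : (h - WithLp.toLp 2 m).ofLp = h.ofLp - m := rfl
  rw [h2, h3, h4, Matrix.mulVec_sub, sub_dotProduct, dotProduct_sub, dotProduct_sub, h1]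
  ring

/-- Translating by `m` removes the parameters from the argument of `q`, which may be discontinuous,
and places them in the density, where they appear through the natural parameters `(K⁻¹, K⁻¹ m)`. -/
theorem integral_multivariateGaussian_shift {K : Matrix (Fin T) (Fin T) ℝ} (hK : K.PosDef)
    (m : Fin T → ℝ) (g q : EuclideanSpace ℝ (Fin T) → ℝ) :
    ∫ x, g x * q (x + WithLp.toLp 2 m) ∂(multivariateGaussian 0 K) =
      Real.exp (-(1 / 2) * (m ⬝ᵥ K⁻¹ *ᵥ m)) *
        (∫ h, Real.exp (natPairing h (natParam K⁻¹ m)) * (g (h - WithLp.toLp 2 m) * q h)) /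
        ∫ h, Real.exp (natPairing h (natParam K⁻¹ 0)) := by
  have hsymm : (K⁻¹)ᵀ = K⁻¹ := by
    rw [← Matrix.conjTranspose_eq_transpose_of_trivial]
    exact hK.inv.isHermitian
  rw [integral_multivariateGaussian hK]
  congr 1
  · rw [← integral_const_mul, ← integral_sub_right_eq_self _ (WithLp.toLp 2 m)]
    refine integral_congr_ae (Eventually.of_forall fun h => ?_)
    simp only
    rw [gaussKernel_sub hsymm, sub_add_cancel]
    ring
  · refine integral_congr_ae (Eventually.of_forall fun h => ?_)
    have := gaussKernel_sub hsymm 0 h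
    simpa using this

theorem abs_patternProb_le (ε : Fin (T + 1) → Bool) (x : EuclideanSpace ℝ (Fin T)) :
    |patternProb c ε x| ≤ 1 * Real.exp ‖x‖ := by
  rw [abs_of_nonneg (patternProb_nonneg _ _), one_mul]
  exact (patternProb_le_one _ _).trans (Real.one_le_exp (norm_nonneg _))

theorem abs_eval_mul_patternProb_le (ε : Fin (T + 1) → Bool) (s : Fin T)
    (x : EuclideanSpace ℝ (Fin T)) : |x s * patternProb c ε x| ≤ 1 * Real.exp ‖x‖ := by
  rw [abs_mul, abs_of_nonneg (patternProb_nonneg _ _), one_mul]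
  have h1 : |x s| ≤ ‖x‖ := by simpa using PiLp.norm_apply_le x s
  have h2 := Real.add_one_le_exp ‖x‖
  calc |x s| * patternProb c ε x ≤ |x s| * 1 := by gcongr; exact patternProb_le_one _ _
    _ ≤ _ := by linarith

theorem integral_exp_natPairing_pos {q : EuclideanSpace ℝ (Fin T) → ℝ} (hq : Measurable q)
    (hq0 : ∀ x, 0 ≤ q x) (hq1 : ∀ x, |q x| ≤ 1 * Real.exp ‖x‖)
    (hsupp : (volume : Measure (EuclideanSpace ℝ (Fin T))) (Function.support q) ≠ 0)
    {θ : (Fin T → Fin T → ℝ) × (Fin T → ℝ)} (hθ : θ ∈ posParam T) :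
    0 < ∫ x, Real.exp (natPairing x θ) * q x := by
  rw [integral_pos_iff_support_of_nonneg (fun x => mul_nonneg (Real.exp_pos _).le (hq0 x))
    (integrable_exp_natPairing_mul hq.aestronglyMeasurable hq1 hθ)]
  have : Function.support (fun x => Real.exp (natPairing x θ) * q x) = Function.support q := by
    ext x
    simp [Real.exp_ne_zero]
  rw [this]
  exact pos_iff_ne_zero.2 hsupp

theorem integral_exp_natPairing_natParam_pos {K : Matrix (Fin T) (Fin T) ℝ} (hK : K.PosDef) :
    0 < ∫ h, Real.exp (natPairing h (natParam K⁻¹ 0)) := by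
  have h := integral_exp_natPairing_pos (T := T) (q := fun _ => 1) measurable_const
    (fun _ => zero_le_one) (fun x => by simp) (by
      rw [Function.support_const one_ne_zero]
      exact NeZero.ne _) (natParam_mem hK 0)
  simpa using h

theorem patternMass_pos (hc : IsUpdateRule c) {K : Matrix (Fin T) (Fin T) ℝ} (hK : K.PosDef)
    (v : Vecs T) (ε : Fin (T + 1) → Bool) : 0 < patternMass c K v ε := by
  have h := integral_multivariateGaussian_shift hK (patternDrift v ε) (fun _ => 1) (patternProb c ε)
  simp only [one_mul] at h
  rw [patternMass, h]
  refine div_pos (mul_pos (Real.exp_pos _) ?_) (integral_exp_natPairing_natParam_pos hK)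
  exact integral_exp_natPairing_pos (measurable_patternProb hc ε) (patternProb_nonneg ε)
    (abs_patternProb_le ε) (volume_support_patternProb hc ε) (natParam_mem hK _)

theorem corr_posDef (hc : IsUpdateRule c) {K : Matrix (Fin T) (Fin T) ℝ} (hK : K.PosDef)
    (v : Vecs T) : (corr c K v).PosDef := by
  refine Matrix.PosDef.of_dotProduct_mulVec_pos (corr_isHermitian K v) fun a ha => ?_
  rw [star_trivial, dotProduct_corr_mulVec hc]
  have hterm : ∀ ε : Fin (T + 1) → Bool,
      0 ≤ (1 / 2) * (∑ s, a s * sign (ε s)) ^ 2 * patternMass c K v ε := fun ε =>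
    mul_nonneg (by positivity) (patternMass_nonneg K v ε)
  -- One strictly positive term suffices: the pattern with the signs of `a`, for which the linear
  -- form equals `∑ |a s|`.
  refine Finset.sum_pos' (fun ε _ => hterm ε) ⟨fun s => decide (0 ≤ a s), Finset.mem_univ _, ?_⟩
  have h1 : ∑ s, a s * sign (decide (0 ≤ a s)) = ∑ s, |a s| := by
    refine Finset.sum_congr rfl fun s _ => ?_
    by_cases h : 0 ≤ a s
    · simp [sign, h, abs_of_nonneg h]
    · simp [sign, h, abs_of_neg (not_le.1 h)]
  have h2 : 0 < ∑ s, |a s| := by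
    obtain ⟨s, hs⟩ := Function.ne_iff.1 ha
    exact Finset.sum_pos' (fun _ _ => abs_nonneg _) ⟨s, Finset.mem_univ _, abs_pos.2 hs⟩
  have h3 := patternMass_pos hc hK v fun s => decide (0 ≤ a s)
  rw [h1]
  positivity

end Smoothness

/-! ### Smoothness of matrix operations and of the rates on positive definite states. -/

/-- All entries of a matrix-valued function are smooth on `S`. -/
def SmoothEntries {X : Type*} [NormedAddCommGroup X] [NormedSpace ℝ X] {m n : Type*} (S : Set X)
    (M : X → Matrix m n ℝ) : Prop :=
  ∀ i j, ContDiffOn ℝ ∞ (fun x => M x i j) S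

namespace SmoothEntries

variable {X : Type*} [NormedAddCommGroup X] [NormedSpace ℝ X] {S : Set X} {m n p : Type*}

theorem mul [Fintype n] {M : X → Matrix m n ℝ} {N : X → Matrix n p ℝ} (hM : SmoothEntries S M)
    (hN : SmoothEntries S N) : SmoothEntries S fun x => M x * N x := fun i j => by
  simp only [Matrix.mul_apply]
  exact ContDiffOn.sum fun k _ => (hM i k).mul (hN k j)

theorem sub {M N : X → Matrix m n ℝ} (hM : SmoothEntries S M) (hN : SmoothEntries S N) :
    SmoothEntries S fun x => M x - N x := fun i j => (hM i j).sub (hN i j)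

theorem mulVec [Fintype n] {M : X → Matrix m n ℝ} {v : X → n → ℝ} (hM : SmoothEntries S M)
    (hv : ∀ j, ContDiffOn ℝ ∞ (fun x => v x j) S) (i : m) :
    ContDiffOn ℝ ∞ (fun x => (M x *ᵥ v x) i) S := by
  simp only [Matrix.mulVec, dotProduct]
  exact ContDiffOn.sum fun k _ => (hM i k).mul (hv k)

theorem det [Fintype n] [DecidableEq n] {M : X → Matrix n n ℝ} (hM : SmoothEntries S M) :
    ContDiffOn ℝ ∞ (fun x => (M x).det) S := by
  simp only [Matrix.det_apply]
  refine ContDiffOn.sum fun e _ => ContDiffOn.const_smul _ ?_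
  exact contDiffOn_prod fun i _ => hM _ _

/-- Cramer's rule: the entries are quotients of determinants, hence rational in the entries of `M`.
-/
theorem inv [Fintype n] [DecidableEq n] {M : X → Matrix n n ℝ} (hM : SmoothEntries S M)
    (hdet : ∀ x ∈ S, (M x).det ≠ 0) : SmoothEntries S fun x => (M x)⁻¹ := fun i j => by
  simp only [Matrix.inv_def, Matrix.smul_apply, Ring.inverse_eq_inv', smul_eq_mul,
    Matrix.adjugate_apply]
  refine (hM.det.inv hdet).mul (det fun k l => ?_)
  simp only [Matrix.updateRow_apply]
  split_ifs
  · exact contDiffOn_const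
  · exact hM k l

theorem block {T N a b : ℕ} {M : X → Matrix (Fin T) (Fin N) ℝ} (hM : SmoothEntries S M)
    (ha : a ≤ T) (hb : b ≤ N) : SmoothEntries S fun x => BlockScan.block ha hb (M x) :=
  fun _ _ => hM _ _

end SmoothEntries

theorem contDiffOn_dotProduct {X : Type*} [NormedAddCommGroup X] [NormedSpace ℝ X] {S : Set X}
    {n : Type*} [Fintype n] {u v : X → n → ℝ} (hu : ∀ j, ContDiffOn ℝ ∞ (fun x => u x j) S)
    (hv : ∀ j, ContDiffOn ℝ ∞ (fun x => v x j) S) : ContDiffOn ℝ ∞ (fun x => u x ⬝ᵥ v x) S := by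
  simp only [dotProduct]
  exact ContDiffOn.sum fun k _ => (hu k).mul (hv k)

/-- The recursion for the kernel is smooth where the inverses exist. -/
theorem smoothEntries_kernelBlock {X : Type*} [NormedAddCommGroup X] [NormedSpace ℝ X] {S : Set X}
    {T : ℕ} {K : X → Matrix (Fin T) (Fin T) ℝ} {C : X → Matrix (Fin (T + 1)) (Fin (T + 1)) ℝ}
    {R : X → Matrix (Fin T) (Fin (T + 1)) ℝ} (hK : SmoothEntries S K) (hC : SmoothEntries S C)
    (hR : SmoothEntries S R) :
    ∀ (t : ℕ) (ht : t ≤ T),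
      (∀ x ∈ S, ∀ (s : ℕ) (hs : s + 1 ≤ T), s < t → (block hs hs (K x)).det ≠ 0 ∧
        (block (Nat.le_succ_of_le hs) (Nat.le_succ_of_le hs) (C x)).det ≠ 0) →
      SmoothEntries S fun x => kernelBlock (K x) (C x) (R x) t ht
  | 0, _, _ => fun _ _ => by simp only [kernelBlock]; exact contDiffOn_const
  | t + 1, ht, hdet => by
    have hA := smoothEntries_kernelBlock hK hC hR t (Nat.le_of_succ_le ht)
      fun x hx s hs hst => hdet x hx s hs (Nat.lt_succ_of_lt hst)
    have hKi := (hK.block ht ht).inv fun x hx => (hdet x hx t ht (Nat.lt_succ_self t)).1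
    have hCi := (hC.block (Nat.le_succ_of_le ht) (Nat.le_succ_of_le ht)).inv
      fun x hx => (hdet x hx t ht (Nat.lt_succ_self t)).2
    intro i j
    simp only [kernelBlock, Matrix.of_apply]
    split_ifs with hi hj
    · exact hA _ _
    · refine ContDiffOn.add ?_ ?_
      · exact ((hA.sub (hKi.mul (hR.block ht (Nat.le_succ_of_le ht)))).mul hCi).mulVec
          (fun k => hC _ _) _
      · exact hKi.mulVec (fun k => hR _ _) _
    · exact contDiffOn_const

/-- A pair `(K, v)` as a point of a normed space. -/
abbrev State (T : ℕ) : Type := (Fin T → Fin T → ℝ) × Vecs T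

/-- The covariance matrix of a state. -/
abbrev State.cov {T : ℕ} (z : State T) : Matrix (Fin T) (Fin T) ℝ := Matrix.of z.1

/-- States with positive definite covariance. -/
def posStates (T : ℕ) : Set (State T) := {z | z.cov.PosDef}

section Smoothness

variable {c : I × ℝ → ℝ} {T : ℕ}

theorem contDiff_state_cov (i j : Fin T) : ContDiff ℝ ∞ fun z : State T => z.1 i j :=
  ((ContinuousLinearMap.proj (R := ℝ) j).comp ((ContinuousLinearMap.proj (R := ℝ) i).comp
    (ContinuousLinearMap.fst ℝ (Fin T → Fin T → ℝ) (Vecs T)))).contDiff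

theorem contDiff_state_drift (t : Fin T) (s : Fin (t.val + 1)) :
    ContDiff ℝ ∞ fun z : State T => z.2 t s :=
  ((ContinuousLinearMap.proj (R := ℝ) s).comp ((ContinuousLinearMap.proj (R := ℝ)
    (φ := fun t : Fin T => Fin (t.val + 1) → ℝ) t).comp
    (ContinuousLinearMap.snd ℝ (Fin T → Fin T → ℝ) (Vecs T)))).contDiff

theorem smoothEntries_cov (S : Set (State T)) : SmoothEntries S fun z : State T => z.cov :=
  fun i j => (contDiff_state_cov i j).contDiffOn

theorem smoothEntries_cov_inv : SmoothEntries (posStates T) fun z : State T => z.cov⁻¹ :=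
  (smoothEntries_cov _).inv fun _ hz => hz.det_pos.ne'

theorem contDiff_patternDrift (ε : Fin (T + 1) → Bool) (t : Fin T) :
    ContDiff ℝ ∞ fun z : State T => patternDrift z.2 ε t :=
  ContDiff.sum fun s _ => (contDiff_state_drift t s).mul contDiff_const

theorem contDiffOn_natParam {m : State T → Fin T → ℝ}
    (hm : ∀ i, ContDiffOn ℝ ∞ (fun z => m z i) (posStates T)) :
    ContDiffOn ℝ ∞ (fun z : State T => natParam z.cov⁻¹ (m z)) (posStates T) := by
  refine ContDiffOn.prodMk ?_ ?_
  · exact contDiffOn_pi.2 fun i => contDiffOn_pi.2 fun j => smoothEntries_cov_inv i j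
  · exact contDiffOn_pi.2 fun i => smoothEntries_cov_inv.mulVec hm i

theorem contDiffOn_integral_natParam {m : State T → Fin T → ℝ}
    (hm : ∀ i, ContDiffOn ℝ ∞ (fun z => m z i) (posStates T))
    {q : EuclideanSpace ℝ (Fin T) → ℝ} (hq : Measurable q) (hq1 : ∀ x, |q x| ≤ 1 * Real.exp ‖x‖) :
    ContDiffOn ℝ ∞ (fun z : State T => ∫ h, Real.exp (natPairing h (natParam z.cov⁻¹ (m z))) * q h)
      (posStates T) :=
  (contDiffOn_integral_exp_natPairing hq.aestronglyMeasurable hq1).comp (contDiffOn_natParam hm)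
    fun _ hz => natParam_mem hz _

theorem contDiffOn_normalizer :
    ContDiffOn ℝ ∞ (fun z : State T => ∫ h, Real.exp (natPairing h (natParam z.cov⁻¹ 0)))
      (posStates T) := by
  have := contDiffOn_integral_natParam (T := T) (m := fun _ => 0) (fun _ => contDiffOn_const)
    (q := fun _ => 1) measurable_const (fun x => by simp)
  simpa only [mul_one] using this

theorem contDiffOn_exp_quad (ε : Fin (T + 1) → Bool) :
    ContDiffOn ℝ ∞ (fun z : State T => Real.exp (-(1 / 2) *
      (patternDrift z.2 ε ⬝ᵥ z.cov⁻¹ *ᵥ patternDrift z.2 ε))) (posStates T) := by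
  refine ContDiffOn.exp (contDiffOn_const.mul ?_)
  exact contDiffOn_dotProduct (fun j => (contDiff_patternDrift ε j).contDiffOn)
    (smoothEntries_cov_inv.mulVec fun j => (contDiff_patternDrift ε j).contDiffOn)

theorem contDiffOn_patternMass (hc : IsUpdateRule c) (ε : Fin (T + 1) → Bool) :
    ContDiffOn ℝ ∞ (fun z : State T => patternMass c z.cov z.2 ε) (posStates T) := by
  have h1 := ((contDiffOn_exp_quad ε).mul (contDiffOn_integral_natParam
    (fun j => (contDiff_patternDrift ε j).contDiffOn) (measurable_patternProb hc ε)
    (abs_patternProb_le ε))).div contDiffOn_normalizer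
    fun z hz => (integral_exp_natPairing_natParam_pos hz).ne'
  refine h1.congr fun z hz => ?_
  have h := integral_multivariateGaussian_shift hz (patternDrift z.2 ε) (fun _ => 1)
    (patternProb c ε)
  simp only [one_mul] at h
  exact h

theorem contDiffOn_integral_eval_mul_patternProb (hc : IsUpdateRule c) (ε : Fin (T + 1) → Bool)
    (s : Fin T) :
    ContDiffOn ℝ ∞ (fun z : State T =>
      ∫ x, x s * patternProb c ε (x + WithLp.toLp 2 (patternDrift z.2 ε))
        ∂(multivariateGaussian 0 z.cov)) (posStates T) := by
  have hm1 : Measurable fun x : EuclideanSpace ℝ (Fin T) => x s * patternProb c ε x :=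
    Measurable.mul (by fun_prop) (measurable_patternProb hc ε)
  have h1 := ((contDiffOn_exp_quad ε).mul (ContDiffOn.sub (contDiffOn_integral_natParam
    (fun j => (contDiff_patternDrift ε j).contDiffOn) hm1
    (abs_eval_mul_patternProb_le (c := c) ε s)) (ContDiffOn.mul
    (contDiff_patternDrift ε s).contDiffOn (contDiffOn_integral_natParam
    (fun j => (contDiff_patternDrift ε j).contDiffOn) (measurable_patternProb hc ε)
    (abs_patternProb_le ε))))).div contDiffOn_normalizer
    fun z hz => (integral_exp_natPairing_natParam_pos hz).ne'
  refine h1.congr fun z hz => ?_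
  -- The translation turns the factor `x s` into `h s - m s`; the two summands are integrals of
  -- parameter-free functions, the second multiplied by the smooth drift `m s`.
  have hsub : ∫ h, Real.exp (natPairing h (natParam z.cov⁻¹ (patternDrift z.2 ε))) *
      ((h - WithLp.toLp 2 (patternDrift z.2 ε)) s * patternProb c ε h) =
      (∫ h, Real.exp (natPairing h (natParam z.cov⁻¹ (patternDrift z.2 ε))) *
        (h s * patternProb c ε h)) - patternDrift z.2 ε s *
      ∫ h, Real.exp (natPairing h (natParam z.cov⁻¹ (patternDrift z.2 ε))) * patternProb c ε h := by
    rw [← integral_const_mul, ← integral_sub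
      (integrable_exp_natPairing_mul hm1.aestronglyMeasurable (abs_eval_mul_patternProb_le ε s)
        (natParam_mem hz _))
      ((integrable_exp_natPairing_mul (measurable_patternProb hc ε).aestronglyMeasurable
        (abs_patternProb_le ε) (natParam_mem hz _)).const_mul _)]
    refine integral_congr_ae (Eventually.of_forall fun h => ?_)
    simp only [PiLp.sub_apply]
    ring
  rw [integral_multivariateGaussian_shift hz (patternDrift z.2 ε) (fun x => x s)
    (patternProb c ε), hsub]
  rfl

theorem smoothEntries_corr (hc : IsUpdateRule c) :
    SmoothEntries (posStates T) fun z : State T => corr c z.cov z.2 := fun s t => by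
  simp only [corr_eq_sum hc]
  exact ContDiffOn.sum fun ε _ => contDiffOn_const.mul (contDiffOn_patternMass hc ε)

theorem smoothEntries_resp (hc : IsUpdateRule c) :
    SmoothEntries (posStates T) fun z : State T => resp c z.cov z.2 := fun s t => by
  simp only [resp_eq_sum hc]
  exact ContDiffOn.sum fun ε _ => contDiffOn_const.mul
    (contDiffOn_integral_eval_mul_patternProb hc ε s)

theorem posDef_block {n t : ℕ} (h : t ≤ n) {K : Matrix (Fin n) (Fin n) ℝ} (hK : K.PosDef) :
    (block h h K).PosDef :=
  hK.submatrix (Fin.castLE_injective h)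

/-- The matrix of the kernel recursion, without the convention for degenerate states. -/
noncomputable def rawKernel (c : I × ℝ → ℝ) (z : State T) : Matrix (Fin (T + 1)) (Fin (T + 1)) ℝ :=
  kernelBlock z.cov (corr c z.cov z.2) (resp c z.cov z.2) T le_rfl

theorem nondegenerate_of_posDef (hc : IsUpdateRule c) {K : Matrix (Fin T) (Fin T) ℝ}
    (hK : K.PosDef) (v : Vecs T) : Nondegenerate c K v := fun _ h =>
  ⟨isUnit_iff_ne_zero.2 (posDef_block h hK).det_pos.ne',
    isUnit_iff_ne_zero.2 (posDef_block (Nat.le_succ_of_le h) (corr_posDef hc hK v)).det_pos.ne'⟩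

theorem kernel_eq_rawKernel (hc : IsUpdateRule c) {z : State T} (hz : z ∈ posStates T) :
    kernel c z.cov z.2 = rawKernel c z :=
  if_pos (nondegenerate_of_posDef hc hz z.2)

theorem smoothEntries_rawKernel (hc : IsUpdateRule c) :
    SmoothEntries (posStates T) (rawKernel (T := T) c) :=
  smoothEntries_kernelBlock (smoothEntries_cov _) (smoothEntries_corr hc) (smoothEntries_resp hc)
    T le_rfl fun _ hz _ hs _ => ⟨(posDef_block hs hz).det_pos.ne',
      (posDef_block (Nat.le_succ_of_le hs) (corr_posDef hc hz _)).det_pos.ne'⟩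

/-- Convexity is what turns continuous differentiability on this set into a local Lipschitz
property. -/
theorem convex_posStates (T : ℕ) : Convex ℝ (posStates T) := by
  intro z hz w hw a b ha hb hab
  change (a • z.cov + b • w.cov).PosDef
  rcases ha.eq_or_lt with rfl | ha'
  · rw [zero_add] at hab
    have hw' : w.cov.PosDef := hw
    simpa [hab] using hw'
  · exact (hz.smul ha').add_posSemidef (hw.posSemidef.smul hb)

end Smoothness

/-! ### Causality: the first passes determine the first entries of the rates. -/

section Causality

variable {c : I × ℝ → ℝ} {T : ℕ}

/-- The components of a state that concern the passes `1, …, t`; the others are set to `0`. -/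
noncomputable def truncState (t : ℕ) : State T →L[ℝ] State T :=
  LinearMap.toContinuousLinearMap
    { toFun := fun z => (fun i j => if i.val < t ∧ j.val < t then z.1 i j else 0,
        fun s => if s.val < t then z.2 s else 0)
      map_add' := fun z w => by
        ext <;> simp only [Prod.fst_add, Prod.snd_add, Pi.add_apply] <;> split_ifs <;> simp
      map_smul' := fun a z => by
        ext <;> simp only [Prod.smul_fst, Prod.smul_snd, Pi.smul_apply, RingHom.id_apply] <;>
          split_ifs <;> simp }

theorem truncState_fst (t : ℕ) (z : State T) (i j : Fin T) :
    (truncState t z).1 i j = if i.val < t ∧ j.val < t then z.1 i j else 0 := rfl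

theorem truncState_snd (t : ℕ) (z : State T) (s : Fin T) :
    (truncState t z).2 s = if s.val < t then z.2 s else 0 := rfl

theorem truncState_eq_iff {t : ℕ} {z w : State T} :
    truncState t z = truncState t w ↔
      (∀ i j : Fin T, i.val < t → j.val < t → z.1 i j = w.1 i j) ∧
        ∀ s : Fin T, s.val < t → z.2 s = w.2 s := by
  constructor
  · intro h
    refine ⟨fun i j hi hj => ?_, fun s hs => ?_⟩
    · have h1 : (truncState t z).1 i j = (truncState t w).1 i j := by rw [h]
      simpa [truncState_fst, hi, hj] using h1
    · have h1 : (truncState t z).2 s = (truncState t w).2 s := by rw [h]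
      simpa [truncState_snd, hs] using h1
  · rintro ⟨h1, h2⟩
    refine Prod.ext (funext fun i => funext fun j => ?_) (funext fun s => ?_)
    · simp only [truncState_fst]
      split_ifs with h
      exacts [h1 i j h.1 h.2, rfl]
    · simp only [truncState_snd]
      split_ifs with h
      exacts [h2 s h, rfl]

theorem truncState_of_le {t : ℕ} (h : T ≤ t) (z : State T) : truncState t z = z := by
  refine Prod.ext (funext fun i => funext fun j => ?_) (funext fun s => ?_)
  · rw [truncState_fst, if_pos ⟨i.isLt.trans_le h, j.isLt.trans_le h⟩]
  · rw [truncState_snd, if_pos (s.isLt.trans_le h)]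

/-- The Gaussian vector with the entries from `t` on set to `0`. -/
noncomputable def truncVec (t : ℕ) : EuclideanSpace ℝ (Fin T) →L[ℝ] EuclideanSpace ℝ (Fin T) :=
  LinearMap.toContinuousLinearMap
    { toFun := fun x => WithLp.toLp 2 fun i => if i.val < t then x i else 0
      map_add' := fun x y => by
        ext i; simp only [PiLp.add_apply]; split_ifs <;> simp
      map_smul' := fun a x => by
        ext i; simp only [PiLp.smul_apply, RingHom.id_apply]; split_ifs <;> simp }

theorem truncVec_apply (t : ℕ) (x : EuclideanSpace ℝ (Fin T)) (i : Fin T) :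
    truncVec t x i = if i.val < t then x i else 0 := rfl

/-- Truncation is self-adjoint, so the characteristic function of the truncated vector is that of
the full vector at a truncated argument, where only the upper left block of the covariance enters.
-/
theorem map_truncVec_multivariateGaussian {t : ℕ} {K K' : Matrix (Fin T) (Fin T) ℝ}
    (hK : K.PosSemidef) (hK' : K'.PosSemidef)
    (h : ∀ i j : Fin T, i.val < t → j.val < t → K i j = K' i j) :
    (multivariateGaussian 0 K).map (truncVec t) = (multivariateGaussian 0 K').map (truncVec t) := by
  have key : ∀ {K : Matrix (Fin T) (Fin T) ℝ} (x : EuclideanSpace ℝ (Fin T)),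
      charFun ((multivariateGaussian 0 K).map (truncVec t)) x =
        charFun (multivariateGaussian 0 K) (truncVec t x) := by
    intro K x
    rw [charFun_apply, charFun_apply, integral_map (by fun_prop)
      (Measurable.aestronglyMeasurable (by fun_prop))]
    refine integral_congr_ae (Eventually.of_forall fun y => ?_)
    have : inner ℝ (truncVec t y) x = inner ℝ y (truncVec t x) := by
      simp only [PiLp.inner_apply, truncVec_apply]
      refine Finset.sum_congr rfl fun i _ => ?_
      split_ifs <;> simp
    simp only [this]
  apply Measure.ext_of_charFun
  ext x
  rw [key, key, charFun_multivariateGaussian hK, charFun_multivariateGaussian hK']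
  have : (truncVec t x).ofLp ⬝ᵥ K *ᵥ (truncVec t x).ofLp =
      (truncVec t x).ofLp ⬝ᵥ K' *ᵥ (truncVec t x).ofLp := by
    simp only [dotProduct, Matrix.mulVec, truncVec_apply]
    refine Finset.sum_congr rfl fun i _ => ?_
    split_ifs with hi
    · congr 1
      refine Finset.sum_congr rfl fun j _ => ?_
      split_ifs with hj
      · rw [h i j hi hj]
      · simp
    · simp
  rw [this]

theorem spin_congr {t : ℕ} {v v' : Vecs T} (hv : ∀ s : Fin T, s.val < t → v s = v' s)
    {w w' : Sample T} (h0 : w.1 = w'.1) (hG : ∀ i : Fin T, i.val < t → w.2.1 i = w'.2.1 i)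
    (hU : w.2.2 = w'.2.2) : ∀ s ≤ t, s ≤ T → spin c v w s = spin c v' w' s := by
  intro s
  induction s using Nat.strong_induction_on with
  | _ s ih =>
    intro hst hsT
    match s with
    | 0 => rw [spin_zero, spin_zero, h0]
    | s + 1 =>
      have h1 := spin_succ (c := c) v w ⟨s, hsT⟩
      have h2 := spin_succ (c := c) v' w' ⟨s, hsT⟩
      simp only at h1 h2
      rw [h1, h2, hv ⟨s, hsT⟩ hst, hG ⟨s, hsT⟩ hst, hU]
      congr 3
      refine Finset.sum_congr rfl fun r _ => ?_
      rw [ih r.val r.isLt (by omega) (by omega)]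

/-- Expectations of quantities of the first `t` passes depend on the corresponding block. -/
theorem integral_sampleLaw_congr {t : ℕ} {K K' : Matrix (Fin T) (Fin T) ℝ}
    (hK : K.PosSemidef) (hK' : K'.PosSemidef)
    (h : ∀ i j : Fin T, i.val < t → j.val < t → K i j = K' i j) {F : Sample T → ℝ}
    (hF : Measurable F) (hFt : ∀ w, F w = F (w.1, truncVec t w.2.1, w.2.2)) :
    ∫ w, F w ∂(sampleLaw K) = ∫ w, F w ∂(sampleLaw K') := by
  have key : ∀ K : Matrix (Fin T) (Fin T) ℝ, ∫ w, F w ∂(sampleLaw K) =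
      ∫ w, F w ∂(signLaw.prod (((multivariateGaussian 0 K).map (truncVec t)).prod
        (Measure.pi fun _ : Fin T => (volume : Measure I)))) := by
    intro K
    have hm : signLaw.prod (((multivariateGaussian 0 K).map (truncVec t)).prod
        (Measure.pi fun _ : Fin T => (volume : Measure I))) =
        (sampleLaw K).map (Prod.map id (Prod.map (truncVec t) id)) := by
      rw [sampleLaw, ← Measure.map_prod_map _ _ measurable_id (by fun_prop),
        ← Measure.map_prod_map _ _ (by fun_prop) measurable_id, Measure.map_id, Measure.map_id]
    rw [hm, integral_map (by fun_prop) hF.aestronglyMeasurable]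
    exact integral_congr_ae (Eventually.of_forall hFt)
  rw [key K, key K', map_truncVec_multivariateGaussian hK hK' h]

/-- Two replacements: the spins up to `t` see the Gaussian vector only through its truncation, so
the covariance may be changed outside the block; then the drifts may be changed pointwise, since
later ones are never used. -/
theorem corr_congr (hc : IsUpdateRule c) {t : ℕ} {z z' : State T} (hz : z.cov.PosSemidef)
    (hz' : z'.cov.PosSemidef) (h : truncState t z = truncState t z') (a b : Fin (T + 1))
    (ha : a.val ≤ t) (hb : b.val ≤ t) : corr c z.cov z.2 a b = corr c z'.cov z'.2 a b := by
  rw [truncState_eq_iff] at h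
  simp only [corr, Matrix.of_apply]
  rw [integral_sampleLaw_congr hz hz' h.1
    (F := fun w => spin c z.2 w a.val * spin c z.2 w b.val)
    ((measurable_spin hc _ _).mul (measurable_spin hc _ _)) fun w => ?_]
  · congr 1
    ext w
    rw [spin_congr h.2 (w := w) (w' := w) rfl (fun _ _ => rfl) rfl a.val ha (Nat.lt_succ_iff.1 a.isLt),
      spin_congr h.2 (w := w) (w' := w) rfl (fun _ _ => rfl) rfl b.val hb (Nat.lt_succ_iff.1 b.isLt)]
  · have hG : ∀ i : Fin T, i.val < t → w.2.1 i = truncVec t w.2.1 i := fun i hi => by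
      rw [truncVec_apply, if_pos hi]
    rw [spin_congr (v := z.2) (v' := z.2) (w := w) (w' := (w.1, truncVec t w.2.1, w.2.2))
      (fun _ _ => rfl) rfl hG rfl a.val ha (Nat.lt_succ_iff.1 a.isLt),
      spin_congr (v := z.2) (v' := z.2) (w := w) (w' := (w.1, truncVec t w.2.1, w.2.2))
      (fun _ _ => rfl) rfl hG rfl b.val hb (Nat.lt_succ_iff.1 b.isLt)]

theorem resp_congr (hc : IsUpdateRule c) {t : ℕ} {z z' : State T} (hz : z.cov.PosSemidef)
    (hz' : z'.cov.PosSemidef) (h : truncState t z = truncState t z') (a : Fin T) (b : Fin (T + 1))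
    (ha : a.val < t) (hb : b.val ≤ t) : resp c z.cov z.2 a b = resp c z'.cov z'.2 a b := by
  rw [truncState_eq_iff] at h
  simp only [resp, Matrix.of_apply]
  rw [integral_sampleLaw_congr hz hz' h.1 (F := fun w => w.2.1 a * spin c z.2 w b.val)
    (Measurable.mul (by fun_prop) (measurable_spin hc _ _)) fun w => ?_]
  · congr 1
    ext w
    rw [spin_congr h.2 (w := w) (w' := w) rfl (fun _ _ => rfl) rfl b.val hb (Nat.lt_succ_iff.1 b.isLt)]
  · have hG : ∀ i : Fin T, i.val < t → w.2.1 i = truncVec t w.2.1 i := fun i hi => by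
      rw [truncVec_apply, if_pos hi]
    rw [spin_congr (v := z.2) (v' := z.2) (w := w) (w' := (w.1, truncVec t w.2.1, w.2.2))
      (fun _ _ => rfl) rfl hG rfl b.val hb (Nat.lt_succ_iff.1 b.isLt), ← hG a ha]

theorem kernelBlock_congr {K K' : Matrix (Fin T) (Fin T) ℝ}
    {C C' : Matrix (Fin (T + 1)) (Fin (T + 1)) ℝ} {R R' : Matrix (Fin T) (Fin (T + 1)) ℝ} :
    ∀ (t : ℕ) (ht : t ≤ T), (∀ i j : Fin T, i.val < t → j.val < t → K i j = K' i j) →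
      (∀ i j : Fin (T + 1), i.val ≤ t → j.val ≤ t → C i j = C' i j) →
      (∀ (i : Fin T) (j : Fin (T + 1)), i.val < t → j.val ≤ t → R i j = R' i j) →
      kernelBlock K C R t ht = kernelBlock K' C' R' t ht
  | 0, _, _, _, _ => by simp only [kernelBlock]
  | t + 1, ht, hK, hC, hR => by
    have ih := kernelBlock_congr (K := K) (K' := K') (C := C) (C' := C') (R := R) (R' := R') t
      (Nat.le_of_succ_le ht) (fun i j hi hj => hK i j (by omega) (by omega))
      (fun i j hi hj => hC i j (by omega) (by omega)) fun i j hi hj => hR i j (by omega) (by omega)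
    have h1 : block ht ht K = block ht ht K' := by
      ext i j; exact hK _ _ i.isLt j.isLt
    have h2 : block (Nat.le_succ_of_le ht) (Nat.le_succ_of_le ht) C =
        block (Nat.le_succ_of_le ht) (Nat.le_succ_of_le ht) C' := by
      ext i j; exact hC _ _ i.isLt.le j.isLt.le
    have h3 : block ht (Nat.le_succ_of_le ht) R = block ht (Nat.le_succ_of_le ht) R' := by
      ext i j; exact hR _ _ i.isLt j.isLt.le
    have h4 : ∀ l : Fin (T + 1), l.val = t + 1 →
        colHead (Nat.le_succ_of_le ht) C l = colHead (Nat.le_succ_of_le ht) C' l := by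
      intro l hl; ext i; exact hC _ _ i.isLt.le hl.le
    have h5 : ∀ l : Fin (T + 1), l.val = t + 1 → colHead ht R l = colHead ht R' l := by
      intro l hl; ext i; exact hR _ _ i.isLt hl.le
    simp only [kernelBlock]
    rw [ih, h1, h2, h3, h4 _ rfl, h5 _ rfl]

/-- Each step of the recursion appends a row and a column and leaves the previous block untouched.
-/
theorem kernelBlock_apply_of_le {K : Matrix (Fin T) (Fin T) ℝ}
    {C : Matrix (Fin (T + 1)) (Fin (T + 1)) ℝ} {R : Matrix (Fin T) (Fin (T + 1)) ℝ} {t : ℕ}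
    {u : ℕ} (htu : t ≤ u) (hu : u ≤ T) (i j : Fin (u + 1)) (hi : i.val < t + 1)
    (hj : j.val < t + 1) :
    kernelBlock K C R u hu i j = kernelBlock K C R t (htu.trans hu) ⟨i, hi⟩ ⟨j, hj⟩ := by
  induction u with
  | zero =>
    obtain rfl : t = 0 := by omega
    rfl
  | succ u ih =>
    rcases htu.eq_or_lt with rfl | hlt
    · rfl
    · have h := ih (Nat.lt_succ_iff.1 hlt) (Nat.le_of_succ_le hu) ⟨i, by omega⟩ ⟨j, by omega⟩ hi hj
      rw [← h]
      conv_lhs => rw [kernelBlock]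
      simp only [Matrix.of_apply]
      rw [dif_pos (by omega), dif_pos (by omega)]

/-- This is the reason for working with `rawKernel`: the convention in `kernel` tests all blocks at
once, so a degeneracy in a late pass would change early columns. In `rawKernel` a singular block is
inverted by the default value of `⁻¹`, which still depends on that block alone, so causality holds
for every positive semidefinite covariance. -/
theorem rawKernel_congr (hc : IsUpdateRule c) {t : ℕ} (ht : t ≤ T) {z z' : State T}
    (hz : z.cov.PosSemidef) (hz' : z'.cov.PosSemidef) (h : truncState t z = truncState t z')
    (a b : Fin (T + 1)) (ha : a.val ≤ t) (hb : b.val ≤ t) :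
    rawKernel c z a b = rawKernel c z' a b := by
  have hk : kernelBlock z.cov (corr c z.cov z.2) (resp c z.cov z.2) t ht =
      kernelBlock z'.cov (corr c z'.cov z'.2) (resp c z'.cov z'.2) t ht :=
    kernelBlock_congr t ht (truncState_eq_iff.1 h).1
      (fun i j hi hj => corr_congr hc hz hz' h i j hi hj)
      fun i j hi hj => resp_congr hc hz hz' h i j hi hj
  exact (kernelBlock_apply_of_le ht le_rfl a b (Nat.lt_succ_of_le ha) (Nat.lt_succ_of_le hb)).trans
    ((congrFun (congrFun hk _) _).trans
      (kernelBlock_apply_of_le ht le_rfl a b (Nat.lt_succ_of_le ha) (Nat.lt_succ_of_le hb)).symm)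

/-- The integrand to the left of `x` in the system. -/
noncomputable def forwardRate (c : I × ℝ → ℝ) (z : State T) : State T :=
  (fun s t => corr c z.cov z.2 s.succ t.succ, newCol (rawKernel c z))

/-- The integrand to the right of `x` in the system. -/
noncomputable def backwardRate (c : I × ℝ → ℝ) (z : State T) : State T :=
  (fun s t => corr c z.cov z.2 s.castSucc t.castSucc, shiftCol (rawKernel c z))

/-- The contribution of the block itself in the difference equations; the covariance counts if
`b` is true. -/
noncomputable def selfRate (c : I × ℝ → ℝ) (b : Prop) [Decidable b] (z : State T) : State T :=
  (if b then fun s t => corr c z.cov z.2 s.castSucc t.castSucc else 0, oldCol (rawKernel c z))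

theorem forwardRate_congr (hc : IsUpdateRule c) {t : ℕ} (ht : t ≤ T) {z z' : State T}
    (hz : z.cov.PosSemidef) (hz' : z'.cov.PosSemidef) (h : truncState t z = truncState t z') :
    truncState t (forwardRate c z) = truncState t (forwardRate c z') := by
  rw [truncState_eq_iff]
  refine ⟨fun i j hi hj => corr_congr hc hz hz' h _ _ (by simpa using hi) (by simpa using hj),
    fun s hs => funext fun r => rawKernel_congr hc ht hz hz' h _ _ ?_ (by simpa using hs)⟩
  simp only [Fin.val_castLE]
  omega

/-- In the backward rate pass `t + 1` uses the spins and the kernel column of index `t`, so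
agreement in `t` passes yields agreement in `t + 1`. This gain of one pass, absent for the forward
rate, drives every induction on passes. -/
theorem backwardRate_congr (hc : IsUpdateRule c) {t : ℕ} (ht : t ≤ T) {z z' : State T}
    (hz : z.cov.PosSemidef) (hz' : z'.cov.PosSemidef) (h : truncState t z = truncState t z') :
    truncState (t + 1) (backwardRate c z) = truncState (t + 1) (backwardRate c z') := by
  rw [truncState_eq_iff]
  refine ⟨fun i j hi hj => corr_congr hc hz hz' h _ _ (by simpa using Nat.lt_succ_iff.1 hi)
    (by simpa using Nat.lt_succ_iff.1 hj), fun s hs => funext fun r => ?_⟩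
  simp only [backwardRate, shiftCol]
  congr 1
  funext r
  refine rawKernel_congr hc ht hz hz' h _ _ ?_ (by simpa using Nat.lt_succ_iff.1 hs)
  have := r.isLt
  simp only [Fin.val_castLE]
  omega

theorem selfRate_congr (hc : IsUpdateRule c) {t : ℕ} (ht : t ≤ T) (b : Prop) [Decidable b]
    {z z' : State T}
    (hz : z.cov.PosSemidef) (hz' : z'.cov.PosSemidef) (h : truncState t z = truncState t z') :
    truncState (t + 1) (selfRate c b z) = truncState (t + 1) (selfRate c b z') := by
  rw [truncState_eq_iff]
  refine ⟨fun i j hi hj => ?_, fun s hs => funext fun r => rawKernel_congr hc ht hz hz' h _ _ ?_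
    (by simpa using Nat.lt_succ_iff.1 hs)⟩
  · simp only [selfRate]
    split_ifs
    · exact corr_congr hc hz hz' h _ _ (by simpa using Nat.lt_succ_iff.1 hi)
        (by simpa using Nat.lt_succ_iff.1 hj)
    · rfl
  · have := r.isLt
    simp only [Fin.val_castLE]
    omega

end Causality

/-! ### Coercivity on the first indices. -/

/-- The quadratic form of `M` is at least `l ‖x‖²` on vectors supported on the first `t` indices. -/
def CoerciveBelow {n : ℕ} (l : ℝ) (t : ℕ) (M : Matrix (Fin n) (Fin n) ℝ) : Prop :=
  ∀ x : Fin n → ℝ, (∀ i, t ≤ i.val → x i = 0) → l * (x ⬝ᵥ x) ≤ x ⬝ᵥ M *ᵥ x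

theorem dotProduct_self_nonneg' {n : ℕ} (x : Fin n → ℝ) : 0 ≤ x ⬝ᵥ x :=
  Finset.sum_nonneg fun i _ => mul_self_nonneg (x i)

theorem dotProduct_self_pos {n : ℕ} {x : Fin n → ℝ} (hx : x ≠ 0) : 0 < x ⬝ᵥ x := by
  simpa using Matrix.dotProduct_star_self_pos_iff (v := x) |>.2 hx

namespace CoerciveBelow

variable {n : ℕ} {l : ℝ} {t : ℕ} {M : Matrix (Fin n) (Fin n) ℝ}

theorem mono_right (h : CoerciveBelow l t M) {s : ℕ} (hs : s ≤ t) : CoerciveBelow l s M :=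
  fun x hx => h x fun i hi => hx i (hs.trans hi)

theorem mono_left (h : CoerciveBelow l t M) {k : ℝ} (hk : k ≤ l) : CoerciveBelow k t M :=
  fun x hx => (mul_le_mul_of_nonneg_right hk (dotProduct_self_nonneg' x)).trans (h x hx)

theorem congr (h : CoerciveBelow l t M) {N : Matrix (Fin n) (Fin n) ℝ}
    (hMN : ∀ i j : Fin n, i.val < t → j.val < t → M i j = N i j) : CoerciveBelow l t N := by
  intro x hx
  convert h x hx using 1
  simp only [dotProduct, Matrix.mulVec]
  refine Finset.sum_congr rfl fun i _ => ?_
  by_cases hi : i.val < t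
  · congr 1
    refine Finset.sum_congr rfl fun j _ => ?_
    by_cases hj : j.val < t
    · rw [hMN i j hi hj]
    · rw [hx j (not_lt.1 hj), mul_zero, mul_zero]
  · rw [hx i (not_lt.1 hi), zero_mul, zero_mul]

theorem posDef (h : CoerciveBelow l t M) (hl : 0 < l) (ht : n ≤ t) (hM : M.IsHermitian) :
    M.PosDef := by
  refine Matrix.PosDef.of_dotProduct_mulVec_pos hM fun x hx => ?_
  rw [star_trivial]
  exact (mul_pos hl (dotProduct_self_pos hx)).trans_le
    (h x fun i hi => absurd (i.isLt.trans_le (ht.trans hi)) (lt_irrefl _))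

theorem block (h : CoerciveBelow l t M) {s : ℕ} (hs : s ≤ n) (hst : s ≤ t) (hl : 0 < l)
    (hM : M.IsHermitian) : (BlockScan.block hs hs M).PosDef := by
  refine Matrix.PosDef.of_dotProduct_mulVec_pos (hM.submatrix _) fun x hx => ?_
  rw [star_trivial]
  have hinj := Fin.castLE_injective hs
  set y : Fin n → ℝ := Function.extend (Fin.castLE hs) x 0 with hy
  have hyx : ∀ i, y (Fin.castLE hs i) = x i := fun i => hinj.extend_apply _ _ _
  have hy0 : ∀ i, i ∉ Set.range (Fin.castLE hs) → y i = 0 := fun i hi =>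
    Function.extend_apply' _ _ _ hi
  have hsum : ∀ f : Fin n → ℝ, ∑ i, y i * f i = ∑ i, x i * f (Fin.castLE hs i) := fun f =>
    (Fintype.sum_of_injective _ hinj _ _ (fun i hi => by rw [hy0 i hi, zero_mul])
      fun i => by rw [hyx]).symm
  have hquad : y ⬝ᵥ M *ᵥ y = x ⬝ᵥ BlockScan.block hs hs M *ᵥ x := by
    simp only [dotProduct, Matrix.mulVec]
    rw [hsum]
    refine Finset.sum_congr rfl fun i _ => ?_
    congr 1
    rw [Finset.sum_congr rfl fun j _ => mul_comm _ _, hsum]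
    exact Finset.sum_congr rfl fun j _ => mul_comm _ _
  rw [← hquad]
  have hyne : y ≠ 0 := by
    intro h0
    apply hx
    funext i
    rw [← hyx, h0]
    rfl
  refine (mul_pos hl (dotProduct_self_pos hyne)).trans_le (h y fun i hi => hy0 i ?_)
  rintro ⟨k, rfl⟩
  have := k.isLt
  simp only [Fin.val_castLE] at hi
  omega

/-- Prepending a zero costs one index: removing the spin `0` lowers the range from `t + 1` to `t`.
In `submatrix_castSucc` a zero is appended and no index is lost, which is why the backward rate
propagates positivity to a further pass and the forward rate does not. -/
theorem submatrix_succ {C : Matrix (Fin (n + 1)) (Fin (n + 1)) ℝ} (h : CoerciveBelow l (t + 1) C) :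
    CoerciveBelow l t (Matrix.of fun i j : Fin n => C i.succ j.succ) := by
  intro x hx
  have := h (Fin.cons 0 x) fun i => by
    refine Fin.cases (fun _ => rfl) (fun k hk => ?_) i
    rw [Fin.cons_succ]
    exact hx k (by simpa using hk)
  simpa [dotProduct, Matrix.mulVec, Fin.sum_univ_succ] using this

theorem submatrix_castSucc {C : Matrix (Fin (n + 1)) (Fin (n + 1)) ℝ} (h : CoerciveBelow l t C) :
    CoerciveBelow l t (Matrix.of fun i j : Fin n => C i.castSucc j.castSucc) := by
  intro x hx
  have := h (Fin.snoc (α := fun _ => ℝ) x 0) fun i => by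
    refine Fin.lastCases (fun _ => by simp) (fun k hk => ?_) i
    rw [Fin.snoc_castSucc]
    exact hx k (by simpa using hk)
  simpa [dotProduct, Matrix.mulVec, Fin.sum_univ_castSucc] using this

end CoerciveBelow

/-! ### Bounds uniform over compact families of states. -/

section Bounds

variable {c : I × ℝ → ℝ} {T : ℕ}

/-- The state whose covariance is the block of the first `t` passes completed by an identity
matrix, and whose drifts of later passes vanish. -/
noncomputable def padState (t : ℕ) (z : State T) : State T :=
  truncState t z + (fun i j => if i = j ∧ t ≤ i.val then 1 else 0, 0)

theorem padState_cov_apply (t : ℕ) (z : State T) (i j : Fin T) :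
    (padState t z).cov i j = (if i.val < t ∧ j.val < t then z.1 i j else 0) +
      if i = j ∧ t ≤ i.val then 1 else 0 := rfl

theorem padState_snd (t : ℕ) (z : State T) (s : Fin T) :
    (padState t z).2 s = if s.val < t then z.2 s else 0 := by
  simp [padState, truncState_snd]

theorem truncState_padState (t : ℕ) (z : State T) :
    truncState t (padState t z) = truncState t z := by
  rw [truncState_eq_iff]
  refine ⟨fun i j hi hj => ?_, fun s hs => ?_⟩
  · have := padState_cov_apply t z i j
    rw [if_pos ⟨hi, hj⟩, if_neg (fun h => absurd h.2 (not_le.2 hi)), add_zero] at this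
    exact this
  · rw [padState_snd, if_pos hs]

theorem padState_isHermitian (t : ℕ) {z : State T} (hz : z.cov.IsHermitian) :
    (padState t z).cov.IsHermitian := by
  refine Matrix.ext fun i j => ?_
  have h : z.1 j i = z.1 i j := by simpa using hz.apply i j
  rw [Matrix.conjTranspose_apply, star_trivial, padState_cov_apply, padState_cov_apply, h]
  congr 1
  · simp only [and_comm]
  · by_cases hij : i = j
    · subst hij; rfl
    · rw [if_neg (fun h => hij h.1.symm), if_neg (fun h => hij h.1)]

/-- The form splits into that of the block and that of the identity on the remaining indices; the
latter requires `l ≤ 1`. -/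
theorem le_quadForm_padState {t : ℕ} {z : State T} {l : ℝ} (hl : l ≤ 1)
    (h : CoerciveBelow l t z.cov) (x : Fin T → ℝ) :
    l * (x ⬝ᵥ x) ≤ x ⬝ᵥ (padState t z).cov *ᵥ x := by
  set y : Fin T → ℝ := fun i => if i.val < t then x i else 0 with hy
  have h1 := h y fun i hi => if_neg (not_lt.2 hi)
  have h2 : x ⬝ᵥ (padState t z).cov *ᵥ x =
      y ⬝ᵥ z.cov *ᵥ y + ∑ i, if t ≤ i.val then x i * x i else 0 := by
    simp only [dotProduct, Matrix.mulVec, padState_cov_apply]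
    rw [← Finset.sum_add_distrib]
    refine Finset.sum_congr rfl fun i _ => ?_
    simp only [add_mul, Finset.sum_add_distrib, mul_add]
    congr 1
    · by_cases hi : i.val < t
      · simp only [hy, hi, true_and, if_true]
        congr 1
        refine Finset.sum_congr rfl fun j _ => ?_
        split_ifs
        · rfl
        · rw [mul_zero, zero_mul]
      · simp [hy, hi]
    · by_cases hi : t ≤ i.val
      · simp [hi]
      · simp [hi]
  have h3 : x ⬝ᵥ x = y ⬝ᵥ y + ∑ i : Fin T, if t ≤ i.val then x i * x i else 0 := by
    simp only [dotProduct]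
    rw [← Finset.sum_add_distrib]
    refine Finset.sum_congr rfl fun i _ => ?_
    by_cases hi : i.val < t
    · simp [hy, hi]
    · simp [hy, hi, not_lt.1 hi]
  have h4 : 0 ≤ ∑ i : Fin T, if t ≤ i.val then x i * x i else 0 :=
    Finset.sum_nonneg fun i _ => by split_ifs; exacts [mul_self_nonneg _, le_rfl]
  rw [h2, h3, mul_add]
  nlinarith

theorem padState_mem_posStates {t : ℕ} {z : State T} (hz : z.cov.IsHermitian) {l : ℝ} (hl : 0 < l)
    (h : CoerciveBelow l t z.cov) : padState t z ∈ posStates T := by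
  refine Matrix.PosDef.of_dotProduct_mulVec_pos (padState_isHermitian t hz) fun x hx => ?_
  rw [star_trivial]
  exact (mul_pos (lt_min hl one_pos) (dotProduct_self_pos hx)).trans_le
    (le_quadForm_padState (min_le_right l 1) (h.mono_left (min_le_left l 1)) x)

/-- The padded state is positive definite in all passes, so the results for full rank apply to it;
by causality its spins `0, …, t` have the same correlations as those of `z`. -/
theorem coerciveBelow_corr_of_pad (hc : IsUpdateRule c) {t : ℕ} {z : State T}
    (hz : z.cov.PosSemidef) (hpad : padState t z ∈ posStates T) {l : ℝ}
    (h : ∀ a : Fin (T + 1) → ℝ,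
      l * (a ⬝ᵥ a) ≤ a ⬝ᵥ corr c (padState t z).cov (padState t z).2 *ᵥ a) :
    CoerciveBelow l (t + 1) (corr c z.cov z.2) := by
  have h1 : CoerciveBelow l (t + 1) (corr c (padState t z).cov (padState t z).2) :=
    fun a _ => h a
  exact h1.congr fun i j hi hj => corr_congr hc hpad.posSemidef hz (truncState_padState t z) i j
    (Nat.lt_succ_iff.1 hi) (Nat.lt_succ_iff.1 hj)

/-- If the covariance is positive on the first `t` passes, then so are the correlations of the
spins `0, …, t`. -/
theorem exists_coerciveBelow_corr (hc : IsUpdateRule c) {t : ℕ} {z : State T}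
    (hz : z.cov.PosSemidef) {l : ℝ} (hl : 0 < l) (h : CoerciveBelow l t z.cov) :
    ∃ k : ℝ, 0 < k ∧ CoerciveBelow k (t + 1) (corr c z.cov z.2) := by
  have hpad := padState_mem_posStates hz.1 hl h
  obtain ⟨k, hk, hk'⟩ := exists_le_quadForm (corr_posDef hc hpad (padState t z).2)
  exact ⟨k, hk, coerciveBelow_corr_of_pad hc hz hpad hk'⟩

/-- States with entries bounded and covariance bounded below. -/
def boundedStates (T : ℕ) (l B : ℝ) : Set (State T) :=
  {z | z.cov.IsHermitian ∧ CoerciveBelow l T z.cov ∧ (∀ i j, |z.1 i j| ≤ 1) ∧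
    ∀ s r, |z.2 s r| ≤ B}

theorem boundedStates_subset {l : ℝ} (hl : 0 < l) (B : ℝ) : boundedStates T l B ⊆ posStates T :=
  fun _ hz => hz.2.1.posDef hl le_rfl hz.1

/-- The fixed lower bound `l` makes positivity a closed condition. -/
theorem isCompact_boundedStates (l B : ℝ) : IsCompact (boundedStates T l B) := by
  have hfst : ∀ i j : Fin T, Continuous fun z : State T => z.1 i j := fun i j =>
    (contDiff_state_cov i j).continuous
  have hsnd : ∀ (t : Fin T) s, Continuous fun z : State T => z.2 t s := fun t s =>
    (contDiff_state_drift t s).continuous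
  apply Metric.isCompact_of_isClosed_isBounded
  · have h1 : IsClosed {z : State T | z.cov.IsHermitian} := by
      simp only [Matrix.IsHermitian, ← Matrix.ext_iff, Matrix.conjTranspose_apply, star_trivial,
        Matrix.of_apply, Set.ofPred_forall]
      exact isClosed_iInter fun i => isClosed_iInter fun j => isClosed_eq (hfst j i) (hfst i j)
    have h2 : IsClosed {z : State T | CoerciveBelow l T z.cov} := by
      simp only [CoerciveBelow, Set.ofPred_forall]
      refine isClosed_iInter fun x => isClosed_iInter fun _ => isClosed_le continuous_const ?_
      simp only [dotProduct, Matrix.mulVec, Matrix.of_apply]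
      exact continuous_finsetSum _ fun i _ => continuous_const.mul
        (continuous_finsetSum _ fun j _ => (hfst i j).mul continuous_const)
    have h3 : IsClosed {z : State T | ∀ i j, |z.1 i j| ≤ 1} := by
      simp only [Set.ofPred_forall]
      exact isClosed_iInter fun i => isClosed_iInter fun j =>
        isClosed_le (hfst i j).abs continuous_const
    have h4 : IsClosed {z : State T | ∀ s r, |z.2 s r| ≤ B} := by
      simp only [Set.ofPred_forall]
      exact isClosed_iInter fun i => isClosed_iInter fun j =>
        isClosed_le (hsnd i j).abs continuous_const
    exact h1.inter (h2.inter (h3.inter h4))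
  · refine (Metric.isBounded_closedBall (x := (0 : State T)) (r := max 1 |B|)).subset fun z hz => ?_
    rw [mem_closedBall_zero_iff, Prod.norm_def]
    have hm : (0 : ℝ) ≤ max 1 |B| := zero_le_one.trans (le_max_left _ _)
    refine max_le ?_ ?_
    · exact (pi_norm_le_iff_of_nonneg hm).2 fun i => (pi_norm_le_iff_of_nonneg hm).2 fun j =>
        (hz.2.2.1 i j).trans (le_max_left _ _)
    · exact (pi_norm_le_iff_of_nonneg hm).2 fun i => (pi_norm_le_iff_of_nonneg hm).2 fun j =>
        (hz.2.2.2 i j).trans ((le_abs_self B).trans (le_max_right _ _))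

/-- Linear interpolation between blocks must not leave the set. -/
theorem convex_boundedStates (l B : ℝ) : Convex ℝ (boundedStates T l B) := by
  have habs : ∀ {x y a b M : ℝ}, |x| ≤ M → |y| ≤ M → 0 ≤ a → 0 ≤ b → a + b = 1 →
      |a * x + b * y| ≤ M := by
    intro x y a b M hx hy ha hb hab
    calc |a * x + b * y| ≤ a * |x| + b * |y| := by
          refine (abs_add_le _ _).trans ?_
          rw [abs_mul, abs_mul, abs_of_nonneg ha, abs_of_nonneg hb]
      _ ≤ a * M + b * M := by gcongr
      _ = M := by rw [← add_mul, hab, one_mul]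
  intro z hz w hw a b ha hb hab
  refine ⟨?_, fun x hx => ?_, fun i j => habs (hz.2.2.1 i j) (hw.2.2.1 i j) ha hb hab,
    fun s r => habs (hz.2.2.2 s r) (hw.2.2.2 s r) ha hb hab⟩
  · change (a • z.cov + b • w.cov).IsHermitian
    exact (hz.1.smul (IsSelfAdjoint.all a)).add (hw.1.smul (IsSelfAdjoint.all b))
  · change l * (x ⬝ᵥ x) ≤ x ⬝ᵥ (a • z.cov + b • w.cov) *ᵥ x
    rw [Matrix.add_mulVec, Matrix.smul_mulVec, Matrix.smul_mulVec, dotProduct_add,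
      dotProduct_smul, dotProduct_smul, smul_eq_mul, smul_eq_mul]
    have h1 := mul_le_mul_of_nonneg_left (hz.2.1 x hx) ha
    have h2 := mul_le_mul_of_nonneg_left (hw.2.1 x hx) hb
    have h3 : l * (x ⬝ᵥ x) = a * (l * (x ⬝ᵥ x)) + b * (l * (x ⬝ᵥ x)) := by
      rw [← add_mul, hab, one_mul]
    linarith

theorem padState_mem_boundedStates {t : ℕ} {z : State T} (hz : z.cov.IsHermitian) {l B : ℝ}
    (hl : l ≤ 1) (hB : 0 ≤ B) (h : CoerciveBelow l t z.cov) (h1 : ∀ i j, |z.1 i j| ≤ 1)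
    (h2 : ∀ s : Fin T, s.val < t → ∀ r, |z.2 s r| ≤ B) : padState t z ∈ boundedStates T l B := by
  refine ⟨padState_isHermitian t hz, fun x _ => le_quadForm_padState hl h x, fun i j => ?_,
    fun s r => ?_⟩
  · rw [show (padState t z).1 i j = _ from padState_cov_apply t z i j]
    by_cases hi : i.val < t
    · have hne : ¬(i = j ∧ t ≤ i.val) := fun h => absurd h.2 (not_le.2 hi)
      rw [if_neg hne, add_zero]
      split_ifs
      · exact h1 i j
      · simp
    · rw [if_neg (fun h => hi h.1), zero_add]
      split_ifs <;> simp
  · rw [padState_snd]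
    split_ifs with hs
    · exact h2 s hs r
    · simpa using hB

/-- A lower bound for the correlations that is uniform over bounded states. -/
theorem exists_uniform_coerciveBelow_corr (hc : IsUpdateRule c) (T : ℕ) {l B : ℝ} (hl : 0 < l)
    (hl1 : l ≤ 1) (hB : 0 ≤ B) :
    ∃ k : ℝ, 0 < k ∧ k ≤ 1 ∧ ∀ (t : ℕ) (z : State T), z.cov.PosSemidef → CoerciveBelow l t z.cov →
      (∀ i j, |z.1 i j| ≤ 1) → (∀ s : Fin T, s.val < t → ∀ r, |z.2 s r| ≤ B) →
      CoerciveBelow k (t + 1) (corr c z.cov z.2) := by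
  have hsub := boundedStates_subset (T := T) hl B
  obtain ⟨k, hk, h⟩ := exists_le_quadForm_of_isCompact (isCompact_boundedStates (T := T) l B)
    (M := fun z => corr c z.cov z.2)
    (fun i j => ((smoothEntries_corr hc i j).continuousOn).mono hsub)
    fun z hz => corr_posDef hc (hsub hz) _
  refine ⟨min k 1, lt_min hk one_pos, min_le_right _ _, fun t z hz hzl h1 h2 => ?_⟩
  have hmem := padState_mem_boundedStates hz.1 hl1 hB hzl h1 h2
  exact (coerciveBelow_corr_of_pad hc hz (hsub hmem) (h _ hmem)).mono_left (min_le_left _ _)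

/-- The matrices `K`, `C`, `R` entering the kernel recursion, as a point of a normed space. -/
abbrev KernelData (T : ℕ) : Type :=
  (Fin T → Fin T → ℝ) × (Fin (T + 1) → Fin (T + 1) → ℝ) × (Fin T → Fin (T + 1) → ℝ)

/-- The kernel recursion is bounded on data with covariances and correlations bounded below. -/
theorem exists_bound_kernelBlock (T t : ℕ) (ht : t ≤ T) {l k : ℝ} (hl : 0 < l) (hk : 0 < k) :
    ∃ M : ℝ, 0 ≤ M ∧ ∀ (K : Matrix (Fin T) (Fin T) ℝ) (C : Matrix (Fin (T + 1)) (Fin (T + 1)) ℝ)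
      (R : Matrix (Fin T) (Fin (T + 1)) ℝ), K.IsHermitian → C.IsHermitian →
      CoerciveBelow l t K → CoerciveBelow k t C → (∀ i j, |K i j| ≤ 1) → (∀ i j, |C i j| ≤ 1) →
      (∀ i j, |R i j| ≤ 2) → ∀ i j, |kernelBlock K C R t ht i j| ≤ M := by
  -- The recursion is viewed as a function of the matrices `(K, C, R)` alone. It is continuous where
  -- the relevant blocks are invertible, and the constraints cut out a compact set of such triples.
  let S : Set (KernelData T) := {p | (Matrix.of p.1).IsHermitian ∧ (Matrix.of p.2.1).IsHermitian ∧
    CoerciveBelow l t (Matrix.of p.1) ∧ CoerciveBelow k t (Matrix.of p.2.1) ∧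
    (∀ i j, |p.1 i j| ≤ 1) ∧ (∀ i j, |p.2.1 i j| ≤ 1) ∧ ∀ i j, |p.2.2 i j| ≤ 2}
  have hcp : ∀ i j, ContDiff ℝ ∞ fun p : KernelData T => p.1 i j := fun i j => by fun_prop
  have hcq : ∀ i j, ContDiff ℝ ∞ fun p : KernelData T => p.2.1 i j := fun i j => by fun_prop
  have hcr : ∀ i j, ContDiff ℝ ∞ fun p : KernelData T => p.2.2 i j := fun i j => by fun_prop
  have hcoer : ∀ (n : ℕ) (f : KernelData T → Fin n → Fin n → ℝ) (a : ℝ),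
      (∀ i j, Continuous fun p => f p i j) → IsClosed {p | CoerciveBelow a t (Matrix.of (f p))} := by
    intro n f a hf
    simp only [CoerciveBelow, Set.ofPred_forall]
    refine isClosed_iInter fun x => isClosed_iInter fun _ => isClosed_le continuous_const ?_
    simp only [dotProduct, Matrix.mulVec, Matrix.of_apply]
    exact continuous_finsetSum _ fun i _ => continuous_const.mul
      (continuous_finsetSum _ fun j _ => (hf i j).mul continuous_const)
  have hherm : ∀ (n : ℕ) (f : KernelData T → Fin n → Fin n → ℝ),
      (∀ i j, Continuous fun p => f p i j) → IsClosed {p | (Matrix.of (f p)).IsHermitian} := by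
    intro n f hf
    simp only [Matrix.IsHermitian, ← Matrix.ext_iff, Matrix.conjTranspose_apply, star_trivial,
      Matrix.of_apply, Set.ofPred_forall]
    exact isClosed_iInter fun i => isClosed_iInter fun j => isClosed_eq (hf j i) (hf i j)
  have hbd : ∀ (m n : ℕ) (f : KernelData T → Fin m → Fin n → ℝ) (a : ℝ),
      (∀ i j, Continuous fun p => f p i j) → IsClosed {p | ∀ i j, |f p i j| ≤ a} := by
    intro m n f a hf
    simp only [Set.ofPred_forall]
    exact isClosed_iInter fun i => isClosed_iInter fun j =>
      isClosed_le (hf i j).abs continuous_const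
  have hS : IsCompact S := by
    apply Metric.isCompact_of_isClosed_isBounded
    · exact (hherm _ _ fun i j => (hcp i j).continuous).inter
        ((hherm _ _ fun i j => (hcq i j).continuous).inter
        ((hcoer _ _ _ fun i j => (hcp i j).continuous).inter
        ((hcoer _ _ _ fun i j => (hcq i j).continuous).inter
        ((hbd _ _ _ _ fun i j => (hcp i j).continuous).inter
        ((hbd _ _ _ _ fun i j => (hcq i j).continuous).inter
        (hbd _ _ _ _ fun i j => (hcr i j).continuous))))))
    · refine (Metric.isBounded_closedBall (x := (0 : KernelData T)) (r := 2)).subset fun p hp => ?_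
      obtain ⟨-, -, -, -, h1, h2, h3⟩ := hp
      rw [mem_closedBall_zero_iff, Prod.norm_def, Prod.norm_def]
      refine max_le ?_ (max_le ?_ ?_) <;>
        refine (pi_norm_le_iff_of_nonneg zero_le_two).2 fun i =>
          (pi_norm_le_iff_of_nonneg zero_le_two).2 fun j => ?_
      · exact (h1 i j).trans one_le_two
      · exact (h2 i j).trans one_le_two
      · exact h3 i j
  have hsm : SmoothEntries S fun p : KernelData T =>
      kernelBlock (Matrix.of p.1) (Matrix.of p.2.1) (Matrix.of p.2.2) t ht := by
    refine smoothEntries_kernelBlock (fun i j => (hcp i j).contDiffOn)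
      (fun i j => (hcq i j).contDiffOn) (fun i j => (hcr i j).contDiffOn) t ht
      fun p hp s hs hst => ?_
    exact ⟨(hp.2.2.1.block hs hst hl hp.1).det_pos.ne',
      (hp.2.2.2.1.block (Nat.le_succ_of_le hs) hst hk hp.2.1).det_pos.ne'⟩
  have hbound : ∀ i j, ∃ M : ℝ, ∀ p ∈ S,
      |kernelBlock (Matrix.of p.1) (Matrix.of p.2.1) (Matrix.of p.2.2) t ht i j| ≤ M := by
    intro i j
    obtain ⟨M, hM⟩ := hS.exists_bound_of_continuousOn (hsm i j).continuousOn
    exact ⟨M, hM⟩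
  choose M hM using hbound
  refine ⟨∑ i, ∑ j, |M i j|, by positivity, fun K C R hK hC hKl hCk hK1 hC1 hR i j => ?_⟩
  calc |kernelBlock K C R t ht i j| ≤ M i j := hM i j (K, C, R) ⟨hK, hC, hKl, hCk, hK1, hC1, hR⟩
    _ ≤ |M i j| := le_abs_self _
    _ ≤ ∑ j, |M i j| := Finset.single_le_sum (f := fun j => |M i j|) (fun _ _ => abs_nonneg _)
        (Finset.mem_univ j)
    _ ≤ _ := Finset.single_le_sum (f := fun i => ∑ j, |M i j|)
        (fun _ _ => Finset.sum_nonneg fun _ _ => abs_nonneg _) (Finset.mem_univ i)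

/-- No bound on the drifts is assumed, because they enter only through `C` and `R`, which are
bounded anyway. This avoids a circle: the drift of a pass is later estimated by kernel entries that
themselves depend on it. -/
theorem exists_bound_rawKernel (hc : IsUpdateRule c) (t : ℕ) (ht : t ≤ T) {l k : ℝ} (hl : 0 < l)
    (hk : 0 < k) :
    ∃ M : ℝ, 0 ≤ M ∧ ∀ z : State T, z.cov.PosSemidef → CoerciveBelow l t z.cov →
      CoerciveBelow k t (corr c z.cov z.2) → (∀ i j, |z.1 i j| ≤ 1) →
      ∀ a b : Fin (T + 1), a.val ≤ t → b.val ≤ t → |rawKernel c z a b| ≤ M := by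
  obtain ⟨M, hM0, hM⟩ := exists_bound_kernelBlock T t ht hl hk
  refine ⟨M, hM0, fun z hz hzl hzk h1 a b ha hb => ?_⟩
  rw [rawKernel]
  have h := kernelBlock_apply_of_le (K := z.cov) (C := corr c z.cov z.2) (R := resp c z.cov z.2)
    ht le_rfl a b (Nat.lt_succ_of_le ha) (Nat.lt_succ_of_le hb)
  rw [h]
  refine hM _ _ _ hz.1 (corr_isHermitian _ _) hzl hzk h1 (abs_corr_le_one hc _ _) (fun i j => ?_) _ _
  refine (abs_resp_le hc hz z.2 i j).trans ?_
  have : z.cov i i ≤ 1 := (abs_le.1 (h1 i i)).2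
  linarith

end Bounds

theorem quadForm_nonneg {n : ℕ} {M : Matrix (Fin n) (Fin n) ℝ} (hM : M.PosSemidef)
    (x : Fin n → ℝ) : 0 ≤ x ⬝ᵥ M *ᵥ x := by
  simpa using hM.dotProduct_mulVec_nonneg x

/-! ### The difference equations: positivity, existence and uniqueness for a fixed block size. -/

section Discrete

variable {c : I × ℝ → ℝ} {T : ℕ} {δ : ℝ}

theorem mul_numBlocks_le_one (hδ : 0 < δ) : δ * numBlocks δ ≤ 1 := by
  have h := Nat.floor_le (a := 1 / δ) (by positivity)
  calc δ * numBlocks δ ≤ δ * (1 / δ) := by gcongr; exact h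
    _ = 1 := by field_simp

theorem one_lt_mul_numBlocks_add (hδ : 0 < δ) : 1 < δ * numBlocks δ + δ := by
  have h := Nat.lt_floor_add_one (1 / δ)
  calc 1 = δ * (1 / δ) := by field_simp
    _ < δ * (numBlocks δ + 1) := by gcongr; exact h
    _ = _ := by ring

theorem one_le_numBlocks (hδ : δ ∈ Ioo (0 : ℝ) 1) : 1 ≤ numBlocks δ :=
  Nat.le_floor (by rw [Nat.cast_one, le_div_iff₀ hδ.1]; linarith [hδ.2])

/-- The right-hand side of the difference equations. -/
noncomputable def discreteRhs (c : I × ℝ → ℝ) (δ : ℝ) (Z : ℕ → State T) (j : ℕ) : State T :=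
  δ • (∑ k ∈ Finset.Icc 1 (numBlocks δ) with k < j, forwardRate c (Z k))
    + δ • (∑ k ∈ Finset.Icc 1 (numBlocks δ) with j < k, backwardRate c (Z k))
    + δ • selfRate c (1 ≤ j) (Z j)

theorem discreteRhs_fst {Z : ℕ → State T} {j : ℕ} (hj : j ≤ numBlocks δ) (s t : Fin T) :
    (discreteRhs c δ Z j).1 s t =
      δ * (∑ k ∈ Finset.Icc 1 (numBlocks δ) with k < j, corr c (Z k).cov (Z k).2 s.succ t.succ)
      + δ * ∑ k ∈ Finset.Icc 1 (numBlocks δ) with j ≤ k,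
        corr c (Z k).cov (Z k).2 s.castSucc t.castSucc := by
  simp only [discreteRhs, Prod.fst_add, Prod.smul_fst, Pi.add_apply, Pi.smul_apply, smul_eq_mul,
    Prod.fst_sum, Finset.sum_apply, forwardRate, backwardRate, selfRate]
  rw [add_assoc, ← mul_add]
  congr 2
  -- The covariance equation includes `k = j` in its backward sum. This term is moved to `selfRate`;
  -- for `j = 0` it is absent, since the blocks start at `1`.
  by_cases h1 : 1 ≤ j
  · have hset : (Finset.Icc 1 (numBlocks δ)).filter (fun k => j ≤ k) =
        insert j ((Finset.Icc 1 (numBlocks δ)).filter (fun k => j < k)) := by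
      ext k
      simp only [Finset.mem_filter, Finset.mem_Icc, Finset.mem_insert]
      omega
    rw [hset, Finset.sum_insert (by simp), if_pos h1, add_comm]
  · have hset : (Finset.Icc 1 (numBlocks δ)).filter (fun k => j ≤ k) =
        (Finset.Icc 1 (numBlocks δ)).filter (fun k => j < k) := by
      ext k
      simp only [Finset.mem_filter, Finset.mem_Icc]
      omega
    rw [hset, if_neg h1]
    simp

theorem discreteRhs_snd (Z : ℕ → State T) (j : ℕ) (t : Fin T) (s : Fin (t.val + 1)) :
    (discreteRhs c δ Z j).2 t s =
      δ * (∑ k ∈ Finset.Icc 1 (numBlocks δ) with k < j, newCol (rawKernel c (Z k)) t s)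
      + δ * (∑ k ∈ Finset.Icc 1 (numBlocks δ) with j < k, shiftCol (rawKernel c (Z k)) t s)
      + δ * oldCol (rawKernel c (Z j)) t s := by
  simp only [discreteRhs, Prod.snd_add, Prod.smul_snd, Pi.add_apply, Pi.smul_apply, smul_eq_mul,
    Prod.snd_sum, Finset.sum_apply, forwardRate, backwardRate, selfRate]

theorem forwardRate_cov (z : State T) :
    (forwardRate c z).cov = Matrix.of fun i j : Fin T => corr c z.cov z.2 i.succ j.succ := rfl

theorem backwardRate_cov (z : State T) :
    (backwardRate c z).cov = Matrix.of fun i j : Fin T => corr c z.cov z.2 i.castSucc j.castSucc :=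
  rfl

theorem forwardRate_cov_posSemidef (hc : IsUpdateRule c) (z : State T) :
    (forwardRate c z).cov.PosSemidef := (corr_posSemidef hc _ _).submatrix Fin.succ

theorem backwardRate_cov_posSemidef (hc : IsUpdateRule c) (z : State T) :
    (backwardRate c z).cov.PosSemidef := (corr_posSemidef hc _ _).submatrix Fin.castSucc

theorem cov_eq_of_discrete {Z : ℕ → State T} {j : ℕ}
    (h : ∀ s t, (Z j).1 s t =
      δ * (∑ k ∈ Finset.Icc 1 (numBlocks δ) with k < j, corr c (Z k).cov (Z k).2 s.succ t.succ)
      + δ * ∑ k ∈ Finset.Icc 1 (numBlocks δ) with j ≤ k,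
        corr c (Z k).cov (Z k).2 s.castSucc t.castSucc) :
    (Z j).cov = δ • (∑ k ∈ Finset.Icc 1 (numBlocks δ) with k < j, (forwardRate c (Z k)).cov)
      + δ • ∑ k ∈ Finset.Icc 1 (numBlocks δ) with j ≤ k, (backwardRate c (Z k)).cov := by
  ext s t
  change (Z j).1 s t = _
  rw [h]
  simp [Matrix.sum_apply, forwardRate_cov, backwardRate_cov]

theorem posSemidef_of_discrete (hc : IsUpdateRule c) (hδ : 0 < δ) {Z : ℕ → State T} {j : ℕ}
    {K : Matrix (Fin T) (Fin T) ℝ}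
    (h : K = δ • (∑ k ∈ Finset.Icc 1 (numBlocks δ) with k < j, (forwardRate c (Z k)).cov)
      + δ • ∑ k ∈ Finset.Icc 1 (numBlocks δ) with j ≤ k, (backwardRate c (Z k)).cov) :
    K.PosSemidef := by
  rw [h]
  exact ((Matrix.posSemidef_sum _ fun k _ => forwardRate_cov_posSemidef hc _).smul hδ.le).add
    ((Matrix.posSemidef_sum _ fun k _ => backwardRate_cov_posSemidef hc _).smul hδ.le)

theorem discreteRhs_cov_posSemidef (hc : IsUpdateRule c) (hδ : 0 < δ) (Z : ℕ → State T) {j : ℕ}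
    (hj : j ≤ numBlocks δ) : (discreteRhs c δ Z j).cov.PosSemidef := by
  refine posSemidef_of_discrete hc hδ (Z := Z) (j := j) ?_
  ext s t
  change (discreteRhs c δ Z j).1 s t = _
  rw [discreteRhs_fst hj]
  simp [Matrix.sum_apply, forwardRate_cov, backwardRate_cov]

theorem quadForm_discrete {Z : ℕ → State T} {j : ℕ}
    (h : (Z j).cov = δ • (∑ k ∈ Finset.Icc 1 (numBlocks δ) with k < j, (forwardRate c (Z k)).cov)
      + δ • ∑ k ∈ Finset.Icc 1 (numBlocks δ) with j ≤ k, (backwardRate c (Z k)).cov)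
    (x : Fin T → ℝ) :
    x ⬝ᵥ (Z j).cov *ᵥ x =
      δ * (∑ k ∈ Finset.Icc 1 (numBlocks δ) with k < j, x ⬝ᵥ (forwardRate c (Z k)).cov *ᵥ x)
      + δ * ∑ k ∈ Finset.Icc 1 (numBlocks δ) with j ≤ k, x ⬝ᵥ (backwardRate c (Z k)).cov *ᵥ x := by
  rw [h, Matrix.add_mulVec, Matrix.smul_mulVec, Matrix.smul_mulVec, dotProduct_add,
    dotProduct_smul, dotProduct_smul, Matrix.sum_mulVec, Matrix.sum_mulVec, dotProduct_sum,
    dotProduct_sum, smul_eq_mul, smul_eq_mul]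

/-- Lower bound for the covariance from a set of blocks to the right. -/
theorem coerciveBelow_of_backward (hc : IsUpdateRule c) (hδ : 0 < δ) {Z : ℕ → State T} {j t : ℕ}
    (h : (Z j).cov = δ • (∑ k ∈ Finset.Icc 1 (numBlocks δ) with k < j, (forwardRate c (Z k)).cov)
      + δ • ∑ k ∈ Finset.Icc 1 (numBlocks δ) with j ≤ k, (backwardRate c (Z k)).cov)
    {A : Finset ℕ} (hA : ∀ k ∈ A, 1 ≤ k ∧ k ≤ numBlocks δ ∧ j ≤ k) {l : ℝ}
    (hl : ∀ k ∈ A, CoerciveBelow l t (corr c (Z k).cov (Z k).2)) :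
    CoerciveBelow (δ * A.card * l) t (Z j).cov := by
  intro x hx
  rw [quadForm_discrete h]
  have h1 : 0 ≤ ∑ k ∈ Finset.Icc 1 (numBlocks δ) with k < j,
      x ⬝ᵥ (forwardRate c (Z k)).cov *ᵥ x := Finset.sum_nonneg fun k _ => by
    exact quadForm_nonneg (forwardRate_cov_posSemidef hc (Z k)) x
  have h2 : ∑ k ∈ A, l * (x ⬝ᵥ x) ≤ ∑ k ∈ Finset.Icc 1 (numBlocks δ) with j ≤ k,
      x ⬝ᵥ (backwardRate c (Z k)).cov *ᵥ x := by
    refine (Finset.sum_le_sum fun k hk => (hl k hk).submatrix_castSucc x hx).trans ?_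
    refine Finset.sum_le_sum_of_subset_of_nonneg (fun k hk => ?_) fun k _ _ => ?_
    · have := hA k hk
      simp only [Finset.mem_filter, Finset.mem_Icc]
      omega
    · exact quadForm_nonneg (backwardRate_cov_posSemidef hc (Z k)) x
  rw [Finset.sum_const, nsmul_eq_mul] at h2
  have h3 := mul_le_mul_of_nonneg_left h2 hδ.le
  have h4 := mul_nonneg hδ.le h1
  linarith

/-- Lower bound for the covariance from a set of blocks to the left. -/
theorem coerciveBelow_of_forward (hc : IsUpdateRule c) (hδ : 0 < δ) {Z : ℕ → State T} {j t : ℕ}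
    (h : (Z j).cov = δ • (∑ k ∈ Finset.Icc 1 (numBlocks δ) with k < j, (forwardRate c (Z k)).cov)
      + δ • ∑ k ∈ Finset.Icc 1 (numBlocks δ) with j ≤ k, (backwardRate c (Z k)).cov)
    {A : Finset ℕ} (hA : ∀ k ∈ A, 1 ≤ k ∧ k ≤ numBlocks δ ∧ k < j) {l : ℝ}
    (hl : ∀ k ∈ A, CoerciveBelow l (t + 1) (corr c (Z k).cov (Z k).2)) :
    CoerciveBelow (δ * A.card * l) t (Z j).cov := by
  intro x hx
  rw [quadForm_discrete h]
  have h1 : 0 ≤ ∑ k ∈ Finset.Icc 1 (numBlocks δ) with j ≤ k,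
      x ⬝ᵥ (backwardRate c (Z k)).cov *ᵥ x := Finset.sum_nonneg fun k _ => by
    exact quadForm_nonneg (backwardRate_cov_posSemidef hc (Z k)) x
  have h2 : ∑ k ∈ A, l * (x ⬝ᵥ x) ≤ ∑ k ∈ Finset.Icc 1 (numBlocks δ) with k < j,
      x ⬝ᵥ (forwardRate c (Z k)).cov *ᵥ x := by
    refine (Finset.sum_le_sum fun k hk => (hl k hk).submatrix_succ x hx).trans ?_
    refine Finset.sum_le_sum_of_subset_of_nonneg (fun k hk => ?_) fun k _ _ => ?_
    · have := hA k hk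
      simp only [Finset.mem_filter, Finset.mem_Icc]
      omega
    · exact quadForm_nonneg (forwardRate_cov_posSemidef hc (Z k)) x
  rw [Finset.sum_const, nsmul_eq_mul] at h2
  have h3 := mul_le_mul_of_nonneg_left h2 hδ.le
  have h4 := mul_nonneg hδ.le h1
  linarith

/-- The covariances of a solution of the difference equations are positive definite. -/
theorem posDef_of_discrete (hc : IsUpdateRule c) (hδ : δ ∈ Ioo (0 : ℝ) 1) {Z : ℕ → State T}
    (h : ∀ j ≤ numBlocks δ,
      (Z j).cov = δ • (∑ k ∈ Finset.Icc 1 (numBlocks δ) with k < j, (forwardRate c (Z k)).cov)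
      + δ • ∑ k ∈ Finset.Icc 1 (numBlocks δ) with j ≤ k, (backwardRate c (Z k)).cov)
    {j : ℕ} (hj : j ≤ numBlocks δ) : Z j ∈ posStates T := by
  have hpsd : ∀ j ≤ numBlocks δ, (Z j).cov.PosSemidef := fun j hj =>
    posSemidef_of_discrete hc hδ.1 (h j hj)
  have key : ∀ t : ℕ, ∃ l : ℝ, 0 < l ∧ ∀ j ≤ numBlocks δ, CoerciveBelow l t (Z j).cov := by
    intro t
    induction t with
    | zero =>
      refine ⟨1, one_pos, fun j _ x hx => ?_⟩
      have : x = 0 := funext fun i => hx i (Nat.zero_le _)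
      simp [this]
    | succ t ih =>
      obtain ⟨l, hl, hlj⟩ := ih
      obtain ⟨k, hk, hkc⟩ := exists_coerciveBelow_corr hc (hpsd _ le_rfl) hl (hlj _ le_rfl)
      -- The last block belongs to the backward sum of every `j`, so its correlations alone give a
      -- lower bound. The bound degrades with `δ` and serves only for fixed block size.
      refine ⟨δ * k, mul_pos hδ.1 hk, fun j hj => ?_⟩
      have := coerciveBelow_of_backward hc hδ.1 (h j hj) (A := {numBlocks δ}) (t := t + 1) (l := k)
        (fun i hi => by
          rw [Finset.mem_singleton] at hi
          subst hi
          exact ⟨one_le_numBlocks hδ, le_rfl, hj⟩)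
        (fun i hi => by
          rw [Finset.mem_singleton] at hi
          subst hi
          exact hkc)
      simpa using this
  obtain ⟨l, hl, hlj⟩ := key T
  exact (hlj j hj).posDef hl le_rfl (hpsd j hj).1

/-- Agreement of two sequences in the first `t` passes, and in pass `t + 1` for the blocks before
`j`. -/
def AgreeUpTo (n t j : ℕ) (Z W : ℕ → State T) : Prop :=
  (∀ k ≤ n, truncState t (Z k) = truncState t (W k)) ∧
    ∀ k ≤ n, k < j → truncState (t + 1) (Z k) = truncState (t + 1) (W k)

theorem truncState_eq_of_succ {t : ℕ} {z w : State T}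
    (h : truncState (t + 1) z = truncState (t + 1) w) : truncState t z = truncState t w := by
  rw [truncState_eq_iff] at h ⊢
  exact ⟨fun i j hi hj => h.1 i j (by omega) (by omega), fun s hs => h.2 s (by omega)⟩

/-- For pass `t + 1` at block `k`, the backward and self terms see only the first `t` passes, and
the forward term sees pass `t + 1` only at blocks before `k`. One application therefore extends the
agreement by one block. -/
theorem agreeUpTo_discreteRhs (hc : IsUpdateRule c) {t j : ℕ} (ht : t < T) {Z W : ℕ → State T}
    (hZ : ∀ k ≤ numBlocks δ, (Z k).cov.PosSemidef) (hW : ∀ k ≤ numBlocks δ, (W k).cov.PosSemidef)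
    (h : AgreeUpTo (numBlocks δ) t j Z W) :
    AgreeUpTo (numBlocks δ) t (j + 1) (discreteRhs c δ Z) (discreteRhs c δ W) := by
  have hmem : ∀ {k i : ℕ} {p : ℕ → Prop} [DecidablePred p],
      i ∈ (Finset.Icc 1 (numBlocks δ)).filter p → i ≤ numBlocks δ ∧ p i := by
    intro k i p _ hi
    rw [Finset.mem_filter, Finset.mem_Icc] at hi
    exact ⟨hi.1.2, hi.2⟩
  have hback : ∀ k, ∑ i ∈ Finset.Icc 1 (numBlocks δ) with k < i,
      truncState (t + 1) (backwardRate c (Z i)) = ∑ i ∈ Finset.Icc 1 (numBlocks δ) with k < i,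
      truncState (t + 1) (backwardRate c (W i)) := fun k =>
    Finset.sum_congr rfl fun i hi => by
      have hi := (hmem (k := k) hi).1
      exact backwardRate_congr hc ht.le (hZ i hi) (hW i hi) (h.1 i hi)
  have hself : ∀ k ≤ numBlocks δ, truncState (t + 1) (selfRate c (1 ≤ k) (Z k)) =
      truncState (t + 1) (selfRate c (1 ≤ k) (W k)) := fun k hk =>
    selfRate_congr hc ht.le _ (hZ k hk) (hW k hk) (h.1 k hk)
  constructor
  · intro k hk
    simp only [discreteRhs, map_add, map_smul, map_sum]
    congr 2
    · congr 1
      exact Finset.sum_congr rfl fun i hi => by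
        have hi := (hmem (k := k) hi).1
        exact forwardRate_congr hc ht.le (hZ i hi) (hW i hi) (h.1 i hi)
    · congr 1
      exact Finset.sum_congr rfl fun i hi => by
        have hi := (hmem (k := k) hi).1
        exact truncState_eq_of_succ
          (backwardRate_congr hc ht.le (hZ i hi) (hW i hi) (h.1 i hi))
    · exact truncState_eq_of_succ (hself k hk)
  · intro k hk hkj
    simp only [discreteRhs, map_add, map_smul, map_sum]
    rw [hback k, hself k hk]
    congr 3
    exact Finset.sum_congr rfl fun i hi => by
      have hi := hmem (k := k) hi
      exact forwardRate_congr hc ht (hZ i hi.1) (hW i hi.1)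
        (h.2 i hi.1 (hi.2.trans_le (Nat.lt_succ_iff.1 hkj)))

theorem iterate_discreteRhs_eq (hc : IsUpdateRule c) (hδ : 0 < δ) {Z W : ℕ → State T}
    (hZ : ∀ k ≤ numBlocks δ, (Z k).cov.PosSemidef) (hW : ∀ k ≤ numBlocks δ, (W k).cov.PosSemidef)
    {k : ℕ} (hk : k ≤ numBlocks δ) :
    (discreteRhs c δ)^[T * (numBlocks δ + 1)] Z k = (discreteRhs c δ)^[T * (numBlocks δ + 1)] W k := by
  have hpsd : ∀ {Z : ℕ → State T}, (∀ k ≤ numBlocks δ, (Z k).cov.PosSemidef) →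
      ∀ m : ℕ, ∀ k ≤ numBlocks δ, ((discreteRhs c δ)^[m] Z k).cov.PosSemidef := by
    intro Z hZ m k hk
    cases m with
    | zero => exact hZ k hk
    | succ m =>
      rw [Function.iterate_succ_apply']
      exact discreteRhs_cov_posSemidef hc hδ _ hk
  have key : ∀ t ≤ T, AgreeUpTo (numBlocks δ) t 0 ((discreteRhs c δ)^[t * (numBlocks δ + 1)] Z)
      ((discreteRhs c δ)^[t * (numBlocks δ + 1)] W) := by
    intro t
    induction t with
    | zero =>
      intro _
      refine ⟨fun k _ => truncState_eq_iff.2 ⟨fun i j hi => absurd hi (Nat.not_lt_zero _),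
        fun s hs => absurd hs (Nat.not_lt_zero _)⟩, fun k _ h => absurd h (Nat.not_lt_zero _)⟩
    | succ t ih =>
      intro ht
      have hinner : ∀ j, AgreeUpTo (numBlocks δ) t j
          ((discreteRhs c δ)^[t * (numBlocks δ + 1) + j] Z)
          ((discreteRhs c δ)^[t * (numBlocks δ + 1) + j] W) := by
        intro j
        induction j with
        | zero => exact ih (Nat.le_of_succ_le ht)
        | succ j ihj =>
          rw [← add_assoc, Function.iterate_succ_apply', Function.iterate_succ_apply']
          exact agreeUpTo_discreteRhs hc ht (hpsd hZ _) (hpsd hW _) ihj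
      -- There are `n + 1` positions `0, …, n`, so `n + 1` applications settle one pass.
      have h := hinner (numBlocks δ + 1)
      rw [show (t + 1) * (numBlocks δ + 1) = t * (numBlocks δ + 1) + (numBlocks δ + 1) by ring]
      exact ⟨fun k hk => h.2 k hk (Nat.lt_succ_of_le hk), fun k _ h => absurd h (Nat.not_lt_zero _)⟩
  have h := (key T le_rfl).1 k hk
  rwa [truncState_of_le le_rfl, truncState_of_le le_rfl] at h

theorem discreteRhs_congr {Z W : ℕ → State T} (h : ∀ k ≤ numBlocks δ, Z k = W k) {j : ℕ}
    (hj : j ≤ numBlocks δ) : discreteRhs c δ Z j = discreteRhs c δ W j := by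
  have hmem : ∀ {i : ℕ} {p : ℕ → Prop} [DecidablePred p],
      i ∈ (Finset.Icc 1 (numBlocks δ)).filter p → i ≤ numBlocks δ := by
    intro i p _ hi
    rw [Finset.mem_filter, Finset.mem_Icc] at hi
    exact hi.1.2
  simp only [discreteRhs]
  rw [h j hj, Finset.sum_congr rfl fun i hi => by rw [h i (hmem hi)],
    Finset.sum_congr (s₁ := (Finset.Icc 1 (numBlocks δ)).filter fun k => j < k) rfl
    fun i hi => by rw [h i (hmem hi)]]

theorem exists_discrete_fixedPoint (hc : IsUpdateRule c) (T : ℕ) (hδ : 0 < δ) :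
    ∃ Z : ℕ → State T, ∀ j ≤ numBlocks δ, Z j = discreteRhs c δ Z j := by
  have h0 : ∀ k ≤ numBlocks δ, ((fun _ => 0 : ℕ → State T) k).cov.PosSemidef := fun k _ =>
    Matrix.PosSemidef.zero
  refine ⟨(discreteRhs c δ)^[T * (numBlocks δ + 1)] fun _ => 0, fun j hj => ?_⟩
  -- With `N = T (n + 1)`, the `N`-th iterate forgets its starting point. Starting from `0` and from
  -- the image of `0` gives the same result, which is the fixed point equation.
  rw [← Function.iterate_succ_apply' (discreteRhs c δ), Function.iterate_succ_apply]
  exact iterate_discreteRhs_eq hc hδ h0 (fun k hk => discreteRhs_cov_posSemidef hc hδ _ hk) hj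

theorem discrete_fixedPoint_unique (hc : IsUpdateRule c) (hδ : 0 < δ) {Z W : ℕ → State T}
    (hZ : ∀ j ≤ numBlocks δ, Z j = discreteRhs c δ Z j)
    (hW : ∀ j ≤ numBlocks δ, W j = discreteRhs c δ W j) {j : ℕ} (hj : j ≤ numBlocks δ) :
    Z j = W j := by
  have hiter : ∀ {Z : ℕ → State T}, (∀ j ≤ numBlocks δ, Z j = discreteRhs c δ Z j) →
      ∀ m : ℕ, ∀ j ≤ numBlocks δ, (discreteRhs c δ)^[m] Z j = Z j := by
    intro Z hZ m
    induction m with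
    | zero => exact fun _ _ => rfl
    | succ m ih =>
      intro j hj
      rw [Function.iterate_succ_apply', discreteRhs_congr ih hj, ← hZ j hj]
  rw [← hiter hZ (T * (numBlocks δ + 1)) j hj, ← hiter hW (T * (numBlocks δ + 1)) j hj]
  exact iterate_discreteRhs_eq hc hδ
    (fun k hk => by rw [hZ k hk]; exact discreteRhs_cov_posSemidef hc hδ _ hk)
    (fun k hk => by rw [hW k hk]; exact discreteRhs_cov_posSemidef hc hδ _ hk) hj

end Discrete

/-! ### A priori bounds uniform in the block size. -/

section APriori

variable {c : I × ℝ → ℝ} {T : ℕ} {δ : ℝ}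

theorem abs_mul_sum_le {n : ℕ} {p : ℕ → Prop} [DecidablePred p] {f : ℕ → ℝ} {M : ℝ} (hδ : 0 ≤ δ)
    (hM : 0 ≤ M) (hn : δ * n ≤ 1) (hf : ∀ k, 1 ≤ k → k ≤ n → p k → |f k| ≤ M) :
    |δ * ∑ k ∈ Finset.Icc 1 n with p k, f k| ≤ M := by
  rw [abs_mul, abs_of_nonneg hδ]
  have h1 : |∑ k ∈ Finset.Icc 1 n with p k, f k| ≤ n * M := by
    refine (Finset.abs_sum_le_sum_abs _ _).trans ?_
    refine (Finset.sum_le_card_nsmul _ _ M fun k hk => ?_).trans ?_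
    · rw [Finset.mem_filter, Finset.mem_Icc] at hk
      exact hf k hk.1.1 hk.1.2 hk.2
    · rw [nsmul_eq_mul]
      gcongr
      simpa using Finset.card_filter_le (Finset.Icc 1 n) p
  calc δ * |∑ k ∈ Finset.Icc 1 n with p k, f k| ≤ δ * (n * M) := by gcongr
    _ = (δ * n) * M := by ring
    _ ≤ 1 * M := by gcongr
    _ = M := one_mul M

/-- Each block contributes exactly one correlation, from the left or from the right, so the entry is
`δ` times a sum of at most `1 / δ` numbers of modulus at most one. -/
theorem abs_discreteRhs_fst_le (hc : IsUpdateRule c) (hδ : 0 < δ) (Z : ℕ → State T) {j : ℕ}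
    (hj : j ≤ numBlocks δ) (s t : Fin T) : |(discreteRhs c δ Z j).1 s t| ≤ 1 := by
  rw [discreteRhs_fst hj, ← mul_add]
  have h1 : ∀ f g : ℕ → ℝ, (∑ k ∈ Finset.Icc 1 (numBlocks δ) with k < j, f k) +
      ∑ k ∈ Finset.Icc 1 (numBlocks δ) with j ≤ k, g k =
      ∑ k ∈ Finset.Icc 1 (numBlocks δ) with True, if k < j then f k else g k := by
    intro f g
    rw [Finset.filter_true, Finset.sum_ite]
    simp only [not_lt]
  rw [h1]
  refine abs_mul_sum_le hδ.le zero_le_one (mul_numBlocks_le_one hδ) fun k _ _ _ => ?_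
  split_ifs <;> exact abs_corr_le_one hc _ _ _ _

/-- The three terms are bounded by `M` each. Kernel entries of index `t + 1` are needed only at the
blocks before `j`, which permits a bootstrap from left to right. -/
theorem abs_discreteRhs_snd_le (hδ : 0 < δ) (hδ1 : δ ≤ 1) {Z : ℕ → State T} {j t : ℕ}
    (hj : j ≤ numBlocks δ) {M : ℝ} (hM : 0 ≤ M)
    (h1 : ∀ k < j, k ≤ numBlocks δ → ∀ a b : Fin (T + 1), a.val ≤ t + 1 → b.val ≤ t + 1 →
      |rawKernel c (Z k) a b| ≤ M)
    (h2 : ∀ k ≤ numBlocks δ, ∀ a b : Fin (T + 1), a.val ≤ t → b.val ≤ t →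
      |rawKernel c (Z k) a b| ≤ M) {s : Fin T} (hs : s.val < t + 1) (r : Fin (s.val + 1)) :
    |(discreteRhs c δ Z j).2 s r| ≤ 3 * M := by
  have hr := r.isLt
  rw [discreteRhs_snd]
  have b1 := abs_mul_sum_le (p := fun k => k < j) (f := fun k => newCol (rawKernel c (Z k)) s r)
    hδ.le hM (mul_numBlocks_le_one hδ) fun k _ hk hkj => h1 k hkj hk _ _
      (by simp only [Fin.val_castLE]; omega) (by simp only [Fin.val_succ]; omega)
  have b2 := abs_mul_sum_le (p := fun k => j < k) (f := fun k => shiftCol (rawKernel c (Z k)) s r)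
    hδ.le hM (mul_numBlocks_le_one hδ) fun k _ hk _ => by
      simp only [shiftCol]
      refine Fin.cases ?_ (fun i => ?_) r
      · simpa using hM
      · rw [Fin.cons_succ]
        have := i.isLt
        exact h2 k hk _ _ (by simp only [Fin.val_castLE]; omega)
          (by simp only [Fin.val_castSucc]; omega)
  have b3 : |δ * oldCol (rawKernel c (Z j)) s r| ≤ M := by
    rw [abs_mul, abs_of_pos hδ]
    have := h2 j hj (Fin.castLE (Nat.le_succ_of_le s.isLt) r) s.castSucc
      (by simp only [Fin.val_castLE]; omega) (by simp only [Fin.val_castSucc]; omega)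
    calc δ * |oldCol (rawKernel c (Z j)) s r| ≤ 1 * M := by gcongr; exact this
      _ = M := one_mul M
  refine (abs_add_le _ _).trans ?_
  have := abs_add_le (δ * ∑ k ∈ Finset.Icc 1 (numBlocks δ) with k < j,
    newCol (rawKernel c (Z k)) s r) (δ * ∑ k ∈ Finset.Icc 1 (numBlocks δ) with j < k,
    shiftCol (rawKernel c (Z k)) s r)
  linarith

/-- The inductive step of the a priori bounds, from `t` to `t + 1` passes. -/
theorem exists_discrete_bounds_succ (hc : IsUpdateRule c) {t : ℕ} (ht : t < T) {l B : ℝ}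
    (hl : 0 < l) (hl1 : l ≤ 1) (hB : 0 ≤ B) :
    ∃ l' B' : ℝ, 0 < l' ∧ l' ≤ 1 ∧ 0 ≤ B' ∧ ∀ δ : ℝ, 0 < δ → δ ≤ 1 / 4 → ∀ Z : ℕ → State T,
      (∀ j ≤ numBlocks δ, Z j = discreteRhs c δ Z j) →
      (∀ j ≤ numBlocks δ, CoerciveBelow l t (Z j).cov ∧
        ∀ s : Fin T, s.val < t → ∀ r, |(Z j).2 s r| ≤ B) →
      ∀ j ≤ numBlocks δ, CoerciveBelow l' (t + 1) (Z j).cov ∧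
        ∀ s : Fin T, s.val < t + 1 → ∀ r, |(Z j).2 s r| ≤ B' := by
  -- All constants are fixed before `δ`: first for the blocks with `δ j ≤ 1 / 2` (`k`, `M1`, `B1`),
  -- then, from the correlations of these early blocks on one more spin (`k2`), for all blocks
  -- (`l2`, `M2`).
  obtain ⟨k, hk, hk1, hkc⟩ := exists_uniform_coerciveBelow_corr hc T hl hl1 hB
  obtain ⟨M0, hM0, hM0'⟩ := exists_bound_rawKernel (T := T) hc t ht.le hl hk
  have hk4 : 0 < 1 / 4 * k := by positivity
  obtain ⟨M1, hM1, hM1'⟩ := exists_bound_rawKernel (T := T) hc (t + 1) ht hk4 hk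
  set B1 : ℝ := 3 * max M0 M1 with hB1
  have hmax1 : 0 ≤ max M0 M1 := hM0.trans (le_max_left _ _)
  obtain ⟨k2, hk2, hk21, hk2c⟩ := exists_uniform_coerciveBelow_corr hc T (B := B1) hk4
    (by linarith) (by positivity)
  set l2 : ℝ := min (1 / 4 * k) (1 / 4 * k2) with hl2
  have hl2pos : 0 < l2 := lt_min hk4 (by positivity)
  obtain ⟨M2, hM2, hM2'⟩ := exists_bound_rawKernel (T := T) hc (t + 1) ht hl2pos hk
  have hmax2 : 0 ≤ max M0 M2 := hM0.trans (le_max_left _ _)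
  refine ⟨l2, 3 * max M0 M2, hl2pos, (min_le_left _ _).trans (by linarith), by positivity,
    fun δ hδ hδ4 Z hZ hprev => ?_⟩
  have hδ1 : δ ≤ 1 := by linarith
  have hn1 := one_lt_mul_numBlocks_add hδ
  have hpsd : ∀ j ≤ numBlocks δ, (Z j).cov.PosSemidef := fun j hj => by
    rw [hZ j hj]; exact discreteRhs_cov_posSemidef hc hδ _ hj
  have habs : ∀ j ≤ numBlocks δ, ∀ a b, |(Z j).1 a b| ≤ 1 := fun j hj a b => by
    rw [hZ j hj]; exact abs_discreteRhs_fst_le hc hδ _ hj a b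
  have hcov : ∀ j ≤ numBlocks δ, _ := fun j hj => cov_eq_of_discrete (c := c) (δ := δ) (Z := Z)
    (j := j) fun s t => by
      rw [show (Z j).1 s t = (discreteRhs c δ Z j).1 s t by rw [← hZ j hj]]
      exact discreteRhs_fst hj s t
  have hcorr : ∀ j ≤ numBlocks δ, CoerciveBelow k (t + 1) (corr c (Z j).cov (Z j).2) :=
    fun j hj => hkc t _ (hpsd j hj) (hprev j hj).1 (habs j hj) (hprev j hj).2
  have hker0 : ∀ j ≤ numBlocks δ, ∀ a b : Fin (T + 1), a.val ≤ t → b.val ≤ t →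
      |rawKernel c (Z j) a b| ≤ M0 := fun j hj =>
    hM0' _ (hpsd j hj) (hprev j hj).1 ((hcorr j hj).mono_right t.le_succ) (habs j hj)
  -- The blocks to the right of an early `j` have total length `δ (n - j) ≥ 1 - δ - 1 / 2 ≥ 1 / 4`.
  have hearly : ∀ j ≤ numBlocks δ, δ * j ≤ 1 / 2 → CoerciveBelow (1 / 4 * k) (t + 1) (Z j).cov := by
    intro j hj hj2
    refine (coerciveBelow_of_backward hc hδ (hcov j hj) (A := Finset.Icc (j + 1) (numBlocks δ))
      (fun i hi => by rw [Finset.mem_Icc] at hi; omega)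
      fun i hi => hcorr i (Finset.mem_Icc.1 hi).2).mono_left ?_
    gcongr
    rw [Nat.card_Icc, show numBlocks δ + 1 - (j + 1) = numBlocks δ - j by omega, Nat.cast_sub hj,
      mul_sub]
    linarith
  have hker1 : ∀ j ≤ numBlocks δ, δ * j ≤ 1 / 2 → ∀ a b : Fin (T + 1), a.val ≤ t + 1 →
      b.val ≤ t + 1 → |rawKernel c (Z j) a b| ≤ M1 := fun j hj hj2 =>
    hM1' _ (hpsd j hj) (hearly j hj hj2) (hcorr j hj) (habs j hj)
  -- The forward sum runs over `k < j`, which are early as well, so the kernel bound for early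
  -- blocks suffices.
  have hdrift1 : ∀ j ≤ numBlocks δ, δ * j ≤ 1 / 2 → ∀ s : Fin T, s.val < t + 1 →
      ∀ r, |(Z j).2 s r| ≤ B1 := by
    intro j hj hj2 s hs r
    rw [hZ j hj]
    refine abs_discreteRhs_snd_le hδ hδ1 hj hmax1 (fun i hij hi a b ha hb => ?_)
      (fun i hi a b ha hb => (hker0 i hi a b ha hb).trans (le_max_left _ _)) hs r
    refine (hker1 i hi ?_ a b ha hb).trans (le_max_right _ _)
    have : (i : ℝ) ≤ j := by exact_mod_cast hij.le
    nlinarith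
  have hcorr2 : ∀ j ≤ numBlocks δ, δ * j ≤ 1 / 2 →
      CoerciveBelow k2 (t + 1 + 1) (corr c (Z j).cov (Z j).2) := fun j hj hj2 =>
    hk2c (t + 1) _ (hpsd j hj) (hearly j hj hj2) (habs j hj) (hdrift1 j hj hj2)
  have hall : ∀ j ≤ numBlocks δ, CoerciveBelow l2 (t + 1) (Z j).cov := by
    intro j hj
    rcases le_or_gt (δ * j) (1 / 2) with hj2 | hj2
    · exact (hearly j hj hj2).mono_left (min_le_left _ _)
    -- For late `j` the blocks to the right may be too few. The early blocks `1, …, m` lie to the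
    -- left and have total length between `1 / 4` and `1 / 2`; the index lost in the forward rate is
    -- covered by `hcorr2`, which reaches `t + 2` spins.
    · set m := ⌊1 / (2 * δ)⌋₊ with hm
      have hm1 : δ * m ≤ 1 / 2 := by
        have h := Nat.floor_le (a := 1 / (2 * δ)) (by positivity)
        calc δ * m ≤ δ * (1 / (2 * δ)) := by gcongr
          _ = 1 / 2 := by field_simp
      have hm2 : 1 / 4 ≤ δ * m := by
        have h := Nat.lt_floor_add_one (1 / (2 * δ))
        have h' : 1 / 2 < δ * m + δ := by
          calc (1 : ℝ) / 2 = δ * (1 / (2 * δ)) := by field_simp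
            _ < δ * (m + 1) := by gcongr
            _ = _ := by ring
        linarith
      have hmj : m < j := by
        have : (m : ℝ) < j := by
          by_contra hcon
          have := mul_le_mul_of_nonneg_left (not_lt.1 hcon) hδ.le
          linarith
        exact_mod_cast this
      refine ((coerciveBelow_of_forward hc hδ (hcov j hj) (A := Finset.Icc 1 m)
        (fun i hi => by rw [Finset.mem_Icc] at hi; omega)
        fun i hi => hcorr2 i (by rw [Finset.mem_Icc] at hi; omega) ?_).mono_left ?_).mono_left
        (min_le_right _ _)
      · have : (i : ℝ) ≤ m := by exact_mod_cast (Finset.mem_Icc.1 hi).2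
        nlinarith
      · gcongr
        simpa using hm2
  refine fun j hj => ⟨hall j hj, fun s hs r => ?_⟩
  rw [hZ j hj]
  exact abs_discreteRhs_snd_le hδ hδ1 hj hmax2
    (fun i _ hi a b ha hb => (hM2' _ (hpsd i hi) (hall i hi) (hcorr i hi) (habs i hi) a b ha hb).trans
      (le_max_right _ _))
    (fun i hi a b ha hb => (hker0 i hi a b ha hb).trans (le_max_left _ _)) hs r

/-- Solutions of the difference equations stay in a compact set of nondegenerate states, uniformly
in the block size. -/
theorem exists_discrete_bounds (hc : IsUpdateRule c) (T : ℕ) :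
    ∃ l B : ℝ, 0 < l ∧ ∀ δ : ℝ, 0 < δ → δ ≤ 1 / 4 → ∀ Z : ℕ → State T,
      (∀ j ≤ numBlocks δ, Z j = discreteRhs c δ Z j) →
      ∀ j ≤ numBlocks δ, Z j ∈ boundedStates T l B := by
  have key : ∀ t ≤ T, ∃ l B : ℝ, 0 < l ∧ l ≤ 1 ∧ 0 ≤ B ∧ ∀ δ : ℝ, 0 < δ → δ ≤ 1 / 4 →
      ∀ Z : ℕ → State T, (∀ j ≤ numBlocks δ, Z j = discreteRhs c δ Z j) →
      ∀ j ≤ numBlocks δ, CoerciveBelow l t (Z j).cov ∧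
        ∀ s : Fin T, s.val < t → ∀ r, |(Z j).2 s r| ≤ B := by
    intro t
    induction t with
    | zero =>
      refine fun _ => ⟨1, 0, one_pos, le_rfl, le_rfl, fun δ _ _ Z _ j _ => ⟨fun x hx => ?_,
        fun s hs => absurd hs (Nat.not_lt_zero _)⟩⟩
      have : x = 0 := funext fun i => hx i (Nat.zero_le _)
      simp [this]
    | succ t ih =>
      intro ht
      obtain ⟨l, B, hl, hl1, hB, h⟩ := ih (Nat.le_of_succ_le ht)
      obtain ⟨l', B', hl', hl1', hB', h'⟩ := exists_discrete_bounds_succ hc ht hl hl1 hB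
      exact ⟨l', B', hl', hl1', hB', fun δ hδ hδ4 Z hZ => h' δ hδ hδ4 Z hZ (h δ hδ hδ4 Z hZ)⟩
  obtain ⟨l, B, hl, -, -, h⟩ := key T le_rfl
  refine ⟨l, B, hl, fun δ hδ hδ4 Z hZ j hj => ?_⟩
  obtain ⟨h1, h2⟩ := h δ hδ hδ4 Z hZ j hj
  refine ⟨?_, h1, ?_, fun s r => h2 s s.isLt r⟩
  · rw [hZ j hj]
    exact (discreteRhs_cov_posSemidef hc hδ _ hj).1
  · intro a b
    rw [hZ j hj]
    exact abs_discreteRhs_fst_le hc hδ _ hj a b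

end APriori

/-! ### Interpolation over the blocks and Riemann sums. -/

theorem norm_min_sub_min_le {E : Type*} [NormedAddCommGroup E] {n : ℕ} {Z : ℕ → E} {A : ℝ} (hA : 0 ≤ A)
    (hZ : ∀ j < n, ‖Z (j + 1) - Z j‖ ≤ A) (i : ℕ) : ‖Z (min (i + 1) n) - Z (min i n)‖ ≤ A := by
  rcases lt_or_ge i n with h | h
  · rw [min_eq_left h, min_eq_left h.le]
    exact hZ i h
  · rw [min_eq_right h, min_eq_right (by omega), sub_self, norm_zero]
    exact hA

section Interpolation

variable {E : Type*} [NormedAddCommGroup E] [NormedSpace ℝ E] {δ : ℝ}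

/-- Vector-valued version of `interp`. -/
noncomputable def vecInterp (δ : ℝ) (Z : ℕ → E) (x : ℝ) : E :=
  (1 - Int.fract (x / δ)) • Z (min ⌊x / δ⌋₊ (numBlocks δ))
    + Int.fract (x / δ) • Z (min (⌊x / δ⌋₊ + 1) (numBlocks δ))

theorem vecInterp_eq (Z : ℕ → E) (x : ℝ) :
    vecInterp δ Z x = Z (min ⌊x / δ⌋₊ (numBlocks δ)) + Int.fract (x / δ) •
      (Z (min (⌊x / δ⌋₊ + 1) (numBlocks δ)) - Z (min ⌊x / δ⌋₊ (numBlocks δ))) := by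
  rw [vecInterp, sub_smul, one_smul, smul_sub]
  abel

theorem norm_vecInterp_sub_le {Z : ℕ → E} {A : ℝ} (hA : 0 ≤ A)
    (hZ : ∀ j < numBlocks δ, ‖Z (j + 1) - Z j‖ ≤ A) (x : ℝ) :
    ‖vecInterp δ Z x - Z (min ⌊x / δ⌋₊ (numBlocks δ))‖ ≤ A := by
  rw [vecInterp_eq, add_sub_cancel_left, norm_smul, Real.norm_of_nonneg (Int.fract_nonneg _)]
  calc Int.fract (x / δ) * _ ≤ 1 * A := by
        gcongr
        · exact (Int.fract_lt_one _).le
        · exact norm_min_sub_min_le hA hZ _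
    _ = A := one_mul A

/-- On the cell `[i δ, (i+1) δ]` the interpolation is affine. -/
theorem vecInterp_cell (hδ : 0 < δ) (Z : ℕ → E) {i : ℕ} {x : ℝ} (h1 : δ * i ≤ x)
    (h2 : x ≤ δ * (i + 1)) :
    vecInterp δ Z x = Z (min i (numBlocks δ)) + (x / δ - i) •
      (Z (min (i + 1) (numBlocks δ)) - Z (min i (numBlocks δ))) := by
  have hx0 : 0 ≤ x / δ := div_nonneg ((by positivity : (0 : ℝ) ≤ δ * i).trans h1) hδ.le
  have h1' : (i : ℝ) ≤ x / δ := by rw [le_div_iff₀ hδ]; linarith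
  have hfr : ∀ m : ℕ, ⌊x / δ⌋₊ = m → Int.fract (x / δ) = x / δ - m := by
    intro m hm
    rw [← Int.self_sub_floor, ← natCast_floor_eq_intCast_floor hx0, hm]
  rcases h2.lt_or_eq with h3 | h3
  · have h3' : x / δ < i + 1 := by rw [div_lt_iff₀ hδ]; linarith
    have hfl : ⌊x / δ⌋₊ = i := (Nat.floor_eq_iff hx0).2 ⟨h1', h3'⟩
    rw [vecInterp_eq, hfr i hfl, hfl]
  -- At the right end of the cell the floor jumps to `i + 1` and the fractional part to `0`; both
  -- formulas give the value at node `i + 1`.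
  · have h3' : x / δ = ((i + 1 : ℕ) : ℝ) := by
      rw [div_eq_iff hδ.ne', h3]; push_cast; ring
    have hfl : ⌊x / δ⌋₊ = i + 1 := by rw [h3', Nat.floor_natCast]
    rw [vecInterp_eq, hfr (i + 1) hfl, hfl, h3']
    push_cast
    simp

theorem norm_vecInterp_sub_vecInterp_le (hδ : 0 < δ) {Z : ℕ → E} {L : ℝ} (hL : 0 ≤ L)
    (hZ : ∀ j < numBlocks δ, ‖Z (j + 1) - Z j‖ ≤ L * δ) {x y : ℝ} (hx : 0 ≤ x) (hxy : x ≤ y) :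
    ‖vecInterp δ Z y - vecInterp δ Z x‖ ≤ L * (y - x) := by
  have hcell : ∀ (i : ℕ) {x y : ℝ}, δ * i ≤ x → x ≤ y → y ≤ δ * (i + 1) →
      ‖vecInterp δ Z y - vecInterp δ Z x‖ ≤ L * (y - x) := by
    intro i x y h1 h2 h3
    rw [vecInterp_cell hδ Z h1 (h2.trans h3), vecInterp_cell hδ Z (h1.trans h2) h3,
      add_sub_add_left_eq_sub, ← sub_smul, norm_smul]
    have h4 : y / δ - i - (x / δ - i) = (y - x) / δ := by ring
    rw [h4, Real.norm_of_nonneg (div_nonneg (by linarith) hδ.le)]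
    calc (y - x) / δ * _ ≤ (y - x) / δ * (L * δ) := by
          exact mul_le_mul_of_nonneg_left (norm_min_sub_min_le (by positivity) hZ i)
            (div_nonneg (by linarith) hδ.le)
      _ = L * (y - x) := by field_simp
  -- The number `m` bounds how many further cells separate `y` from the cell of `x`; the estimate is
  -- chained through the cell endpoints.
  have key : ∀ (m i : ℕ) {x : ℝ}, δ * i ≤ x → x ≤ δ * (i + 1) → x ≤ y → y ≤ δ * (i + 1 + m) →
      ‖vecInterp δ Z y - vecInterp δ Z x‖ ≤ L * (y - x) := by
    intro m
    induction m with
    | zero =>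
      intro i x h1 _ h3 h4
      exact hcell i h1 h3 (by simpa using h4)
    | succ m ih =>
      intro i x h1 h2 h3 h4
      rcases le_or_gt y (δ * (i + 1)) with h5 | h5
      · exact hcell i h1 h3 h5
      · have a := hcell i h1 h2 le_rfl
        have b := ih (i + 1) (x := δ * (i + 1)) (by push_cast; exact le_rfl)
          (by push_cast; nlinarith) h5.le (by push_cast at h4 ⊢; linarith)
        calc ‖vecInterp δ Z y - vecInterp δ Z x‖
            ≤ ‖vecInterp δ Z y - vecInterp δ Z (δ * (i + 1))‖ +
              ‖vecInterp δ Z (δ * (i + 1)) - vecInterp δ Z x‖ := norm_sub_le_norm_sub_add_norm_sub _ _ _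
          _ ≤ L * (y - δ * (i + 1)) + L * (δ * (i + 1) - x) := add_le_add b a
          _ = L * (y - x) := by ring
  obtain ⟨m, hm⟩ := exists_nat_ge (y / δ)
  have hfl := Nat.floor_le (div_nonneg hx hδ.le)
  have hfl2 := Nat.lt_floor_add_one (x / δ)
  have e1 : δ * (x / δ) = x := by field_simp
  have e2 : δ * (y / δ) = y := by field_simp
  refine key m ⌊x / δ⌋₊ ?_ ?_ hxy ?_
  · calc δ * ⌊x / δ⌋₊ ≤ δ * (x / δ) := by gcongr
      _ = x := e1
  · calc x = δ * (x / δ) := e1.symm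
      _ ≤ δ * (⌊x / δ⌋₊ + 1) := by gcongr
  · calc y = δ * (y / δ) := e2.symm
      _ ≤ δ * m := by gcongr
      _ ≤ δ * (⌊x / δ⌋₊ + 1 + m) := by
          gcongr
          have : (0 : ℝ) ≤ ⌊x / δ⌋₊ := Nat.cast_nonneg _
          linarith

theorem floor_le_numBlocks (hδ : 0 < δ) {x : ℝ} (hx : x ≤ 1) : ⌊x / δ⌋₊ ≤ numBlocks δ :=
  Nat.floor_le_floor (by gcongr)

variable [CompleteSpace E]

/-- Riemann sums over the blocks approximate integrals. -/
theorem norm_integral_sub_sum_le (hδ : 0 < δ) {h : ℝ → E} (hh : ContinuousOn h (Icc 0 1))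
    {a : ℕ → E} {M η : ℝ} (hM : 0 ≤ M) (hη : 0 ≤ η) (haM : ∀ k ≤ numBlocks δ, ‖a k‖ ≤ M)
    (hhM : ∀ y ∈ Icc (0 : ℝ) 1, ‖h y‖ ≤ M)
    (hha : ∀ y ∈ Icc (0 : ℝ) 1, ‖h y - a ⌊y / δ⌋₊‖ ≤ η) {x : ℝ} (hx : x ∈ Icc (0 : ℝ) 1) :
    ‖(∫ y in (0 : ℝ)..x, h y) -
      δ • ∑ k ∈ Finset.Icc 1 (numBlocks δ) with k < ⌊x / δ⌋₊, a k‖ ≤ η + 2 * (M * δ) := by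
  set j := ⌊x / δ⌋₊ with hj
  have hjn : j ≤ numBlocks δ := floor_le_numBlocks hδ hx.2
  have hjx : j * δ ≤ x := by
    have := Nat.floor_le (div_nonneg hx.1 hδ.le)
    rwa [le_div_iff₀ hδ] at this
  have hxj : x ≤ (j + 1) * δ := by
    have := (Nat.lt_floor_add_one (x / δ)).le
    rwa [div_le_iff₀ hδ] at this
  have hmono : ∀ {k : ℕ}, k ≤ j → (k : ℝ) * δ ≤ x := fun hk => by
    refine le_trans ?_ hjx
    gcongr
  have hmem : ∀ {k : ℕ}, k ≤ j → (k : ℝ) * δ ∈ Icc (0 : ℝ) 1 := fun hk =>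
    ⟨by positivity, (hmono hk).trans hx.2⟩
  have hii : ∀ {u v : ℝ}, u ∈ Icc (0 : ℝ) 1 → v ∈ Icc (0 : ℝ) 1 →
      IntervalIntegrable h volume u v := fun hu hv =>
    (hh.mono (uIcc_subset_Icc hu hv)).intervalIntegrable
  have hsplit : ∑ k ∈ Finset.range j, ∫ y in (k * δ : ℝ)..((k + 1 : ℕ) * δ), h y =
      ∫ y in ((0 : ℕ) * δ : ℝ)..(j * δ), h y :=
    intervalIntegral.sum_integral_adjacent_intervals (a := fun k : ℕ => (k : ℝ) * δ) fun k hk =>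
      hii (hmem hk.le) (hmem hk)
  have hadd : (∫ y in (0 : ℝ)..x, h y) =
      (∑ k ∈ Finset.range j, ∫ y in (k * δ : ℝ)..((k + 1 : ℕ) * δ), h y) +
        ∫ y in (j * δ : ℝ)..x, h y := by
    rw [hsplit, Nat.cast_zero, zero_mul, intervalIntegral.integral_add_adjacent_intervals]
    · exact hii ⟨le_rfl, zero_le_one⟩ (hmem le_rfl)
    · exact hii (hmem le_rfl) hx
  -- The incomplete last cell is shorter than `δ`.
  have hlast : ‖∫ y in (j * δ : ℝ)..x, h y‖ ≤ M * δ := by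
    refine (intervalIntegral.norm_integral_le_of_norm_le_const (C := M) fun y hy => ?_).trans ?_
    · rw [uIoc_of_le hjx] at hy
      exact hhM y ⟨(hmem le_rfl).1.trans hy.1.le, hy.2.trans hx.2⟩
    · rw [abs_of_nonneg (by linarith)]
      gcongr
      linarith
  have hterm : ∀ k ∈ Finset.range j,
      ‖(∫ y in (k * δ : ℝ)..((k + 1 : ℕ) * δ), h y) - δ • a k‖ ≤ η * δ := by
    intro k hk
    have hkj := Finset.mem_range.1 hk
    have hle : (k : ℝ) * δ ≤ (k + 1 : ℕ) * δ := by gcongr; omega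
    have hlen : ((k + 1 : ℕ) : ℝ) * δ - k * δ = δ := by push_cast; ring
    have hconst : δ • a k = ∫ _y in (k * δ : ℝ)..((k + 1 : ℕ) * δ), a k := by
      rw [intervalIntegral.integral_const, hlen]
    rw [hconst, ← intervalIntegral.integral_sub (hii (hmem hkj.le) (hmem hkj))
      intervalIntegrable_const]
    have hb : ∀ y ∈ Ioo ((k : ℝ) * δ) ((k + 1 : ℕ) * δ), ‖h y - a k‖ ≤ η := by
      intro y hy
      have hyI : y ∈ Icc (0 : ℝ) 1 := ⟨(hmem hkj.le).1.trans hy.1.le, hy.2.le.trans (hmem hkj).2⟩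
      have hfl : ⌊y / δ⌋₊ = k := by
        rw [Nat.floor_eq_iff (div_nonneg hyI.1 hδ.le), le_div_iff₀ hδ, div_lt_iff₀ hδ]
        refine ⟨hy.1.le, ?_⟩
        have := hy.2
        push_cast at this
        exact this
      have := hha y hyI
      rwa [hfl] at this
    -- At the right endpoint the floor is `k + 1` instead of `k`, so the pointwise bound is used
    -- almost everywhere.
    have := intervalIntegral.norm_integral_le_of_norm_le_const_ae (C := η)
      (f := fun y => h y - a k) (a := k * δ) (b := (k + 1 : ℕ) * δ) (by
        have hne : ∀ᵐ y : ℝ, y ≠ (k + 1 : ℕ) * δ := by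
          simp [ae_iff, measure_singleton]
        filter_upwards [hne] with y hy hyI
        rw [uIoc_of_le hle] at hyI
        exact hb y ⟨hyI.1, lt_of_le_of_ne hyI.2 hy⟩)
    rwa [hlen, abs_of_pos hδ] at this
  -- The Riemann sum contains the cell `k = 0`, while the blocks start at `1`; the discrepancy is
  -- one term.
  have hset : ‖(δ • ∑ k ∈ Finset.range j, a k) -
      δ • ∑ k ∈ Finset.Icc 1 (numBlocks δ) with k < j, a k‖ ≤ M * δ := by
    rcases Nat.eq_zero_or_pos j with h0 | hpos
    · rw [h0]
      simp
      positivity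
    · have : Finset.range j = insert 0 ((Finset.Icc 1 (numBlocks δ)).filter fun k => k < j) := by
        ext k
        simp only [Finset.mem_range, Finset.mem_insert, Finset.mem_filter, Finset.mem_Icc]
        omega
      rw [this, Finset.sum_insert (by simp), smul_add, add_sub_cancel_right, norm_smul,
        Real.norm_of_nonneg hδ.le, mul_comm]
      gcongr
      exact haM 0 (Nat.zero_le _)
  have hjδ : (j : ℝ) * δ ≤ 1 := hjx.trans hx.2
  have hsum : ‖(∑ k ∈ Finset.range j, ∫ y in (k * δ : ℝ)..((k + 1 : ℕ) * δ), h y) -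
      δ • ∑ k ∈ Finset.range j, a k‖ ≤ η := by
    rw [Finset.smul_sum, ← Finset.sum_sub_distrib]
    refine (norm_sum_le_of_le _ hterm).trans ?_
    rw [Finset.sum_const, Finset.card_range, nsmul_eq_mul]
    calc (j : ℝ) * (η * δ) = η * (j * δ) := by ring
      _ ≤ η * 1 := by gcongr
      _ = η := mul_one η
  rw [hadd]
  calc _ = ‖((∑ k ∈ Finset.range j, ∫ y in (k * δ : ℝ)..((k + 1 : ℕ) * δ), h y) -
        δ • ∑ k ∈ Finset.range j, a k) + ((δ • ∑ k ∈ Finset.range j, a k) -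
        δ • ∑ k ∈ Finset.Icc 1 (numBlocks δ) with k < j, a k) + ∫ y in (j * δ : ℝ)..x, h y‖ := by
        congr 1; abel
    _ ≤ η + M * δ + M * δ := (norm_add₃_le).trans (by gcongr)
    _ = _ := by ring

/-- Riemann sums over the blocks to the right. -/
theorem norm_integral_sub_sum_right_le (hδ : 0 < δ) {h : ℝ → E}
    (hh : ContinuousOn h (Icc 0 1))
    {a : ℕ → E} {M η : ℝ} (hM : 0 ≤ M) (hη : 0 ≤ η) (haM : ∀ k ≤ numBlocks δ, ‖a k‖ ≤ M)
    (hhM : ∀ y ∈ Icc (0 : ℝ) 1, ‖h y‖ ≤ M)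
    (hha : ∀ y ∈ Icc (0 : ℝ) 1, ‖h y - a ⌊y / δ⌋₊‖ ≤ η) {x : ℝ} (hx : x ∈ Icc (0 : ℝ) 1) :
    ‖(∫ y in x..(1 : ℝ), h y) -
      δ • ∑ k ∈ Finset.Icc 1 (numBlocks δ) with ⌊x / δ⌋₊ < k, a k‖ ≤ 2 * η + 6 * (M * δ) := by
  set j := ⌊x / δ⌋₊ with hj
  have hjn : j ≤ numBlocks δ := floor_le_numBlocks hδ hx.2
  have h1I : (1 : ℝ) ∈ Icc (0 : ℝ) 1 := ⟨zero_le_one, le_rfl⟩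
  have hii : ∀ {u v : ℝ}, u ∈ Icc (0 : ℝ) 1 → v ∈ Icc (0 : ℝ) 1 →
      IntervalIntegrable h volume u v := fun hu hv =>
    (hh.mono (uIcc_subset_Icc hu hv)).intervalIntegrable
  have hint : (∫ y in x..(1 : ℝ), h y) = (∫ y in (0 : ℝ)..1, h y) - ∫ y in (0 : ℝ)..x, h y :=
    (intervalIntegral.integral_interval_sub_left (hii ⟨le_rfl, zero_le_one⟩ h1I)
      (hii ⟨le_rfl, zero_le_one⟩ hx)).symm
  have b1 := norm_integral_sub_sum_le hδ hh hM hη haM hhM hha h1I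
  have b2 := norm_integral_sub_sum_le hδ hh hM hη haM hhM hha hx
  rw [show ⌊1 / δ⌋₊ = numBlocks δ from rfl] at b1
  rw [← hj] at b2
  set n := numBlocks δ with hn
  -- Subtracting the left sums at `n` and at `j` misses the block `n` and retains the block `j`; `r`
  -- corrects these two terms.
  obtain ⟨r, hr, hsum⟩ : ∃ r : E, ‖r‖ ≤ 2 * M ∧ ∑ k ∈ Finset.Icc 1 n with j < k, a k =
      (∑ k ∈ Finset.Icc 1 n with k < n, a k) - (∑ k ∈ Finset.Icc 1 n with k < j, a k) + r := by
    refine ⟨(∑ k ∈ Finset.Icc 1 n with n ≤ k, a k) - ∑ k ∈ Finset.Icc 1 n with k = j, a k, ?_, ?_⟩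
    · have hs : ∀ (p : ℕ → Prop) [DecidablePred p] (i : ℕ), i ≤ n →
          (∀ k, k ∈ (Finset.Icc 1 n).filter p → k = i) →
          ‖∑ k ∈ Finset.Icc 1 n with p k, a k‖ ≤ M := by
        intro p _ i hi hp
        have hsub : (Finset.Icc 1 n).filter p ⊆ {i} := fun k hk => Finset.mem_singleton.2 (hp k hk)
        rcases Finset.subset_singleton_iff.1 hsub with h | h
        · rw [h]; simpa using hM
        · rw [h, Finset.sum_singleton]; exact haM i hi
      have e1 := hs (fun k => n ≤ k) n le_rfl fun k hk => by
        simp only [Finset.mem_filter, Finset.mem_Icc] at hk; omega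
      have e2 := hs (fun k => k = j) j hjn fun k hk => by
        simp only [Finset.mem_filter, Finset.mem_Icc] at hk; omega
      calc _ ≤ _ := norm_sub_le _ _
        _ ≤ M + M := add_le_add e1 e2
        _ = 2 * M := by ring
    · have e1 : (∑ k ∈ Finset.Icc 1 n with k < n, a k) + ∑ k ∈ Finset.Icc 1 n with n ≤ k, a k =
          ∑ k ∈ Finset.Icc 1 n, a k := by
        have := Finset.sum_filter_add_sum_filter_not (Finset.Icc 1 n) (fun k => k < n) a
        simpa only [not_lt] using this
      have e2 : (∑ k ∈ Finset.Icc 1 n with k < j, a k) + ((∑ k ∈ Finset.Icc 1 n with k = j, a k) +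
          ∑ k ∈ Finset.Icc 1 n with j < k, a k) = ∑ k ∈ Finset.Icc 1 n, a k := by
        simp only [Finset.sum_filter]
        rw [← Finset.sum_add_distrib, ← Finset.sum_add_distrib]
        refine Finset.sum_congr rfl fun k _ => ?_
        rcases lt_trichotomy k j with h | h | h
        · simp [h, h.ne, h.le]
        · simp [h]
        · simp [h, h.ne', h.le]
      have e3 := e1.trans e2.symm
      rw [← sub_eq_zero] at e3 ⊢
      rw [← neg_eq_zero, ← e3]
      abel
  have hδr : ‖δ • r‖ ≤ 2 * (M * δ) := by
    rw [norm_smul, Real.norm_of_nonneg hδ.le]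
    nlinarith
  rw [hint, hsum, smul_add, smul_sub]
  calc _ = ‖((∫ y in (0 : ℝ)..1, h y) - δ • ∑ k ∈ Finset.Icc 1 n with k < n, a k) +
        -((∫ y in (0 : ℝ)..x, h y) - δ • ∑ k ∈ Finset.Icc 1 n with k < j, a k) + -(δ • r)‖ := by
        congr 1; abel
    _ ≤ (η + 2 * (M * δ)) + (η + 2 * (M * δ)) + 2 * (M * δ) := by
        refine (norm_add₃_le).trans ?_
        rw [norm_neg, norm_neg]
        gcongr
    _ = _ := by ring

end Interpolation

/-! ### Compactness of Lipschitz paths. -/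

section Paths

variable {E : Type*} [NormedAddCommGroup E] {P : Set E}

/-- The extension to `ℝ` of a path on `[0,1]` in `P`. -/
noncomputable def extendPath (f : BoundedContinuousFunction (Icc (0 : ℝ) 1) P) (x : ℝ) : E :=
  f (projIcc 0 1 zero_le_one x)

theorem continuous_extendPath (f : BoundedContinuousFunction (Icc (0 : ℝ) 1) P) :
    Continuous (extendPath f) :=
  continuous_subtype_val.comp (f.continuous.comp continuous_projIcc)

theorem extendPath_mem (f : BoundedContinuousFunction (Icc (0 : ℝ) 1) P) (x : ℝ) :
    extendPath f x ∈ P := Subtype.coe_prop _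

theorem extendPath_of_mem (f : BoundedContinuousFunction (Icc (0 : ℝ) 1) P) {x : ℝ}
    (hx : x ∈ Icc (0 : ℝ) 1) : extendPath f x = f ⟨x, hx⟩ := by
  rw [extendPath, projIcc_of_mem _ hx]

/-- Arzelà–Ascoli: the values lie in the compact set `P`, the common Lipschitz constant gives
equicontinuity, and it survives limits. -/
theorem isCompact_setOf_lipschitzWith_path [CompactSpace P] (L : NNReal) :
    IsCompact {f : BoundedContinuousFunction (Icc (0 : ℝ) 1) P | LipschitzWith L f} := by
  refine BoundedContinuousFunction.arzela_ascoli₁ _ ?_ ?_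
  · have h : IsClosed {f : Icc (0 : ℝ) 1 → P | LipschitzWith L f} :=
      isClosed_setOfPred_lipschitzWith L
    exact h.preimage BoundedContinuousFunction.continuous_coe
  · exact (LipschitzWith.uniformEquicontinuous _ L fun f => f.2).equicontinuous

end Paths

/-! ### Convergence of approximate solutions of an abstract integral equation. -/

section Convergence

variable {E : Type*} [NormedAddCommGroup E] [NormedSpace ℝ E] {δ : ℝ} {P : Set E} {F G : E → E}
  {M : ℝ}

/-- A sequence of states solving difference equations with rates `F` to the left and `G` to the
right, up to an error of the order of one block. -/
structure IsApproxSolution (P : Set E) (F G : E → E) (M δ : ℝ) (Z : ℕ → E) : Prop where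
  mem : ∀ j ≤ numBlocks δ, Z j ∈ P
  eq_add : ∀ j ≤ numBlocks δ, ∃ e : E, ‖e‖ ≤ M ∧
    Z j = δ • (∑ k ∈ Finset.Icc 1 (numBlocks δ) with k < j, F (Z k)) +
      δ • (∑ k ∈ Finset.Icc 1 (numBlocks δ) with j < k, G (Z k)) + δ • e

/-- The integral equation with rates `F` to the left and `G` to the right. -/
structure IsIntegralSolution (P : Set E) (F G : E → E) (W : ℝ → E) : Prop where
  continuousOn : ContinuousOn W (Icc 0 1)
  mapsTo : MapsTo W (Icc 0 1) P
  eq_integral : ∀ x ∈ Icc (0 : ℝ) 1,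
    W x = (∫ y in (0 : ℝ)..x, F (W y)) + ∫ y in x..(1 : ℝ), G (W y)

namespace IsApproxSolution

variable {Z : ℕ → E}

/-- Consecutive equations differ by one forward term, one backward term and the two errors, each of
size at most `M δ`. -/
theorem norm_step_le (h : IsApproxSolution P F G M δ Z) (hδ : 0 < δ) (hM : 0 ≤ M)
    (hF : ∀ z ∈ P, ‖F z‖ ≤ M) (hG : ∀ z ∈ P, ‖G z‖ ≤ M) :
    ∀ j < numBlocks δ, ‖Z (j + 1) - Z j‖ ≤ 4 * M * δ := by
  intro j hj
  obtain ⟨e, he, h1⟩ := h.eq_add j hj.le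
  obtain ⟨e', he', h2⟩ := h.eq_add (j + 1) hj
  set n := numBlocks δ
  have hs : ∀ (i : ℕ) (H : E → E), i ≤ n → (∀ z ∈ P, ‖H z‖ ≤ M) →
      ‖∑ k ∈ Finset.Icc 1 n with k = i, H (Z k)‖ ≤ M := by
    intro i H hi hH
    have hsub : (Finset.Icc 1 n).filter (fun k => k = i) ⊆ {i} := fun k hk => by
      simpa using (Finset.mem_filter.1 hk).2
    rcases Finset.subset_singleton_iff.1 hsub with h' | h'
    · rw [h']; simpa using hM
    · rw [h', Finset.sum_singleton]; exact hH _ (h.mem i hi)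
  have e1 : ∑ k ∈ Finset.Icc 1 n with k < j + 1, F (Z k) =
      (∑ k ∈ Finset.Icc 1 n with k < j, F (Z k)) + ∑ k ∈ Finset.Icc 1 n with k = j, F (Z k) := by
    simp only [Finset.sum_filter]
    rw [← Finset.sum_add_distrib]
    refine Finset.sum_congr rfl fun k _ => ?_
    rcases lt_trichotomy k j with h | h | h
    · simp [h, h.ne, h.trans (Nat.lt_succ_self j)]
    · simp [h]
    · simp [h.ne', not_lt.2 h.le, not_lt.2 (Nat.succ_le_of_lt h)]
  have e2 : ∑ k ∈ Finset.Icc 1 n with j < k, G (Z k) =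
      (∑ k ∈ Finset.Icc 1 n with j + 1 < k, G (Z k)) +
        ∑ k ∈ Finset.Icc 1 n with k = j + 1, G (Z k) := by
    simp only [Finset.sum_filter]
    rw [← Finset.sum_add_distrib]
    refine Finset.sum_congr rfl fun k _ => ?_
    rcases lt_trichotomy k (j + 1) with h | h | h
    · simp [h.ne, not_lt.2 h.le, not_lt.2 (Nat.le_of_lt_succ h)]
    · simp [h]
    · simp [h, h.ne', (Nat.lt_succ_self j).trans h]
  rw [h1, h2, e1, e2]
  have a1 := hs j F hj.le hF
  have a2 := hs (j + 1) G hj hG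
  calc _ = ‖δ • ((∑ k ∈ Finset.Icc 1 n with k = j, F (Z k)) -
        (∑ k ∈ Finset.Icc 1 n with k = j + 1, G (Z k)) + (e' - e))‖ := by
        congr 1
        simp only [smul_add, smul_sub]
        abel
    _ ≤ δ * ((M + M) + (M + M)) := by
        rw [norm_smul, Real.norm_of_nonneg hδ.le]
        gcongr
        refine (norm_add_le _ _).trans (add_le_add ?_ ?_)
        · exact (norm_sub_le _ _).trans (add_le_add a1 a2)
        · exact (norm_sub_le _ _).trans (add_le_add he' he)
    _ = 4 * M * δ := by ring

theorem vecInterp_mem (h : IsApproxSolution P F G M δ Z) (hP : Convex ℝ P) (x : ℝ) :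
    vecInterp δ Z x ∈ P :=
  hP (h.mem _ (min_le_right _ _)) (h.mem _ (min_le_right _ _))
    (sub_nonneg.2 (Int.fract_lt_one _).le) (Int.fract_nonneg _) (by ring)

theorem norm_sub_le (h : IsApproxSolution P F G M δ Z) (hδ : 0 < δ) (hM : 0 ≤ M)
    (hF : ∀ z ∈ P, ‖F z‖ ≤ M) (hG : ∀ z ∈ P, ‖G z‖ ≤ M) {x y : ℝ} (hx : 0 ≤ x) (hy : 0 ≤ y) :
    ‖vecInterp δ Z x - vecInterp δ Z y‖ ≤ 4 * M * |x - y| := by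
  have hstep := h.norm_step_le hδ hM hF hG
  rcases le_total x y with hxy | hxy
  · rw [norm_sub_rev, abs_sub_comm, abs_of_nonneg (sub_nonneg.2 hxy)]
    exact norm_vecInterp_sub_vecInterp_le hδ (by positivity) hstep hx hxy
  · rw [abs_of_nonneg (sub_nonneg.2 hxy)]
    exact norm_vecInterp_sub_vecInterp_le hδ (by positivity) hstep hy hxy

/-- The interpolation of an approximate solution nearly solves the integral equation. -/
theorem norm_residual_le [CompleteSpace E] (h : IsApproxSolution P F G M δ Z) (hP : Convex ℝ P)
    (hδ : 0 < δ)
    (hM : 0 ≤ M) (hF : ∀ z ∈ P, ‖F z‖ ≤ M) (hG : ∀ z ∈ P, ‖G z‖ ≤ M) (hFc : ContinuousOn F P)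
    (hGc : ContinuousOn G P) {η : ℝ} (hη : 0 ≤ η)
    (hFη : ∀ z ∈ P, ∀ w ∈ P, ‖z - w‖ ≤ 4 * M * δ → ‖F z - F w‖ ≤ η)
    (hGη : ∀ z ∈ P, ∀ w ∈ P, ‖z - w‖ ≤ 4 * M * δ → ‖G z - G w‖ ≤ η) {x : ℝ}
    (hx : x ∈ Icc (0 : ℝ) 1) :
    ‖vecInterp δ Z x - ((∫ y in (0 : ℝ)..x, F (vecInterp δ Z y)) +
      ∫ y in x..(1 : ℝ), G (vecInterp δ Z y))‖ ≤ 3 * η + 13 * (M * δ) := by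
  have hstep := h.norm_step_le hδ hM hF hG
  have hcont : ContinuousOn (vecInterp δ Z) (Icc 0 1) := by
    have : LipschitzOnWith (4 * M).toNNReal (vecInterp δ Z) (Icc 0 1) :=
      LipschitzOnWith.of_dist_le_mul fun x hx y hy => by
        rw [dist_eq_norm, Real.dist_eq, Real.coe_toNNReal _ (by positivity)]
        exact h.norm_sub_le hδ hM hF hG hx.1 hy.1
    exact this.continuousOn
  -- The interpolation is compared with its node at the left end of the cell, where the discrete
  -- equation holds exactly. The final bound adds this error, the two Riemann sum errors and the
  -- error term of the equation.
  have hclose : ∀ y ∈ Icc (0 : ℝ) 1, ‖vecInterp δ Z y - Z ⌊y / δ⌋₊‖ ≤ 4 * M * δ := by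
    intro y hy
    have := norm_vecInterp_sub_le (δ := δ) (Z := Z) (by positivity) hstep y
    rwa [min_eq_left (floor_le_numBlocks hδ hy.2)] at this
  have hmaps : MapsTo (vecInterp δ Z) (Icc 0 1) P := fun y _ => h.vecInterp_mem hP y
  have rF := norm_integral_sub_sum_le hδ (h := fun y => F (vecInterp δ Z y))
    (a := fun k => F (Z k)) (hFc.comp hcont hmaps) hM hη
    (fun k hk => hF _ (h.mem k hk)) (fun y hy => hF _ (hmaps hy))
    (fun y hy => hFη _ (hmaps hy) _ (h.mem _ (floor_le_numBlocks hδ hy.2)) (hclose y hy)) hx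
  have rG := norm_integral_sub_sum_right_le hδ (h := fun y => G (vecInterp δ Z y))
    (a := fun k => G (Z k)) (hGc.comp hcont hmaps) hM hη
    (fun k hk => hG _ (h.mem k hk)) (fun y hy => hG _ (hmaps hy))
    (fun y hy => hGη _ (hmaps hy) _ (h.mem _ (floor_le_numBlocks hδ hy.2)) (hclose y hy)) hx
  obtain ⟨e, he, heq⟩ := h.eq_add _ (floor_le_numBlocks hδ hx.2)
  have hδe : ‖δ • e‖ ≤ M * δ := by
    rw [norm_smul, Real.norm_of_nonneg hδ.le, mul_comm]
    gcongr
  set SF := δ • ∑ k ∈ Finset.Icc 1 (numBlocks δ) with k < ⌊x / δ⌋₊, F (Z k)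
  set SG := δ • ∑ k ∈ Finset.Icc 1 (numBlocks δ) with ⌊x / δ⌋₊ < k, G (Z k)
  have hc := hclose x hx
  rw [heq] at hc
  rw [norm_sub_rev] at rF rG
  calc _ = ‖(vecInterp δ Z x - (SF + SG + δ • e)) + (SF - ∫ y in (0 : ℝ)..x, F (vecInterp δ Z y)) +
        (SG - ∫ y in x..(1 : ℝ), G (vecInterp δ Z y)) + δ • e‖ := by congr 1; abel
    _ ≤ 4 * M * δ + (η + 2 * (M * δ)) + (2 * η + 6 * (M * δ)) + M * δ :=
        (norm_add₄_le).trans (by gcongr)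
    _ = _ := by ring

end IsApproxSolution

theorem continuous_integral_extendPath (hF : ContinuousOn F P)
    (hFM : ∀ z ∈ P, ‖F z‖ ≤ M) (a b : ℝ) :
    Continuous fun f : BoundedContinuousFunction (Icc (0 : ℝ) 1) P =>
      ∫ y in a..b, F (extendPath f y) := by
  have hF' : Continuous fun z : P => F z := continuousOn_iff_continuous_domRestrict.1 hF
  refine intervalIntegral.continuous_of_dominated_interval (bound := fun _ => M) (fun f => ?_)
    (fun f => Eventually.of_forall fun y _ => hFM _ (extendPath_mem f y)) intervalIntegrable_const
    (Eventually.of_forall fun y _ => ?_)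
  · exact (hF'.comp (f.continuous.comp continuous_projIcc)).aestronglyMeasurable
  · exact hF'.comp ((continuous_eval_const _))

variable [CompleteSpace E]

/-- Interpolations of approximate solutions are compact, and their limits solve the integral
equation. -/
theorem exists_paths (hPK : IsCompact P) (hP : Convex ℝ P) (hFc : ContinuousOn F P)
    (hGc : ContinuousOn G P) (hM : 0 ≤ M) (hF : ∀ z ∈ P, ‖F z‖ ≤ M) (hG : ∀ z ∈ P, ‖G z‖ ≤ M)
    {δ₀ : ℝ} (hδ₀ : 0 < δ₀) {Z : ℝ → ℕ → E}
    (hZ : ∀ δ ∈ Ioo 0 δ₀, IsApproxSolution P F G M δ (Z δ)) :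
    ∃ (K : Set (BoundedContinuousFunction (Icc (0 : ℝ) 1) P))
      (p : ℝ → BoundedContinuousFunction (Icc (0 : ℝ) 1) P), IsCompact K ∧ (∀ δ, p δ ∈ K) ∧
      (∀ δ ∈ Ioo 0 δ₀, ∀ x, (p δ x : E) = vecInterp δ (Z δ) x) ∧
      ∀ f, MapClusterPt f (𝓝[>] 0) p → IsIntegralSolution P F G (extendPath f) := by
  have : CompactSpace P := isCompact_iff_compactSpace.1 hPK
  set L : NNReal := (4 * M).toNNReal with hL
  have hex : ∀ δ ∈ Ioo 0 δ₀, ∃ f : BoundedContinuousFunction (Icc (0 : ℝ) 1) P,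
      LipschitzWith L f ∧ ∀ x, (f x : E) = vecInterp δ (Z δ) x := by
    intro δ hδ
    have hlip : LipschitzWith L fun x : Icc (0 : ℝ) 1 =>
        (⟨vecInterp δ (Z δ) x, (hZ δ hδ).vecInterp_mem hP x⟩ : P) :=
      LipschitzWith.of_dist_le_mul fun x y => by
        rw [Subtype.dist_eq, Subtype.dist_eq, dist_eq_norm, Real.dist_eq, hL,
          Real.coe_toNNReal _ (by positivity)]
        exact (hZ δ hδ).norm_sub_le hδ.1 hM hF hG x.2.1 y.2.1
    exact ⟨BoundedContinuousFunction.mkOfCompact ⟨_, hlip.continuous⟩, hlip, fun _ => rfl⟩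
  -- Outside `(0, δ₀)` the path is an arbitrary element of the compact set, taken from `δ₀ / 2`; the
  -- filter `𝓝[>] 0` does not see it.
  have hex' : ∀ δ, ∃ f : BoundedContinuousFunction (Icc (0 : ℝ) 1) P,
      LipschitzWith L f ∧ (δ ∈ Ioo 0 δ₀ → ∀ x, (f x : E) = vecInterp δ (Z δ) x) := by
    intro δ
    by_cases hδ : δ ∈ Ioo 0 δ₀
    · obtain ⟨f, h1, h2⟩ := hex δ hδ
      exact ⟨f, h1, fun _ => h2⟩
    · obtain ⟨f, h1, -⟩ := hex (δ₀ / 2) ⟨by positivity, by linarith⟩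
      exact ⟨f, h1, fun h => absurd h hδ⟩
  choose p hpL hpZ using hex'
  refine ⟨_, p, isCompact_setOf_lipschitzWith_path L, hpL, hpZ, fun f hf =>
    ⟨(continuous_extendPath f).continuousOn, fun x _ => extendPath_mem f x, fun x hx => ?_⟩⟩
  -- For fixed `x`, the defect in the integral equation is continuous in the path and tends to `0`
  -- along the interpolations. Hence it vanishes at every cluster point.
  let res : BoundedContinuousFunction (Icc (0 : ℝ) 1) P → E := fun f =>
    extendPath f x - ((∫ y in (0 : ℝ)..x, F (extendPath f y)) +
      ∫ y in x..(1 : ℝ), G (extendPath f y))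
  have hres : Continuous res := by
    refine Continuous.sub ?_ ((continuous_integral_extendPath hFc hF _ _).add
      (continuous_integral_extendPath hGc hG _ _))
    exact continuous_subtype_val.comp (continuous_eval_const _)
  have hlim : Tendsto (res ∘ p) (𝓝[>] 0) (𝓝 0) := by
    rw [Metric.tendsto_nhds]
    intro ε hε
    have uF := Metric.uniformContinuousOn_iff_le.1 (hPK.uniformContinuousOn_of_continuous hFc)
      (ε / 8) (by positivity)
    have uG := Metric.uniformContinuousOn_iff_le.1 (hPK.uniformContinuousOn_of_continuous hGc)
      (ε / 8) (by positivity)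
    obtain ⟨a, ha, uF⟩ := uF
    obtain ⟨b, hb, uG⟩ := uG
    have hsmall : ∀ (k r : ℝ), 0 < r → ∀ᶠ δ in 𝓝[>] (0 : ℝ), k * δ < r := by
      intro k r hr
      have : Tendsto (fun δ : ℝ => k * δ) (𝓝[>] 0) (𝓝 (k * 0)) :=
        (continuous_const.mul continuous_id).continuousAt.mono_left nhdsWithin_le_nhds
      rw [mul_zero] at this
      exact this.eventually_lt_const hr
    filter_upwards [Ioo_mem_nhdsGT hδ₀, hsmall (4 * M) a ha, hsmall (4 * M) b hb,
      hsmall (13 * M) (ε / 2) (by positivity)] with δ hδ h1 h2 h3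
    have hb := (hZ δ hδ).norm_residual_le hP hδ.1 hM hF hG hFc hGc (η := ε / 8) (by positivity)
      (fun z hz w hw hzw => by
        rw [← dist_eq_norm] at hzw ⊢; exact uF z hz w hw (hzw.trans h1.le))
      (fun z hz w hw hzw => by
        rw [← dist_eq_norm] at hzw ⊢; exact uG z hz w hw (hzw.trans h2.le)) hx
    have hpe : ∀ y ∈ Icc (0 : ℝ) 1, extendPath (p δ) y = vecInterp δ (Z δ) y := fun y hy => by
      rw [extendPath_of_mem _ hy, hpZ δ hδ]
    have i1 : (∫ y in (0 : ℝ)..x, F (extendPath (p δ) y)) =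
        ∫ y in (0 : ℝ)..x, F (vecInterp δ (Z δ) y) :=
      intervalIntegral.integral_congr fun y hy => by
        rw [uIcc_of_le hx.1] at hy
        simp only [hpe y ⟨hy.1, hy.2.trans hx.2⟩]
    have i2 : (∫ y in x..(1 : ℝ), G (extendPath (p δ) y)) =
        ∫ y in x..(1 : ℝ), G (vecInterp δ (Z δ) y) :=
      intervalIntegral.integral_congr fun y hy => by
        rw [uIcc_of_le hx.2] at hy
        simp only [hpe y ⟨hx.1.trans hy.1, hy.2⟩]
    rw [dist_zero_right]
    change ‖extendPath (p δ) x - _‖ < ε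
    rw [hpe x hx, i1, i2]
    refine hb.trans_lt ?_
    linarith
  have hcl : MapClusterPt (res f) (𝓝[>] 0) (res ∘ p) := hf.continuousAt_comp hres.continuousAt
  have h0 : res f = 0 := by
    have : (𝓝 (res f) ⊓ 𝓝 0).NeBot := ClusterPt.mono hcl hlim
    exact eq_of_nhds_neBot this
  exact sub_eq_zero.1 h0

theorem exists_isIntegralSolution (hPK : IsCompact P) (hP : Convex ℝ P) (hFc : ContinuousOn F P)
    (hGc : ContinuousOn G P) (hM : 0 ≤ M) (hF : ∀ z ∈ P, ‖F z‖ ≤ M) (hG : ∀ z ∈ P, ‖G z‖ ≤ M)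
    {δ₀ : ℝ} (hδ₀ : 0 < δ₀) {Z : ℝ → ℕ → E}
    (hZ : ∀ δ ∈ Ioo 0 δ₀, IsApproxSolution P F G M δ (Z δ)) :
    ∃ W, IsIntegralSolution P F G W := by
  obtain ⟨K, p, hK, hpK, -, hcl⟩ := exists_paths hPK hP hFc hGc hM hF hG hδ₀ hZ
  obtain ⟨f, -, hf⟩ := hK.exists_mapClusterPt (f := 𝓝[>] (0 : ℝ)) (u := p)
    (tendsto_principal.2 (Eventually.of_forall hpK))
  exact ⟨_, hcl f hf⟩

/-- Every cluster point solves the integral equation and so agrees with `W`; in a compact set, a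
family with a single cluster point converges to it. -/
theorem tendstoUniformlyOn_vecInterp (hPK : IsCompact P) (hP : Convex ℝ P)
    (hFc : ContinuousOn F P)
    (hGc : ContinuousOn G P) (hM : 0 ≤ M) (hF : ∀ z ∈ P, ‖F z‖ ≤ M) (hG : ∀ z ∈ P, ‖G z‖ ≤ M)
    {δ₀ : ℝ} (hδ₀ : 0 < δ₀) {Z : ℝ → ℕ → E}
    (hZ : ∀ δ ∈ Ioo 0 δ₀, IsApproxSolution P F G M δ (Z δ)) {W : ℝ → E}
    (hW : ∀ V, IsIntegralSolution P F G V → EqOn V W (Icc 0 1)) :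
    TendstoUniformlyOn (fun δ x => vecInterp δ (Z δ) x) W (𝓝[>] 0) (Icc 0 1) := by
  obtain ⟨K, p, hK, hpK, hpZ, hcl⟩ := exists_paths hPK hP hFc hGc hM hF hG hδ₀ hZ
  obtain ⟨f, -, hf⟩ := hK.exists_mapClusterPt (f := 𝓝[>] (0 : ℝ)) (u := p)
    (tendsto_principal.2 (Eventually.of_forall hpK))
  have huniq : ∀ g ∈ K, MapClusterPt g (𝓝[>] 0) p → g = f := by
    intro g _ hg
    ext x
    have h1 := hW _ (hcl g hg) x.2
    have h2 := hW _ (hcl f hf) x.2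
    rw [extendPath_of_mem _ x.2] at h1 h2
    exact h1.trans h2.symm
  have ht := hK.tendsto_nhds_of_unique_mapClusterPt (Eventually.of_forall hpK) huniq
  rw [BoundedContinuousFunction.tendsto_iff_tendstoUniformly,
    Metric.tendstoUniformly_iff] at ht
  rw [Metric.tendstoUniformlyOn_iff]
  intro ε hε
  filter_upwards [ht ε hε, Ioo_mem_nhdsGT hδ₀] with δ h1 hδ x hx
  have := h1 ⟨x, hx⟩
  rw [Subtype.dist_eq, hpZ δ hδ] at this
  rwa [← hW _ (hcl f hf) hx, extendPath_of_mem _ hx]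

end Convergence

/-! ### Regularity and Grönwall arguments for integral equations. -/

theorem IsIntegralSolution.mono {E : Type*} [NormedAddCommGroup E] [NormedSpace ℝ E]
    {P Q : Set E} {F G : E → E} {W : ℝ → E} (h : IsIntegralSolution P F G W) (hPQ : P ⊆ Q) :
    IsIntegralSolution Q F G W :=
  ⟨h.continuousOn, h.mapsTo.mono_right hPQ, h.eq_integral⟩

theorem intervalIntegrable_of_mem_Icc {E : Type*} [NormedAddCommGroup E] {e : ℝ → E}
    (he : IntervalIntegrable e volume 0 1) {a b : ℝ} (ha : a ∈ Icc (0 : ℝ) 1)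
    (hb : b ∈ Icc (0 : ℝ) 1) : IntervalIntegrable e volume a b :=
  he.mono_set (by rw [uIcc_of_le zero_le_one]; exact uIcc_subset_Icc ha hb)

/-- A primitive of a continuous function on `[0,1]` is differentiable up to the boundary. -/
theorem hasDerivWithinAt_of_eq_integral {E : Type*} [NormedAddCommGroup E] [NormedSpace ℝ E]
    [CompleteSpace E] {d e : ℝ → E} {a : E} (he : ContinuousOn e (Icc 0 1))
    (hd : ∀ x ∈ Icc (0 : ℝ) 1, d x = a + ∫ y in (0 : ℝ)..x, e y) {x : ℝ}
    (hx : x ∈ Icc (0 : ℝ) 1) : HasDerivWithinAt d (e x) (Icc 0 1) x := by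
  -- The integrand is continued by constants outside `[0,1]`, so that the fundamental theorem of
  -- calculus also applies at the endpoints.
  have hc : Continuous (IccExtend zero_le_one ((Icc (0 : ℝ) 1).domRestrict e)) :=
    (continuousOn_iff_continuous_domRestrict.1 he).Icc_extend'
  have hext : ∀ y ∈ Icc (0 : ℝ) 1,
      IccExtend zero_le_one ((Icc (0 : ℝ) 1).domRestrict e) y = e y := fun y hy =>
    IccExtend_of_mem _ _ hy
  have h1 := ((hc.integral_hasStrictDerivAt 0 x).hasDerivAt.const_add a).hasDerivWithinAt
    (s := Icc 0 1)
  rw [hext x hx] at h1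
  refine h1.congr_of_mem (fun y hy => ?_) hx
  rw [hd y hy]
  congr 1
  refine intervalIntegral.integral_congr fun w hw => ?_
  rw [uIcc_of_le hy.1] at hw
  exact (hext w ⟨hw.1, hw.2.trans hy.2⟩).symm

/-- A continuous function controlled by its own primitive vanishes. -/
theorem eq_zero_of_eq_integral {E : Type*} [NormedAddCommGroup E] [NormedSpace ℝ E]
    [CompleteSpace E] {d e : ℝ → E} {L : ℝ} (he : ContinuousOn e (Icc 0 1))
    (hd : ∀ x ∈ Icc (0 : ℝ) 1, d x = ∫ y in (0 : ℝ)..x, e y)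
    (hL : ∀ x ∈ Icc (0 : ℝ) 1, ‖e x‖ ≤ L * ‖d x‖) {x : ℝ} (hx : x ∈ Icc (0 : ℝ) 1) :
    d x = 0 := by
  have hder : ∀ x ∈ Icc (0 : ℝ) 1, HasDerivWithinAt d (e x) (Icc 0 1) x := fun x hx =>
    hasDerivWithinAt_of_eq_integral (a := 0) he (fun y hy => by rw [zero_add, hd y hy]) hx
  have h := norm_le_gronwallBound_of_norm_deriv_right_le (f := d) (f' := e) (δ := 0) (K := L)
    (ε := 0) (fun x hx => (hder x hx).continuousWithinAt)
    (fun x hx => (hder x (Ico_subset_Icc_self hx)).mono_of_mem_nhdsWithin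
      (Icc_mem_nhdsGE_of_mem hx))
    (by rw [hd 0 ⟨le_rfl, zero_le_one⟩, intervalIntegral.integral_same, norm_zero])
    (fun x hx => by rw [add_zero]; exact hL x (Ico_subset_Icc_self hx)) x hx
  rw [gronwallBound_ε0_δ0] at h
  exact norm_le_zero_iff.1 h

/-- Solutions of the integral equation with smooth rates are smooth. -/
theorem IsIntegralSolution.contDiffOn {E : Type*} [NormedAddCommGroup E] [NormedSpace ℝ E]
    [CompleteSpace E] {P : Set E} {F G : E → E} {W : ℝ → E} (h : IsIntegralSolution P F G W)
    (hF : ContDiffOn ℝ ∞ F P) (hG : ContDiffOn ℝ ∞ G P) : ContDiffOn ℝ ∞ W (Icc 0 1) := by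
  have hFW := hF.continuousOn.comp h.continuousOn h.mapsTo
  have hGW := hG.continuousOn.comp h.continuousOn h.mapsTo
  have hii : ∀ {H : ℝ → E}, ContinuousOn H (Icc 0 1) → ∀ {a b : ℝ}, a ∈ Icc (0 : ℝ) 1 →
      b ∈ Icc (0 : ℝ) 1 → IntervalIntegrable H volume a b := fun hH _ _ ha hb =>
    (hH.mono (uIcc_subset_Icc ha hb)).intervalIntegrable
  have h0 : (0 : ℝ) ∈ Icc (0 : ℝ) 1 := ⟨le_rfl, zero_le_one⟩
  have h1 : (1 : ℝ) ∈ Icc (0 : ℝ) 1 := ⟨zero_le_one, le_rfl⟩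
  -- The nonlocal part of the equation is the constant `∫₀¹ G(W)`; what depends on `x` is the
  -- primitive of `F(W) - G(W)`. The resulting autonomous differential equation gains one derivative
  -- per step of the induction.
  have hder : ∀ x ∈ Icc (0 : ℝ) 1, HasDerivWithinAt W (F (W x) - G (W x)) (Icc 0 1) x :=
    fun x hx => hasDerivWithinAt_of_eq_integral (a := ∫ y in (0 : ℝ)..1, G (W y))
      (e := fun y => F (W y) - G (W y)) (hFW.sub hGW) (fun x hx => by
        have e1 := intervalIntegral.integral_sub (hii hFW h0 hx) (hii hGW h0 hx)
        have e2 := intervalIntegral.integral_add_adjacent_intervals (hii hGW h0 hx) (hii hGW hx h1)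
        simp only [Function.comp_def] at e1 e2
        rw [h.eq_integral x hx, e1, ← e2]
        abel) hx
  rw [contDiffOn_infty]
  intro n
  induction n with
  | zero =>
    simpa using h.continuousOn
  | succ n ih =>
    have hud := uniqueDiffOn_Icc (zero_lt_one (α := ℝ))
    push_cast
    rw [contDiffOn_succ_iff_derivWithin hud]
    refine ⟨fun x hx => (hder x hx).differentiableWithinAt, by simp, ?_⟩
    refine ContDiffOn.congr (f := fun x => F (W x) - G (W x)) ?_
      fun x hx => (hder x hx).derivWithin (hud x hx)
    have hn : (n : WithTop ℕ∞) ≤ ∞ := by exact_mod_cast le_top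
    exact ((hF.of_le hn).comp ih h.mapsTo).sub ((hG.of_le hn).comp ih h.mapsTo)

/-- Compactness of the unit sphere turns strict positivity into a lower bound; the quotient by `x ⬝ᵥ
x` is scale invariant, so the choice of norm does not matter. -/
theorem CoerciveBelow.exists_of_pos {n t : ℕ} {M : Matrix (Fin n) (Fin n) ℝ}
    (h : ∀ x : Fin n → ℝ, (∀ i, t ≤ i.val → x i = 0) → x ≠ 0 → 0 < x ⬝ᵥ M *ᵥ x) :
    ∃ l : ℝ, 0 < l ∧ CoerciveBelow l t M := by
  set K : Set (Fin n → ℝ) := Metric.sphere 0 1 ∩ {x | ∀ i, t ≤ i.val → x i = 0} with hK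
  have hKc : IsCompact K := by
    refine (isCompact_sphere _ _).inter_right ?_
    simp only [Set.ofPred_forall]
    exact isClosed_iInter fun i => isClosed_iInter fun _ =>
      isClosed_eq (continuous_apply i) continuous_const
  have hne : ∀ x ∈ K, x ≠ 0 := by
    rintro x ⟨hx, -⟩ rfl
    simp at hx
  have hcont : ContinuousOn (fun x : Fin n → ℝ => (x ⬝ᵥ M *ᵥ x) / (x ⬝ᵥ x)) K := by
    refine ContinuousOn.div ?_ ?_ fun x hx => (dotProduct_self_pos (hne x hx)).ne'
    · simp only [dotProduct, Matrix.mulVec]; fun_prop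
    · simp only [dotProduct]; fun_prop
  obtain ⟨l, hl, hlK⟩ : ∃ l : ℝ, 0 < l ∧ ∀ x ∈ K, l ≤ (x ⬝ᵥ M *ᵥ x) / (x ⬝ᵥ x) := by
    rcases K.eq_empty_or_nonempty with h0 | h0
    · exact ⟨1, one_pos, fun x hx => by rw [h0] at hx; exact hx.elim⟩
    · obtain ⟨x, hx, hmin⟩ := hKc.exists_isMinOn h0 hcont
      exact ⟨_, div_pos (h x hx.2 (hne x hx)) (dotProduct_self_pos (hne x hx)),
        fun y hy => hmin hy⟩
  refine ⟨l, hl, fun x hx => ?_⟩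
  by_cases hx0 : x = 0
  · simp [hx0]
  · have hn : 0 < ‖x‖ := norm_pos_iff.2 hx0
    have hw : ‖x‖⁻¹ • x ∈ K := by
      refine ⟨?_, fun i hi => ?_⟩
      · rw [mem_sphere_zero_iff_norm, norm_smul, norm_inv, norm_norm, inv_mul_cancel₀ hn.ne']
      · rw [Pi.smul_apply, hx i hi, smul_zero]
    have h1 := hlK _ hw
    rw [Matrix.mulVec_smul, smul_dotProduct, dotProduct_smul, smul_dotProduct, dotProduct_smul,
      smul_eq_mul, smul_eq_mul, smul_eq_mul, smul_eq_mul,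
      mul_div_mul_left _ _ (inv_ne_zero hn.ne'), mul_div_mul_left _ _ (inv_ne_zero hn.ne'),
      le_div_iff₀ (dotProduct_self_pos hx0)] at h1
    exact h1

theorem quadForm_eq_sum {n : ℕ} (M : Matrix (Fin n) (Fin n) ℝ) (v : Fin n → ℝ) :
    v ⬝ᵥ M *ᵥ v = ∑ p : Fin n × Fin n, v p.1 * v p.2 * M p.1 p.2 := by
  simp only [dotProduct, Matrix.mulVec, Finset.mul_sum, Fintype.sum_prod_type]
  exact Finset.sum_congr rfl fun i _ => Finset.sum_congr rfl fun j _ => by ring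

theorem intervalIntegrable_quadForm {n : ℕ} {M : ℝ → Matrix (Fin n) (Fin n) ℝ} {a b : ℝ}
    (hM : ∀ i j, IntervalIntegrable (fun y => M y i j) volume a b) (v : Fin n → ℝ) :
    IntervalIntegrable (fun y => v ⬝ᵥ M y *ᵥ v) volume a b := by
  have h := IntervalIntegrable.sum (μ := volume) (a := a) (b := b) Finset.univ
    (f := fun (p : Fin n × Fin n) y => v p.1 * v p.2 * M y p.1 p.2)
    fun p _ => (hM p.1 p.2).const_mul _
  have e : (fun y => v ⬝ᵥ M y *ᵥ v) =
      ∑ p : Fin n × Fin n, fun y => v p.1 * v p.2 * M y p.1 p.2 := by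
    funext y
    rw [quadForm_eq_sum, Finset.sum_apply]
  rw [e]
  exact h

theorem integral_quadForm {n : ℕ} {M : ℝ → Matrix (Fin n) (Fin n) ℝ} {a b : ℝ}
    (hM : ∀ i j, IntervalIntegrable (fun y => M y i j) volume a b) (v : Fin n → ℝ) :
    ∫ y in a..b, v ⬝ᵥ M y *ᵥ v = v ⬝ᵥ (Matrix.of fun i j => ∫ y in a..b, M y i j) *ᵥ v := by
  simp only [quadForm_eq_sum]
  rw [intervalIntegral.integral_finsetSum fun p _ => (hM p.1 p.2).const_mul _]
  simp only [intervalIntegral.integral_const_mul, Matrix.of_apply]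

/-! ### The integro-difference system: nondegeneracy, reformulation and uniqueness. -/

section System

variable {c : I × ℝ → ℝ} {T : ℕ}

theorem contDiffOn_forwardRate (hc : IsUpdateRule c) :
    ContDiffOn ℝ ∞ (forwardRate (T := T) c) (posStates T) := by
  refine ContDiffOn.prodMk ?_ ?_
  · exact contDiffOn_pi.2 fun i => contDiffOn_pi.2 fun j => smoothEntries_corr hc _ _
  · exact contDiffOn_pi.2 fun t => contDiffOn_pi.2 fun s => smoothEntries_rawKernel hc _ _

theorem contDiffOn_backwardRate (hc : IsUpdateRule c) :
    ContDiffOn ℝ ∞ (backwardRate (T := T) c) (posStates T) := by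
  refine ContDiffOn.prodMk ?_ ?_
  · exact contDiffOn_pi.2 fun i => contDiffOn_pi.2 fun j => smoothEntries_corr hc _ _
  · refine contDiffOn_pi.2 fun t => contDiffOn_pi.2 fun s => ?_
    refine Fin.cases ?_ (fun s => ?_) s
    · exact contDiffOn_const
    · exact smoothEntries_rawKernel hc _ _

theorem contDiffOn_selfRate (hc : IsUpdateRule c) (b : Prop) [Decidable b] :
    ContDiffOn ℝ ∞ (selfRate (T := T) c b) (posStates T) := by
  refine ContDiffOn.prodMk ?_ ?_
  · split_ifs
    · exact contDiffOn_pi.2 fun i => contDiffOn_pi.2 fun j => smoothEntries_corr hc _ _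
    · exact contDiffOn_const
  · exact contDiffOn_pi.2 fun t => contDiffOn_pi.2 fun s => smoothEntries_rawKernel hc _ _

/-- The covariances of a solution of the integro-difference system are positive definite. -/
theorem IsSolution.posDef (hc : IsUpdateRule c) {S : ℝ → Matrix (Fin T) (Fin T) ℝ} {f : ℝ → Vecs T}
    (h : IsSolution c S f) {x : ℝ} (hx : x ∈ Icc (0 : ℝ) 1) : (S x).PosDef := by
  have h0 : (0 : ℝ) ∈ Icc (0 : ℝ) 1 := ⟨le_rfl, zero_le_one⟩
  have h1 : (1 : ℝ) ∈ Icc (0 : ℝ) 1 := ⟨zero_le_one, le_rfl⟩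
  have hquad : ∀ x ∈ Icc (0 : ℝ) 1, ∀ v : Fin T → ℝ, v ⬝ᵥ S x *ᵥ v =
      (∫ y in (0 : ℝ)..x, v ⬝ᵥ ((corr c (S y) (f y)).submatrix Fin.succ Fin.succ) *ᵥ v) +
      ∫ y in x..(1 : ℝ), v ⬝ᵥ ((corr c (S y) (f y)).submatrix Fin.castSucc Fin.castSucc) *ᵥ v := by
    intro x hx v
    rw [integral_quadForm (M := fun y => (corr c (S y) (f y)).submatrix Fin.succ Fin.succ) fun i j =>
        intervalIntegrable_of_mem_Icc (h.integrable_corr _ _) h0 hx,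
      integral_quadForm (M := fun y => (corr c (S y) (f y)).submatrix Fin.castSucc Fin.castSucc)
        fun i j => intervalIntegrable_of_mem_Icc (h.integrable_corr _ _) hx h1,
      ← dotProduct_add, ← Matrix.add_mulVec]
    congr 2
    ext i j
    exact h.eq_cov x hx i j
  have hnn1 : ∀ (v : Fin T → ℝ) (y : ℝ),
      0 ≤ v ⬝ᵥ ((corr c (S y) (f y)).submatrix Fin.succ Fin.succ) *ᵥ v := fun v y =>
    quadForm_nonneg ((corr_posSemidef hc _ _).submatrix _) v
  have hnn2 : ∀ (v : Fin T → ℝ) (y : ℝ),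
      0 ≤ v ⬝ᵥ ((corr c (S y) (f y)).submatrix Fin.castSucc Fin.castSucc) *ᵥ v := fun v y =>
    quadForm_nonneg ((corr_posSemidef hc _ _).submatrix _) v
  have key : ∀ t : ℕ, ∀ x ∈ Icc (0 : ℝ) 1, ∃ l : ℝ, 0 < l ∧ CoerciveBelow l t (S x) := by
    intro t
    induction t with
    | zero =>
      refine fun x _ => ⟨1, one_pos, fun v hv => ?_⟩
      rw [show v = 0 from funext fun i => hv i (Nat.zero_le _)]
      simp
    | succ t ih =>
      have hcorr : ∀ {t : ℕ} {y : ℝ}, y ∈ Icc (0 : ℝ) 1 →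
          (∃ l : ℝ, 0 < l ∧ CoerciveBelow l t (S y)) →
          ∃ k : ℝ, 0 < k ∧ CoerciveBelow k (t + 1) (corr c (S y) (f y)) := by
        rintro t y hy ⟨l, hl, hl'⟩
        exact exists_coerciveBelow_corr hc (z := (fun i j => S y i j, f y)) (h.posSemidef y hy) hl hl'
      -- For `x < 1` the backward integral runs over an interval of positive length and its
      -- integrand is positive there by the induction hypothesis.
      have hlt : ∀ x ∈ Ico (0 : ℝ) 1, ∃ l : ℝ, 0 < l ∧ CoerciveBelow l (t + 1) (S x) := by
        intro x hx
        have hxI := Ico_subset_Icc_self hx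
        refine CoerciveBelow.exists_of_pos fun v hv hv0 => ?_
        rw [hquad x hxI]
        refine add_pos_of_nonneg_of_pos
          (intervalIntegral.integral_nonneg hx.1 fun y _ => hnn1 v y)
          (intervalIntegral.intervalIntegral_pos_of_pos_on (intervalIntegrable_quadForm
            (fun i j => intervalIntegrable_of_mem_Icc (h.integrable_corr _ _) hxI h1) v)
            (fun y hy => ?_) hx.2)
        have hyI : y ∈ Icc (0 : ℝ) 1 := ⟨hx.1.trans hy.1.le, hy.2.le⟩
        obtain ⟨k, hk, hk'⟩ := hcorr hyI (ih y hyI)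
        exact (mul_pos hk (dotProduct_self_pos hv0)).trans_le (hk'.submatrix_castSucc v hv)
      intro x hx
      rcases hx.2.lt_or_eq with hx1 | rfl
      · exact hlt x ⟨hx.1, hx1⟩
      -- At `x = 1` only the forward integral remains. Its integrand loses one index, which is
      -- compensated by the bound on `t + 1` passes just obtained for `y < 1`.
      · refine CoerciveBelow.exists_of_pos fun v hv hv0 => ?_
        rw [hquad 1 hx]
        refine add_pos_of_pos_of_nonneg
          (intervalIntegral.intervalIntegral_pos_of_pos_on (intervalIntegrable_quadForm
            (fun i j => h.integrable_corr _ _) v) (fun y hy => ?_) one_pos)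
          (by rw [intervalIntegral.integral_same])
        have hyI := Ioo_subset_Icc_self hy
        obtain ⟨k, hk, hk'⟩ := hcorr hyI (hlt y (Ioo_subset_Ico_self hy))
        exact (mul_pos hk (dotProduct_self_pos hv0)).trans_le (hk'.submatrix_succ v hv)
  obtain ⟨l, hl, hl'⟩ := key T x hx
  exact hl'.posDef hl le_rfl (h.posSemidef x hx).1

theorem integral_state_fst {Z : ℝ → State T} {a b : ℝ} (hZ : IntervalIntegrable Z volume a b)
    (i j : Fin T) : (∫ y in a..b, Z y).1 i j = ∫ y in a..b, (Z y).1 i j :=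
  (((ContinuousLinearMap.proj (R := ℝ) j).comp ((ContinuousLinearMap.proj (R := ℝ) i).comp
    (ContinuousLinearMap.fst ℝ (Fin T → Fin T → ℝ) (Vecs T)))).intervalIntegral_comp_comm hZ).symm

theorem integral_state_snd {Z : ℝ → State T} {a b : ℝ} (hZ : IntervalIntegrable Z volume a b)
    (t : Fin T) (s : Fin (t.val + 1)) : (∫ y in a..b, Z y).2 t s = ∫ y in a..b, (Z y).2 t s :=
  (((ContinuousLinearMap.proj (R := ℝ) s).comp ((ContinuousLinearMap.proj (R := ℝ)
    (φ := fun t : Fin T => Fin (t.val + 1) → ℝ) t).comp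
    (ContinuousLinearMap.snd ℝ (Fin T → Fin T → ℝ) (Vecs T)))).intervalIntegral_comp_comm hZ).symm

/-- The integro-difference system as an integral equation for states. -/
abbrev IsStateSolution (c : I × ℝ → ℝ) (W : ℝ → State T) : Prop :=
  IsIntegralSolution (posStates T) (forwardRate c) (backwardRate c) W

namespace IsIntegralSolution

variable {W : ℝ → State T}

theorem continuousOn_forward (hc : IsUpdateRule c) (h : IsStateSolution c W) :
    ContinuousOn (fun y => forwardRate c (W y)) (Icc 0 1) :=
  (contDiffOn_forwardRate hc).continuousOn.comp h.continuousOn h.mapsTo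

theorem continuousOn_backward (hc : IsUpdateRule c) (h : IsStateSolution c W) :
    ContinuousOn (fun y => backwardRate c (W y)) (Icc 0 1) :=
  (contDiffOn_backwardRate hc).continuousOn.comp h.continuousOn h.mapsTo

end IsIntegralSolution

theorem intervalIntegrable_of_continuousOn_Icc {E : Type*} [NormedAddCommGroup E] {e : ℝ → E}
    (he : ContinuousOn e (Icc 0 1)) {a b : ℝ} (ha : a ∈ Icc (0 : ℝ) 1)
    (hb : b ∈ Icc (0 : ℝ) 1) : IntervalIntegrable e volume a b :=
  (he.mono (uIcc_subset_Icc ha hb)).intervalIntegrable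

theorem IsIntegralSolution.isSolution (hc : IsUpdateRule c) {W : ℝ → State T}
    (h : IsStateSolution c W) : IsSolution c (fun x => (W x).cov) fun x => (W x).2 := by
  have h0 : (0 : ℝ) ∈ Icc (0 : ℝ) 1 := ⟨le_rfl, zero_le_one⟩
  have h1 : (1 : ℝ) ∈ Icc (0 : ℝ) 1 := ⟨zero_le_one, le_rfl⟩
  have hF := h.continuousOn_forward hc
  have hG := h.continuousOn_backward hc
  have hker : ∀ y ∈ Icc (0 : ℝ) 1, kernel c (W y).cov (W y).2 = rawKernel c (W y) := fun y hy =>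
    kernel_eq_rawKernel hc (h.mapsTo hy)
  refine ⟨fun x hx => (h.mapsTo hx).posSemidef, fun s t => ?_, fun s t => ?_,
    fun x hx s t => ?_, fun x hx t s => ?_⟩
  · exact intervalIntegrable_of_continuousOn_Icc
      ((smoothEntries_corr hc s t).continuousOn.comp h.continuousOn h.mapsTo) h0 h1
  · refine intervalIntegrable_of_continuousOn_Icc (ContinuousOn.congr
      ((smoothEntries_rawKernel hc s t).continuousOn.comp h.continuousOn h.mapsTo)
      fun y hy => ?_) h0 h1
    simp only [hker y hy, Function.comp_apply]
  · have e := congrArg (fun z : State T => z.1 s t) (h.eq_integral x hx)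
    simp only [Prod.fst_add, Pi.add_apply] at e
    rw [integral_state_fst (intervalIntegrable_of_continuousOn_Icc hF h0 hx),
      integral_state_fst (intervalIntegrable_of_continuousOn_Icc hG hx h1)] at e
    exact e
  · have e := congrArg (fun z : State T => z.2 t s) (h.eq_integral x hx)
    simp only [Prod.snd_add, Pi.add_apply] at e
    rw [integral_state_snd (intervalIntegrable_of_continuousOn_Icc hF h0 hx),
      integral_state_snd (intervalIntegrable_of_continuousOn_Icc hG hx h1)] at e
    rw [e]
    congr 1
    · refine intervalIntegral.integral_congr fun y hy => ?_
      rw [uIcc_of_le hx.1] at hy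
      simp only [hker y ⟨hy.1, hy.2.trans hx.2⟩, forwardRate]
    · refine intervalIntegral.integral_congr fun y hy => ?_
      rw [uIcc_of_le hx.2] at hy
      simp only [hker y ⟨hx.1.trans hy.1, hy.2⟩, backwardRate]

/-- Continuity is not part of `IsSolution`: it follows because the right-hand sides are primitives
of integrable functions. Positivity then identifies `kernel` with the smooth `rawKernel`. -/
theorem IsSolution.isStateSolution (hc : IsUpdateRule c) {S : ℝ → Matrix (Fin T) (Fin T) ℝ}
    {f : ℝ → Vecs T} (h : IsSolution c S f) :
    IsStateSolution c (fun x => ((fun i j => S x i j, f x) : State T)) := by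
  have h0 : (0 : ℝ) ∈ Icc (0 : ℝ) 1 := ⟨le_rfl, zero_le_one⟩
  have h1 : (1 : ℝ) ∈ Icc (0 : ℝ) 1 := ⟨zero_le_one, le_rfl⟩
  set W : ℝ → State T := fun x => (fun i j => S x i j, f x) with hW
  have hmaps : MapsTo W (Icc 0 1) (posStates T) := fun x hx => h.posDef hc hx
  have hker : ∀ y ∈ Icc (0 : ℝ) 1, kernel c (S y) (f y) = rawKernel c (W y) := fun y hy =>
    kernel_eq_rawKernel hc (hmaps hy)
  have hprim : ∀ {p q u : ℝ → ℝ}, IntervalIntegrable p volume 0 1 →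
      IntervalIntegrable q volume 0 1 →
      (∀ x ∈ Icc (0 : ℝ) 1, u x = (∫ y in (0 : ℝ)..x, p y) + ∫ y in x..(1 : ℝ), q y) →
      ContinuousOn u (Icc 0 1) := by
    intro p q u hp hq hu
    have cp := intervalIntegral.continuousOn_primitive_interval' hp left_mem_uIcc
    have cq := (intervalIntegral.continuousOn_primitive_interval' hq right_mem_uIcc).neg
    rw [uIcc_of_le zero_le_one] at cp cq
    refine (cp.add cq).congr fun x hx => ?_
    rw [hu x hx]
    simp only [Pi.add_apply, Pi.neg_apply, intervalIntegral.integral_symm x (1 : ℝ)]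
    simp
  have hshift : ∀ (t : Fin T) (s : Fin (t.val + 1)),
      IntervalIntegrable (fun y => shiftCol (kernel c (S y) (f y)) t s) volume 0 1 := by
    intro t s
    refine Fin.cases ?_ (fun s => ?_) s
    · exact intervalIntegrable_const
    · exact h.integrable_kernel _ _
  have hcont : ContinuousOn W (Icc 0 1) := by
    refine ContinuousOn.prodMk ?_ ?_
    · exact continuousOn_pi.2 fun i => continuousOn_pi.2 fun j =>
        hprim (h.integrable_corr _ _) (h.integrable_corr _ _) fun x hx => h.eq_cov x hx i j
    · exact continuousOn_pi.2 fun t => continuousOn_pi.2 fun s =>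
        hprim (h.integrable_kernel _ _) (hshift t s) fun x hx => h.eq_drift x hx t s
  have hF : ContinuousOn (fun y => forwardRate c (W y)) (Icc 0 1) :=
    (contDiffOn_forwardRate hc).continuousOn.comp hcont hmaps
  have hG : ContinuousOn (fun y => backwardRate c (W y)) (Icc 0 1) :=
    (contDiffOn_backwardRate hc).continuousOn.comp hcont hmaps
  refine ⟨hcont, hmaps, fun x hx => Prod.ext ?_ ?_⟩
  · funext i j
    simp only [Prod.fst_add, Pi.add_apply]
    rw [integral_state_fst (intervalIntegrable_of_continuousOn_Icc hF h0 hx),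
      integral_state_fst (intervalIntegrable_of_continuousOn_Icc hG hx h1)]
    exact h.eq_cov x hx i j
  · funext t s
    simp only [Prod.snd_add, Pi.add_apply]
    rw [integral_state_snd (intervalIntegrable_of_continuousOn_Icc hF h0 hx),
      integral_state_snd (intervalIntegrable_of_continuousOn_Icc hG hx h1)]
    refine (h.eq_drift x hx t s).trans ?_
    congr 1
    · refine intervalIntegral.integral_congr fun y hy => ?_
      rw [uIcc_of_le hx.1] at hy
      simp only [hker y ⟨hy.1, hy.2.trans hx.2⟩, forwardRate]
    · refine intervalIntegral.integral_congr fun y hy => ?_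
      rw [uIcc_of_le hx.2] at hy
      simp only [hker y ⟨hx.1.trans hy.1, hy.2⟩, backwardRate]

theorem padState_mem_posStates_of_mem (t : ℕ) {z : State T} (hz : z ∈ posStates T) :
    padState t z ∈ posStates T := by
  obtain ⟨l, hl, h⟩ := exists_le_quadForm hz
  exact padState_mem_posStates hz.1 hl fun x _ => h x

theorem continuous_padState (t : ℕ) : Continuous (padState (T := T) t) :=
  (truncState t).continuous.add continuous_const

theorem padState_sub (t : ℕ) (z w : State T) :
    padState t z - padState t w = truncState t (z - w) := by
  rw [padState, padState, add_sub_add_right_eq_sub, map_sub]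

/-- The first passes of the forward rate are Lipschitz functions of the first passes. -/
theorem exists_norm_truncState_forwardRate_le (hc : IsUpdateRule c) {t : ℕ} (ht : t ≤ T)
    {Q : Set (State T)} (hQ : IsCompact Q) (hQP : Q ⊆ posStates T) :
    ∃ L : ℝ, ∀ z ∈ Q, ∀ w ∈ Q, ‖truncState t (forwardRate c z - forwardRate c w)‖ ≤
      L * ‖truncState t (z - w)‖ := by
  have hKP : padState t '' Q ⊆ posStates T := by
    rintro _ ⟨z, hz, rfl⟩
    exact padState_mem_posStates_of_mem _ (hQP hz)
  have hC1 : ContDiffOn ℝ 1 (forwardRate (T := T) c) (posStates T) :=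
    (contDiffOn_forwardRate hc).of_le (by exact_mod_cast le_top)
  obtain ⟨L, hL⟩ := LocallyLipschitzOn.exists_lipschitzOnWith_of_compact
    (hQ.image (continuous_padState t)) ((hC1.locallyLipschitzOn (convex_posStates T)).mono hKP)
  -- By causality the rate may be evaluated at the padded states, whose difference is exactly the
  -- truncated difference; this replaces the full norm by that of the first passes.
  have hpad : ∀ z ∈ Q, truncState t (forwardRate c z) =
      truncState t (forwardRate c (padState t z)) := fun z hz =>
    forwardRate_congr hc ht (hQP hz).posSemidef
      (padState_mem_posStates_of_mem _ (hQP hz)).posSemidef (truncState_padState _ _).symm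
  refine ⟨‖truncState (T := T) t‖ * L, fun z hz w hw => ?_⟩
  have h1 : truncState t (forwardRate c z - forwardRate c w) =
      truncState t (forwardRate c (padState t z) - forwardRate c (padState t w)) := by
    rw [map_sub, map_sub, hpad z hz, hpad w hw]
  have h2 := hL.norm_sub_le (mem_image_of_mem _ hz) (mem_image_of_mem _ hw)
  rw [padState_sub] at h2
  rw [h1, mul_assoc]
  exact ((truncState t).le_opNorm _).trans (mul_le_mul_of_nonneg_left h2 (norm_nonneg _))

/-- Uniqueness for the integro-difference system, one pass at a time. -/
theorem IsIntegralSolution.eqOn (hc : IsUpdateRule c) {W V : ℝ → State T}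
    (hW : IsStateSolution c W) (hV : IsStateSolution c V) : EqOn W V (Icc 0 1) := by
  have h0 : (0 : ℝ) ∈ Icc (0 : ℝ) 1 := ⟨le_rfl, zero_le_one⟩
  have h1 : (1 : ℝ) ∈ Icc (0 : ℝ) 1 := ⟨zero_le_one, le_rfl⟩
  have key : ∀ t ≤ T, ∀ x ∈ Icc (0 : ℝ) 1, truncState t (W x) = truncState t (V x) := by
    intro t
    induction t with
    | zero =>
      exact fun _ x _ => truncState_eq_iff.2 ⟨fun i j hi => absurd hi (Nat.not_lt_zero _),
        fun s hs => absurd hs (Nat.not_lt_zero _)⟩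
    | succ t ih =>
      intro ht
      have ih := ih (Nat.le_of_succ_le ht)
      set Q : Set (State T) := W '' Icc 0 1 ∪ V '' Icc 0 1
      have hQ : IsCompact Q := (isCompact_Icc.image_of_continuousOn hW.continuousOn).union
        (isCompact_Icc.image_of_continuousOn hV.continuousOn)
      have hQP : Q ⊆ posStates T := by
        rintro _ (⟨x, hx, rfl⟩ | ⟨x, hx, rfl⟩)
        · exact hW.mapsTo hx
        · exact hV.mapsTo hx
      obtain ⟨L, hL⟩ := exists_norm_truncState_forwardRate_le hc ht hQ hQP
      set A := truncState (T := T) (t + 1)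
      have hcont : ContinuousOn (fun y => A (forwardRate c (W y) - forwardRate c (V y))) (Icc 0 1) :=
        A.continuous.comp_continuousOn
          ((hW.continuousOn_forward hc).sub (hV.continuousOn_forward hc))
      have hlip : ∀ x ∈ Icc (0 : ℝ) 1, ‖A (forwardRate c (W x) - forwardRate c (V x))‖ ≤
          L * ‖A (W x - V x)‖ := fun x hx =>
        hL _ (Or.inl ⟨x, hx, rfl⟩) _ (Or.inr ⟨x, hx, rfl⟩)
      have heq : ∀ x ∈ Icc (0 : ℝ) 1, A (W x - V x) =
          ∫ y in (0 : ℝ)..x, A (forwardRate c (W y) - forwardRate c (V y)) := by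
        intro x hx
        have i1 := intervalIntegrable_of_continuousOn_Icc (hW.continuousOn_forward hc) h0 hx
        have i2 := intervalIntegrable_of_continuousOn_Icc (hV.continuousOn_forward hc) h0 hx
        have i3 := intervalIntegrable_of_continuousOn_Icc (hW.continuousOn_backward hc) hx h1
        have i4 := intervalIntegrable_of_continuousOn_Icc (hV.continuousOn_backward hc) hx h1
        -- The first `t + 1` passes of the backward rate depend on the first `t` passes only, where
        -- the two solutions already agree. What remains is a Volterra equation for the difference.
        have hback : (∫ y in x..(1 : ℝ), A (backwardRate c (W y) - backwardRate c (V y))) = 0 := by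
          rw [intervalIntegral.integral_congr (g := fun _ => (0 : State T)),
            intervalIntegral.integral_zero]
          intro y hy
          rw [uIcc_of_le hx.2] at hy
          have hy' : y ∈ Icc (0 : ℝ) 1 := ⟨hx.1.trans hy.1, hy.2⟩
          simp only [map_sub]
          exact sub_eq_zero.2 (backwardRate_congr hc (Nat.le_of_succ_le ht)
            (hW.mapsTo hy').posSemidef (hV.mapsTo hy').posSemidef (ih y hy'))
        rw [A.intervalIntegral_comp_comm (i1.sub i2)]
        rw [A.intervalIntegral_comp_comm (i3.sub i4)] at hback
        rw [intervalIntegral.integral_sub i1 i2]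
        rw [intervalIntegral.integral_sub i3 i4] at hback
        rw [hW.eq_integral x hx, hV.eq_integral x hx, add_sub_add_comm, map_add, hback, add_zero]
      intro x hx
      have := eq_zero_of_eq_integral hcont heq hlip hx
      rwa [map_sub, sub_eq_zero] at this
  intro x hx
  have := key T le_rfl x hx
  rwa [truncState_of_le le_rfl, truncState_of_le le_rfl] at this

end System

/-! ### From the difference equations to the abstract convergence statement. -/

section Main

variable {c : I × ℝ → ℝ} {T : ℕ} {δ : ℝ}

/-- Only the covariance equations enter, so positivity is available before anything is known about
the kernels and allows `kernel` to be replaced by `rawKernel` in the drift equations. -/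
theorem IsDifferenceSolution.mem_posStates (hc : IsUpdateRule c) (hδ : δ ∈ Ioo (0 : ℝ) 1)
    {Z : ℕ → State T} (h : IsDifferenceSolution c δ (fun j => (Z j).cov) fun j => (Z j).2) :
    ∀ j ≤ numBlocks δ, Z j ∈ posStates T := by
  have hcov : ∀ j ≤ numBlocks δ, ∀ s t : Fin T, (Z j).1 s t =
      δ * (∑ k ∈ Finset.Icc 1 (numBlocks δ) with k < j, corr c (Z k).cov (Z k).2 s.succ t.succ)
      + δ * ∑ k ∈ Finset.Icc 1 (numBlocks δ) with j ≤ k,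
        corr c (Z k).cov (Z k).2 s.castSucc t.castSucc := h.eq_cov
  exact fun j hj => posDef_of_discrete hc hδ
    (fun j hj => cov_eq_of_discrete (c := c) (Z := Z) (j := j) (hcov j hj)) hj

/-- The difference equations as a fixed point equation for states. -/
theorem isDifferenceSolution_iff (hc : IsUpdateRule c) (hδ : δ ∈ Ioo (0 : ℝ) 1)
    {Z : ℕ → State T} : IsDifferenceSolution c δ (fun j => (Z j).cov) (fun j => (Z j).2) ↔
      ∀ j ≤ numBlocks δ, Z j = discreteRhs c δ Z j := by
  have hle : ∀ {p : ℕ → Prop} [DecidablePred p] {k : ℕ},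
      k ∈ (Finset.Icc 1 (numBlocks δ)).filter p → k ≤ numBlocks δ := fun hk =>
    (Finset.mem_Icc.1 (Finset.mem_filter.1 hk).1).2
  have hdrift : (∀ j ≤ numBlocks δ, Z j ∈ posStates T) → ∀ j ≤ numBlocks δ, ∀ (t : Fin T)
      (s : Fin (t.val + 1)), (discreteRhs c δ Z j).2 t s =
      δ * (∑ k ∈ Finset.Icc 1 (numBlocks δ) with k < j,
        newCol (kernel c (Z k).cov (Z k).2) t s)
      + δ * (∑ k ∈ Finset.Icc 1 (numBlocks δ) with j < k,
        shiftCol (kernel c (Z k).cov (Z k).2) t s)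
      + δ * oldCol (kernel c (Z j).cov (Z j).2) t s := by
    intro hpos j hj t s
    rw [discreteRhs_snd, kernel_eq_rawKernel hc (hpos j hj)]
    congr 3
    · exact Finset.sum_congr rfl fun k hk => by rw [kernel_eq_rawKernel hc (hpos k (hle hk))]
    · exact Finset.sum_congr rfl fun k hk => by rw [kernel_eq_rawKernel hc (hpos k (hle hk))]
  constructor
  · intro h j hj
    have hpos := h.mem_posStates hc hδ
    refine Prod.ext (funext fun s => funext fun t => ?_) (funext fun t => funext fun s => ?_)
    · rw [discreteRhs_fst hj]
      exact h.eq_cov j hj s t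
    · rw [hdrift hpos j hj]
      exact h.eq_drift j hj t s
  · intro h
    have hcov : ∀ j ≤ numBlocks δ, ∀ s t : Fin T, (Z j).1 s t =
        δ * (∑ k ∈ Finset.Icc 1 (numBlocks δ) with k < j, corr c (Z k).cov (Z k).2 s.succ t.succ)
        + δ * ∑ k ∈ Finset.Icc 1 (numBlocks δ) with j ≤ k,
          corr c (Z k).cov (Z k).2 s.castSucc t.castSucc := fun j hj s t => by
      rw [← discreteRhs_fst hj, ← h j hj]
    have hpos : ∀ j ≤ numBlocks δ, Z j ∈ posStates T := fun j hj =>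
      posDef_of_discrete hc hδ
        (fun j hj => cov_eq_of_discrete (c := c) (Z := Z) (j := j) (hcov j hj)) hj
    exact ⟨fun j hj => (hpos j hj).posSemidef, hcov, fun j hj t s => by
      rw [← hdrift hpos j hj, ← h j hj]⟩

/-- Solutions of the difference equations are approximate solutions of the integral equation. -/
theorem exists_isApproxSolution (hc : IsUpdateRule c) (T : ℕ) :
    ∃ l B M : ℝ, 0 < l ∧ 0 ≤ M ∧ (∀ z ∈ boundedStates T l B, ‖forwardRate c z‖ ≤ M) ∧
      (∀ z ∈ boundedStates T l B, ‖backwardRate c z‖ ≤ M) ∧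
      ∀ δ ∈ Ioo (0 : ℝ) (1 / 4), ∀ Z : ℕ → State T,
        (∀ j ≤ numBlocks δ, Z j = discreteRhs c δ Z j) →
        IsApproxSolution (boundedStates T l B) (forwardRate c) (backwardRate c) M δ Z := by
  obtain ⟨l, B, hl, hb⟩ := exists_discrete_bounds hc T
  have hK := isCompact_boundedStates (T := T) l B
  have hsub := boundedStates_subset (T := T) hl B
  obtain ⟨M₁, h₁⟩ := hK.exists_bound_of_continuousOn
    ((contDiffOn_forwardRate hc).continuousOn.mono hsub)
  obtain ⟨M₂, h₂⟩ := hK.exists_bound_of_continuousOn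
    ((contDiffOn_backwardRate hc).continuousOn.mono hsub)
  -- The self term takes two forms, for `j ≥ 1` and for `j = 0`; both are bounded on the compact set
  -- and play the role of the error `e` in `IsApproxSolution`.
  obtain ⟨M₃, h₃⟩ := hK.exists_bound_of_continuousOn
    ((contDiffOn_selfRate hc True).continuousOn.mono hsub)
  obtain ⟨M₄, h₄⟩ := hK.exists_bound_of_continuousOn
    ((contDiffOn_selfRate hc False).continuousOn.mono hsub)
  set M := max (max (max M₁ M₂) (max M₃ M₄)) 0
  have l₁ : M₁ ≤ M := (le_max_left M₁ M₂).trans ((le_max_left _ _).trans (le_max_left _ _))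
  have l₂ : M₂ ≤ M := (le_max_right M₁ M₂).trans ((le_max_left _ _).trans (le_max_left _ _))
  have l₃ : M₃ ≤ M := (le_max_left M₃ M₄).trans ((le_max_right _ _).trans (le_max_left _ _))
  have l₄ : M₄ ≤ M := (le_max_right M₃ M₄).trans ((le_max_right _ _).trans (le_max_left _ _))
  refine ⟨l, B, M, hl, le_max_right _ _, fun z hz => (h₁ z hz).trans l₁,
    fun z hz => (h₂ z hz).trans l₂, fun δ hδ Z hZ => ?_⟩
  have hmem : ∀ j ≤ numBlocks δ, Z j ∈ boundedStates T l B := hb δ hδ.1 hδ.2.le Z hZ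
  refine ⟨hmem, fun j hj => ⟨selfRate c (1 ≤ j) (Z j), ?_, hZ j hj⟩⟩
  by_cases hj1 : 1 ≤ j
  · have e : selfRate c (1 ≤ j) (Z j) = selfRate c True (Z j) := by simp only [selfRate, hj1]
    rw [e]
    exact (h₃ _ (hmem j hj)).trans l₃
  · have e : selfRate c (1 ≤ j) (Z j) = selfRate c False (Z j) := by simp only [selfRate, hj1]
    rw [e]
    exact (h₄ _ (hmem j hj)).trans l₄

end Main

end BlockScan

theorem mainTheorem4 (c : unitInterval × ℝ → ℝ) (hc : IsUpdateRule c) (T : ℕ) :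
    ∃ (S : ℝ → Matrix (Fin T) (Fin T) ℝ) (f : ℝ → Vecs T),
      IsSolution c S f ∧
      (∀ x ∈ Icc (0 : ℝ) 1, Nondegenerate c (S x) (f x)) ∧
      (∀ s t, ContDiffOn ℝ ∞ (fun x => S x s t) (Icc 0 1)) ∧
      (∀ t s, ContDiffOn ℝ ∞ (fun x => f x t s) (Icc 0 1)) ∧
      (∀ (S' : ℝ → Matrix (Fin T) (Fin T) ℝ) (f' : ℝ → Vecs T), IsSolution c S' f' →
        ∀ x ∈ Icc (0 : ℝ) 1, S' x = S x ∧ f' x = f x) ∧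
      (∀ δ ∈ Ioo (0 : ℝ) 1, ∃ (D : ℕ → Matrix (Fin T) (Fin T) ℝ) (g : ℕ → Vecs T),
        IsDifferenceSolution c δ D g ∧
        (∀ j ≤ numBlocks δ, Nondegenerate c (D j) (g j)) ∧
        ∀ (D' : ℕ → Matrix (Fin T) (Fin T) ℝ) (g' : ℕ → Vecs T),
          IsDifferenceSolution c δ D' g' → ∀ j ≤ numBlocks δ, D' j = D j ∧ g' j = g j) ∧
      ∀ (D : ℝ → ℕ → Matrix (Fin T) (Fin T) ℝ) (g : ℝ → ℕ → Vecs T),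
        (∀ δ ∈ Ioo (0 : ℝ) 1, IsDifferenceSolution c δ (D δ) (g δ)) →
        (∀ s t, TendstoUniformlyOn (fun δ x => interp δ (fun j => D δ j s t) x)
          (fun x => S x s t) (𝓝[>] 0) (Icc 0 1)) ∧
        ∀ t s, TendstoUniformlyOn (fun δ x => interp δ (fun j => g δ j t s) x)
          (fun x => f x t s) (𝓝[>] 0) (Icc 0 1) := by
  obtain ⟨l, B, M, hl, hM, hF, hG, happ⟩ := exists_isApproxSolution hc T
  have hK := isCompact_boundedStates (T := T) l B
  have hconv := convex_boundedStates (T := T) l B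
  have hsub := boundedStates_subset (T := T) hl B
  have hFs := contDiffOn_forwardRate (T := T) hc
  have hGs := contDiffOn_backwardRate (T := T) hc
  have hFc := hFs.continuousOn.mono hsub
  have hGc := hGs.continuousOn.mono hsub
  have hfix : ∀ δ : ℝ, ∃ Z : ℕ → State T, 0 < δ → ∀ j ≤ numBlocks δ, Z j = discreteRhs c δ Z j := by
    intro δ
    by_cases hδ : 0 < δ
    · obtain ⟨Z, hZ⟩ := exists_discrete_fixedPoint hc T hδ
      exact ⟨Z, fun _ => hZ⟩
    · exact ⟨0, fun h => absurd h hδ⟩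
  choose Z hZ using hfix
  obtain ⟨W, hW⟩ := exists_isIntegralSolution hK hconv hFc hGc hM hF hG
    (δ₀ := 1 / 4) (by norm_num) fun δ hδ => happ δ hδ (Z δ) (hZ δ hδ.1)
  have hWs : IsStateSolution c W := hW.mono hsub
  have hsmooth := hWs.contDiffOn hFs hGs
  refine ⟨fun x => (W x).cov, fun x => (W x).2, hWs.isSolution hc,
    fun x hx => nondegenerate_of_posDef hc (hWs.mapsTo hx) _,
    fun s t => (contDiff_state_cov s t).comp_contDiffOn hsmooth,
    fun t s => (contDiff_state_drift t s).comp_contDiffOn hsmooth, ?_, ?_, ?_⟩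
  · intro S' f' h' x hx
    have h := (h'.isStateSolution hc).eqOn hc hWs hx
    exact ⟨congrArg State.cov h, congrArg Prod.snd h⟩
  · intro δ hδ
    have hsol := (isDifferenceSolution_iff hc hδ).2 (hZ δ hδ.1)
    have hpos := hsol.mem_posStates hc hδ
    refine ⟨fun j => (Z δ j).cov, fun j => (Z δ j).2, hsol,
      fun j hj => nondegenerate_of_posDef hc (hpos j hj) _, fun D' g' h' j hj => ?_⟩
    have h := discrete_fixedPoint_unique hc hδ.1 ((isDifferenceSolution_iff hc hδ
      (Z := fun j => (fun s t => D' j s t, g' j))).1 h') (hZ δ hδ.1) hj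
    exact ⟨congrArg State.cov h, congrArg Prod.snd h⟩
  · intro D g hD
    -- The given solutions need not be those chosen above: any family of solutions consists of
    -- approximate solutions for `δ < 1 / 4`, and the limit is identified by uniqueness. The
    -- entrywise claims follow by continuous linear projections.
    have hlim := tendstoUniformlyOn_vecInterp hK hconv hFc hGc hM hF hG
      (δ₀ := 1 / 4) (by norm_num) (Z := fun δ j => ((fun s t => D δ j s t, g δ j) : State T))
      (fun δ hδ => happ δ hδ _ ((isDifferenceSolution_iff hc ⟨hδ.1, hδ.2.trans (by norm_num)⟩).1
        (hD δ ⟨hδ.1, hδ.2.trans (by norm_num)⟩)))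
      (fun V hV => (hV.mono hsub).eqOn hc hWs)
    constructor
    · intro s t
      exact ((ContinuousLinearMap.proj (R := ℝ) t).comp ((ContinuousLinearMap.proj (R := ℝ) s).comp
        (ContinuousLinearMap.fst ℝ (Fin T → Fin T → ℝ)
          (Vecs T)))).uniformContinuous.comp_tendstoUniformlyOn hlim
    · intro t s
      exact ((ContinuousLinearMap.proj (R := ℝ) s).comp ((ContinuousLinearMap.proj (R := ℝ)
        (φ := fun t : Fin T => Fin (t.val + 1) → ℝ) t).comp
        (ContinuousLinearMap.snd ℝ (Fin T → Fin T → ℝ)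
          (Vecs T)))).uniformContinuous.comp_tendstoUniformlyOn hlim
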